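/- Consider the problem $$u_{tt}-u_{xx}+u+\lambda u_t=|u|^{p-2}u,\qquad 0<x<1,\ t>0,$$ $$u_x(0,t)=-|u(0,t)|^{\alpha-2}u(0,t)+\lambda_0u_t(0,t)+\tilde h_1(t)\,u(1,t)+\tilde\lambda_1u_t(1,t),$$ $$-u_x(1,t)=-|u(1,t)|^{\beta-2}u(1,t)+\lambda_1u_t(1,t)+\tilde h_0(t)\,u(0,t)+\tilde\lambda_0u_t(0,t),$$ $$u(x,0)=u_0(x),\qquad u_t(x,0)=u_1(x),$$ with real constants $p,\alpha,\beta>2$, $\lambda,\lambda_0,\lambda_1>0$, $\tilde\lambda_0=\tilde\lambda_1=\tilde\lambda$ with $|\tilde\lambda|<\sqrt{\lambda_0\lambda_1}$, and $\tilde h_0(t)=\tilde h_1(t)=\tilde h$ for all $t\ge 0$, where $\tilde h$ is a constant with $|\tilde h|<\frac{q-2}{4(q+2)}$, $q=\min\{p,\alpha,\beta\}$. Let $(u_0,u_1)\in H^1(0,1)\times L^2(0,1)$. Write $\|\cdot\|$ and $\langle\cdot,\cdot\rangle$ for the norm and inner product of $L^2(0,1)$ and $\|v\|_1^2=\|v\|^2+\|v_x\|^2$;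 functions in $H^1(0,1)$ are identified with their continuous representatives on $[0,1]$. A weak solution on $[0,S]$, $0<S<\infty$, is a function $u\in C([0,S];H^1(0,1))\cap C^1([0,S];L^2(0,1))$ with $u(0,\cdot),u(1,\cdot)\in H^1(0,S)$, $u(0)=u_0$, $u'(0)=u_1$, such that for every $w\in H^1(0,1)$, in the sense of distributions on $(0,S)$, $$\begin{aligned}&\tfrac{d}{dt}\langle u'(t),w\rangle+\langle u_x(t),w_x\rangle+\langle u(t),w\rangle+\lambda\langle u'(t),w\rangle\\&\quad+\big(\lambda_0u'(0,t)+\tilde h_1(t)u(1,t)+\tilde\lambda_1u'(1,t)\big)w(0)+\big(\lambda_1u'(1,t)+\tilde h_0(t)u(0,t)+\tilde\lambda_0u'(0,t)\big)w(1)\\&=\langle|u(t)|^{p-2}u(t),w\rangle+|u(0,t)|^{\alpha-2}u(0,t)w(0)+|u(1,t)|^{\beta-2}u(1,t)w(1).\end{aligned}$$ A weak solution on $[0,T)$, $0<T\le\infty$, is a function that is a weak solution on $[0,S]$ for every $0<S<T$. It is maximal if no weak solution on a longer interval $[0,S)$, $T<S\le\infty$, extends it. **Theorem 3.1.** Let $E(0)=\frac12\|u_1\|^2+\frac12\|u_0\|_1^2-\frac1p\|u_0\|_{L^p}^p-\frac1\alpha|u_0(0)|^\alpha-\frac1\beta|u_0(1)|^\beta$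 and suppose that $H(0)=-E(0)-\tilde h\,u_0(0)u_0(1)>0$. Then every maximal weak solution $u$, with maximal interval of existence $[0,T)$, blows up in finite time: $T<\infty$ and $$\lim_{t\to T^-}\big(\|u'(t)\|^2+\|u(t)\|_1^2\big)=\infty .$$ -/

import Mathlib

open MeasureTheory Set Filter Topology
open scoped ContDiff

noncomputable section

namespace TwoPointWave

/-- `g` is the weak (distributional) derivative of `f` on the interval `(a, b)`. It is used for
functions `f`, `g` that are locally integrable on `(a, b)`. -/
def HasWeakDeriv (a b : ℝ) (f g : ℝ → ℝ) : Prop :=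
  ∀ φ : ℝ → ℝ, ContDiff ℝ ∞ φ → HasCompactSupport φ → tsupport φ ⊆ Ioo a b →
    ∫ x in Ioo a b, f x * deriv φ x = -∫ x in Ioo a b, g x * φ x

/-- The real Hilbert space `L² = L²(0, 1)`. -/
abbrev L2 : Type := Lp ℝ 2 (volume.restrict (Ioo (0 : ℝ) 1))

lemma integrable_mul_of_L2 (f : L2) {φ : ℝ → ℝ} (hφ : Continuous φ) (hc : HasCompactSupport φ) :
    Integrable (fun x => f x * φ x) (volume.restrict (Ioo (0 : ℝ) 1)) :=
  (Lp.memLp f).integrable_mul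
    ((hφ.memLp_of_hasCompactSupport (p := 2) (μ := volume) hc).mono_measure
      Measure.restrict_le_self)

/-- The pairs `(v, v_x)` in `L² × L²` such that `v_x` is the weak derivative of `v`. -/
def h1Submodule : Submodule ℝ (WithLp 2 (L2 × L2)) where
  carrier := {z | HasWeakDeriv 0 1 z.fst z.snd}
  zero_mem' := by
    have h0 : ∀ᵐ x ∂volume.restrict (Ioo (0 : ℝ) 1), (0 : L2) x = 0 := Lp.coeFn_zero _ _ _
    have key : ∀ ψ : ℝ → ℝ, ∫ x in Ioo (0 : ℝ) 1, (0 : L2) x * ψ x = 0 := fun ψ =>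
      integral_eq_zero_of_ae (h0.mono fun x hx => by simp only [hx, zero_mul, Pi.zero_apply])
    intro φ _ _ _
    rw [WithLp.zero_fst, WithLp.zero_snd, key, key, neg_zero]
  add_mem' := by
    intro y z hy hz φ h1 h2 h3
    have hd : Continuous (deriv φ) := h1.continuous_deriv (by simp)
    have key : ∀ (f g : L2) (ψ : ℝ → ℝ), Continuous ψ → HasCompactSupport ψ →
        ∫ x in Ioo (0 : ℝ) 1, (f + g : L2) x * ψ x
          = (∫ x in Ioo (0 : ℝ) 1, f x * ψ x) + ∫ x in Ioo (0 : ℝ) 1, g x * ψ x := by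
      intro f g ψ hψ hc
      rw [← integral_add (integrable_mul_of_L2 f hψ hc) (integrable_mul_of_L2 g hψ hc)]
      refine integral_congr_ae ?_
      filter_upwards [Lp.coeFn_add f g] with x hx
      rw [hx, Pi.add_apply, add_mul]
    rw [WithLp.add_fst, WithLp.add_snd, key _ _ _ hd h2.deriv, key _ _ _ h1.continuous h2,
      hy φ h1 h2 h3, hz φ h1 h2 h3]
    ring
  smul_mem' := by
    intro c z hz φ h1 h2 h3
    have key : ∀ (f : L2) (ψ : ℝ → ℝ), ∫ x in Ioo (0 : ℝ) 1, (c • f : L2) x * ψ x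
          = c * ∫ x in Ioo (0 : ℝ) 1, f x * ψ x := by
      intro f ψ
      rw [← integral_const_mul]
      refine integral_congr_ae ?_
      filter_upwards [Lp.coeFn_smul c f] with x hx
      rw [hx, Pi.smul_apply, smul_eq_mul, mul_assoc]
    rw [WithLp.smul_fst, WithLp.smul_snd, key, key, hz φ h1 h2 h3]
    ring

/-- The Sobolev space `H¹ = H¹(0, 1)`. An element `v` is stored together with its weak derivative
`v_x`, which is determined by `v`; the norm is `‖v‖₁ = (‖v‖² + ‖v_x‖²)^{1/2}`. -/
abbrev H1 : Type := h1Submodule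

/-- The element of `L²` underlying `v ∈ H¹`. -/
def H1.toL2 (v : H1) : L2 := (v : WithLp 2 (L2 × L2)).fst

/-- The weak derivative `v_x ∈ L²` of `v ∈ H¹`. -/
def H1.dx (v : H1) : L2 := (v : WithLp 2 (L2 × L2)).snd

lemma H1.norm_sq (v : H1) : ‖v‖ ^ 2 = ‖v.toL2‖ ^ 2 + ‖v.dx‖ ^ 2 :=
  WithLp.prod_norm_sq_eq_of_L2 _

lemma L2.intervalIntegrable (g : L2) : IntervalIntegrable g volume 0 1 := by
  rw [intervalIntegrable_iff_integrableOn_Ioo_of_le zero_le_one]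
  exact (Lp.memLp g).integrable one_le_two

/-- Integration by parts for a primitive of an `L²` function. -/
lemma hasWeakDeriv_primitive (g : L2) : HasWeakDeriv 0 1 (fun x => ∫ t in (0 : ℝ)..x, g t) g := by
  intro φ h1 h2 h3
  have hg := L2.intervalIntegrable g
  have hac := hg.absolutelyContinuousOnInterval_intervalIntegral
    (c := 0) (by simp : (0 : ℝ) ∈ uIcc 0 1)
  have hφ : AbsolutelyContinuousOnInterval φ 0 1 := by
    have hd : Continuous (deriv φ) := h1.continuous_deriv (by simp)
    have := (hd.intervalIntegrable (μ := volume) 0 1).absolutelyContinuousOnInterval_intervalIntegral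
      (c := 0) (by simp : (0 : ℝ) ∈ uIcc 0 1)
    have h0 : φ 0 = 0 := by
      by_contra h
      have := h3 (subset_tsupport φ h)
      simp at this
    have e : (fun x => ∫ t in (0 : ℝ)..x, deriv φ t) = φ := by
      funext x
      rw [intervalIntegral.integral_deriv_eq_sub
        (fun y _ => (h1.differentiable (by simp)).differentiableAt)
        (hd.intervalIntegrable _ _), h0, sub_zero]
    rwa [e] at this
  have h11 : φ 1 = 0 := by
    by_contra h
    have := h3 (subset_tsupport φ h)
    simp at this
  have ibp := hac.integral_mul_deriv_eq_deriv_mul hφ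
  rw [h11] at ibp
  simp only [intervalIntegral.integral_same, zero_mul, mul_zero, sub_zero, zero_sub] at ibp
  rw [intervalIntegral.integral_of_le zero_le_one, intervalIntegral.integral_of_le zero_le_one,
    integral_Ioc_eq_integral_Ioo, integral_Ioc_eq_integral_Ioo] at ibp
  rw [ibp]
  congr 1
  refine integral_congr_ae ?_
  rw [EventuallyEq, ae_restrict_iff' measurableSet_Ioo]
  filter_upwards [hg.ae_hasDerivAt_integral] with x hx hxI
  rw [(hx (by rw [uIcc_of_le zero_le_one]; exact Ioo_subset_Icc_self hxI) 0 (by simp)).deriv]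


/-- A function whose weak derivative on `(0, 1)` vanishes is almost everywhere constant. -/
lemma ae_const_of_hasWeakDeriv_zero {d : ℝ → ℝ} (hd : IntegrableOn d (Ioo (0 : ℝ) 1))
    (h : HasWeakDeriv 0 1 d 0) :
    ∃ c : ℝ, d =ᵐ[volume.restrict (Ioo (0 : ℝ) 1)] fun _ => c := by
  let ψ : ContDiffBump (1 / 2 : ℝ) := ⟨1 / 8, 1 / 4, by norm_num, by norm_num⟩
  have hψs : tsupport (ψ.normed volume) ⊆ Ioo 0 1 := by
    rw [ψ.tsupport_normed_eq, Real.closedBall_eq_Icc]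
    intro x hx
    simp only [ψ, mem_Icc] at hx
    constructor <;> linarith [hx.1, hx.2]
  have hψd : ContDiff ℝ ∞ (ψ.normed volume) := ψ.contDiff_normed
  have hψc : HasCompactSupport (ψ.normed volume) := ψ.hasCompactSupport_normed
  have hψi : ∫ x, ψ.normed volume x = 1 := ψ.integral_normed
  generalize ψ.normed volume = w at hψs hψd hψc hψi
  have hint : ∀ θ : ℝ → ℝ, Continuous θ → HasCompactSupport θ →
      IntegrableOn (fun x => d x * θ x) (Ioo (0 : ℝ) 1) := by
    intro θ h1 h2
    obtain ⟨C, hC⟩ := h1.bounded_above_of_compact_support h2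
    exact Integrable.mul_bdd (c := C) hd h1.aestronglyMeasurable (Eventually.of_forall hC)
  refine ⟨∫ x in Ioo (0 : ℝ) 1, d x * w x, ?_⟩
  set c := ∫ x in Ioo (0 : ℝ) 1, d x * w x with hc
  have hz : ∀ᵐ x, x ∈ Ioo (0 : ℝ) 1 → d x - c = 0 := by
    refine isOpen_Ioo.ae_eq_zero_of_integral_contDiff_smul_eq_zero
      ((hd.sub (integrableOn_const (by simp))).locallyIntegrableOn) ?_
    intro θ h1 h2 h3
    set m := ∫ x, θ x with hm
    let ζ : ℝ → ℝ := fun x => θ x - m * w x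
    have hζ : ContDiff ℝ ∞ ζ := h1.sub (contDiff_const.mul hψd)
    let φ : ℝ → ℝ := fun x => ∫ t in (0 : ℝ)..x, ζ t
    have hφd : ∀ x, HasDerivAt φ (ζ x) x := fun x =>
      intervalIntegral.integral_hasDerivAt_right (hζ.continuous.intervalIntegrable _ _)
        hζ.continuous.stronglyMeasurable.stronglyMeasurableAtFilter hζ.continuous.continuousAt
    have hφe : deriv φ = ζ := funext fun x => (hφd x).deriv
    have hφ : ContDiff ℝ ∞ φ := by
      rw [contDiff_infty_iff_deriv]
      exact ⟨fun x => (hφd x).differentiableAt, by rwa [hφe]⟩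
    -- the common support of the two test functions lies in a compact subinterval
    obtain ⟨a, b, ha, hb, hab⟩ : ∃ a b : ℝ, 0 < a ∧ b < 1 ∧
        tsupport θ ∪ tsupport w ⊆ Icc a b := by
      have hK : IsCompact (tsupport θ ∪ tsupport w) := h2.isCompact.union hψc.isCompact
      have hne : (tsupport θ ∪ tsupport w).Nonempty := by
        rw [nonempty_iff_ne_empty]
        intro he
        have hw : w = 0 := by
          rw [← tsupport_eq_empty_iff]
          exact (union_empty_iff.mp he).2
        simp [hw] at hψi
      have hsub : tsupport θ ∪ tsupport w ⊆ Ioo 0 1 := union_subset h3 hψs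
      exact ⟨_, _, (hsub (hK.sInf_mem hne)).1, (hsub (hK.sSup_mem hne)).2,
        fun x hx => ⟨csInf_le hK.bddBelow hx, le_csSup hK.bddAbove hx⟩⟩
    have hζ0 : ∀ x, x ∉ Icc a b → ζ x = 0 := by
      intro x hx
      have h4 : θ x = 0 := image_eq_zero_of_notMem_tsupport fun h => hx (hab (Or.inl h))
      have h5 : w x = 0 := image_eq_zero_of_notMem_tsupport fun h => hx (hab (Or.inr h))
      simp [ζ, h4, h5]
    have hζi : ∫ x, ζ x = 0 := by
      simp only [ζ]
      rw [integral_sub (h1.continuous.integrable_of_hasCompactSupport h2)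
        ((hψd.continuous.integrable_of_hasCompactSupport hψc).const_mul m), integral_const_mul,
        hψi, ← hm]
      ring
    have hφ0 : ∀ x, x ∉ Icc a b → φ x = 0 := by
      intro x hx
      rcases lt_or_ge x a with hxa | hxa
      · refine intervalIntegral.integral_zero_ae (Eventually.of_forall fun t ht => hζ0 t ?_)
        intro ht'
        rcases mem_uIoc.mp ht with h | h <;> linarith [hx, h.1, h.2, ht'.1]
      · have hxb : b < x := by
          by_contra hh
          exact hx ⟨hxa, not_lt.mp hh⟩
        rcases lt_or_ge b a with hba | hba
        · refine intervalIntegral.integral_zero_ae (Eventually.of_forall fun t _ => hζ0 t ?_)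
          intro hh
          linarith [hh.1, hh.2]
        · rw [← hζi]
          simp only [φ]
          rw [intervalIntegral.integral_of_le (by linarith)]
          refine setIntegral_eq_integral_of_forall_compl_eq_zero fun t ht => hζ0 t ?_
          intro hh
          exact ht ⟨by linarith [hh.1], by linarith [hh.2]⟩
    have hφs : tsupport φ ⊆ Icc a b :=
      closure_minimal (fun x hx => by_contra fun hh => hx (hφ0 x hh)) isClosed_Icc
    have hφc : HasCompactSupport φ := isCompact_Icc.of_isClosed_subset (isClosed_tsupport _) hφs
    have := h φ hφ hφc fun x hx => ⟨by linarith [(hφs hx).1], by linarith [(hφs hx).2]⟩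
    simp only [hφe, Pi.zero_apply, zero_mul, integral_zero, neg_zero, ζ] at this
    have e1 : ∫ x in Ioo (0 : ℝ) 1, d x * (θ x - m * w x)
        = (∫ x in Ioo (0 : ℝ) 1, d x * θ x) - m * c := by
      rw [hc, ← integral_const_mul, ← integral_sub (hint θ h1.continuous h2)
        ((hint w hψd.continuous hψc).const_mul m)]
      congr 1
      funext x
      ring
    have e2 : ∫ x, θ x • (d x - c) = ∫ x in Ioo (0 : ℝ) 1, θ x • (d x - c) := by
      refine (setIntegral_eq_integral_of_forall_compl_eq_zero fun x hx => ?_).symm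
      rw [image_eq_zero_of_notMem_tsupport fun hh => hx (h3 hh), zero_smul]
    have e3 : ∫ x in Ioo (0 : ℝ) 1, θ x = m :=
      setIntegral_eq_integral_of_forall_compl_eq_zero fun x hx =>
        image_eq_zero_of_notMem_tsupport fun hh => hx (h3 hh)
    have e4 : ∫ x in Ioo (0 : ℝ) 1, θ x • (d x - c)
        = (∫ x in Ioo (0 : ℝ) 1, d x * θ x) - c * m := by
      rw [← e3, ← integral_const_mul, ← integral_sub (hint θ h1.continuous h2)
        ((h1.continuous.integrable_of_hasCompactSupport h2).integrableOn.const_mul c)]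
      congr 1
      funext x
      simp only [smul_eq_mul]
      ring
    rw [e2, e4]
    linarith
  rw [EventuallyEq, ae_restrict_iff' measurableSet_Ioo]
  filter_upwards [hz] with x hx hxI
  linarith [hx hxI]

/-- Every element of `H¹` has a representative that is continuous on `[0, 1]`. -/
lemma H1.exists_rep (v : H1) : ∃ f : ℝ → ℝ, ContinuousOn f (Icc 0 1) ∧
    f =ᵐ[volume.restrict (Ioo (0 : ℝ) 1)] v.toL2 := by
  let F : ℝ → ℝ := fun x => ∫ t in (0 : ℝ)..x, v.dx t
  have hF : ContinuousOn F (Icc 0 1) := by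
    have := ((L2.intervalIntegrable v.dx).absolutelyContinuousOnInterval_intervalIntegral
      (c := 0) (by simp : (0 : ℝ) ∈ uIcc 0 1)).continuousOn
    rwa [uIcc_of_le zero_le_one] at this
  have hFi : IntegrableOn F (Ioo (0 : ℝ) 1) :=
    (hF.integrableOn_compact isCompact_Icc).mono_set Ioo_subset_Icc_self
  have hvi : IntegrableOn v.toL2 (Ioo (0 : ℝ) 1) := (Lp.memLp v.toL2).integrable one_le_two
  obtain ⟨c, hc⟩ := ae_const_of_hasWeakDeriv_zero (hvi.sub hFi) (by
    intro φ h1 h2 h3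
    have hd : Continuous (deriv φ) := h1.continuous_deriv (by simp)
    have hFm : IntegrableOn (fun x => F x * deriv φ x) (Ioo (0 : ℝ) 1) :=
      ((hF.mul hd.continuousOn).integrableOn_compact isCompact_Icc).mono_set Ioo_subset_Icc_self
    have e1 := v.2 φ h1 h2 h3
    have e2 := hasWeakDeriv_primitive v.dx φ h1 h2 h3
    simp only [Pi.sub_apply, sub_mul, Pi.zero_apply, zero_mul, integral_zero, neg_zero]
    rw [integral_sub (integrable_mul_of_L2 _ hd h2.deriv) hFm]
    exact sub_eq_zero.mpr (e1.trans e2.symm))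
  refine ⟨fun x => F x + c, hF.add continuousOn_const, ?_⟩
  filter_upwards [hc] with x hx
  simp only [Pi.sub_apply] at hx
  linarith

/-- The continuous representative of `v ∈ H¹`; its values at points of `[0, 1]`, in particular the
boundary values `v(0)` and `v(1)`, are determined by `v`. -/
def H1.rep (v : H1) : ℝ → ℝ := Classical.choose v.exists_rep

lemma H1.rep_continuousOn (v : H1) : ContinuousOn v.rep (Icc 0 1) :=
  (Classical.choose_spec v.exists_rep).1

lemma H1.rep_ae_eq (v : H1) : v.rep =ᵐ[volume.restrict (Ioo (0 : ℝ) 1)] v.toL2 :=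
  (Classical.choose_spec v.exists_rep).2

/-- The coefficients of the problem
`u_tt - u_xx + u + λ u_t = |u|^{p-2} u` for `0 < x < 1`, `t > 0`,
`u_x(0,t) = -|u(0,t)|^{α-2} u(0,t) + λ₀ u_t(0,t) + h̃₁(t) u(1,t) + λ̃₁ u_t(1,t)`,
`-u_x(1,t) = -|u(1,t)|^{β-2} u(1,t) + λ₁ u_t(1,t) + h̃₀(t) u(0,t) + λ̃₀ u_t(0,t)`. -/
structure Coeffs where
  /-- the exponent `p` -/
  p : ℝ
  /-- the exponent `α` -/
  α : ℝ
  /-- the exponent `β` -/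
  β : ℝ
  /-- the damping coefficient `λ` -/
  lam : ℝ
  /-- `λ₀` -/
  lam0 : ℝ
  /-- `λ₁` -/
  lam1 : ℝ
  /-- `λ̃₀` -/
  lamT0 : ℝ
  /-- `λ̃₁` -/
  lamT1 : ℝ
  /-- the function `h̃₀` -/
  hT0 : ℝ → ℝ
  /-- the function `h̃₁` -/
  hT1 : ℝ → ℝ

/-- For `v, w ∈ H¹`, `v' ∈ L²` and numbers `d₀`, `d₁` (the values of `u`, the test function, `u_t`,
`u_t(0,t)` and `u_t(1,t)`), the value at time `t` of
`⟨|v|^{p-2}v, w⟩ + |v(0)|^{α-2}v(0)w(0) + |v(1)|^{β-2}v(1)w(1) - ⟨v_x, w_x⟩ - ⟨v, w⟩ - λ⟨v', w⟩`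
`- (λ₀ d₀ + h̃₁(t)v(1) + λ̃₁ d₁)w(0) - (λ₁ d₁ + h̃₀(t)v(0) + λ̃₀ d₀)w(1)`. -/
def weakRHS (c : Coeffs) (t : ℝ) (v : H1) (v' : L2) (d0 d1 : ℝ) (w : H1) : ℝ :=
  (∫ x in Ioo (0 : ℝ) 1, |v.rep x| ^ (c.p - 2) * v.rep x * w.rep x)
    + |v.rep 0| ^ (c.α - 2) * v.rep 0 * w.rep 0
    + |v.rep 1| ^ (c.β - 2) * v.rep 1 * w.rep 1
    - inner ℝ v.dx w.dx - inner ℝ v.toL2 w.toL2 - c.lam * inner ℝ v' w.toL2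
    - (c.lam0 * d0 + c.hT1 t * v.rep 1 + c.lamT1 * d1) * w.rep 0
    - (c.lam1 * d1 + c.hT0 t * v.rep 0 + c.lamT0 * d0) * w.rep 1

/-- `u` (with time derivative `u'`) is a weak solution on `[0, T]` with initial data `(u₀, u₁)`:
`u ∈ C([0,T]; H¹) ∩ C¹([0,T]; L²)`, the boundary values `u(0,·)` and `u(1,·)` are in `H¹(0,T)`, the
initial conditions hold, and for every `w ∈ H¹` the equation
`d/dt ⟨u'(t), w⟩ = weakRHS` holds in the sense of distributions on `(0, T)`. -/
structure IsWeakSolutionOn (c : Coeffs) (u₀ : H1) (u₁ : L2) (u : ℝ → H1) (u' : ℝ → L2) (T : ℝ) :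
    Prop where
  continuousOn : ContinuousOn u (Icc 0 T)
  hasDeriv : ∀ t ∈ Icc 0 T, HasDerivWithinAt (fun s => (u s).toL2) (u' t) (Icc 0 T) t
  continuousOn_deriv : ContinuousOn u' (Icc 0 T)
  init : u 0 = u₀
  init_deriv : u' 0 = u₁
  weak_eq : ∃ d0 d1 : ℝ → ℝ,
    MemLp d0 2 (volume.restrict (Ioo 0 T)) ∧ MemLp d1 2 (volume.restrict (Ioo 0 T)) ∧
    HasWeakDeriv 0 T (fun t => (u t).rep 0) d0 ∧ HasWeakDeriv 0 T (fun t => (u t).rep 1) d1 ∧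
    ∀ w : H1, HasWeakDeriv 0 T (fun t => inner ℝ (u' t) w.toL2)
      (fun t => weakRHS c t (u t) (u' t) (d0 t) (d1 t) w)

/-- `u` is a weak solution on `[0, T)`, where `0 < T ≤ ∞`. -/
def IsWeakSolution (c : Coeffs) (u₀ : H1) (u₁ : L2) (u : ℝ → H1) (u' : ℝ → L2) (T : EReal) : Prop :=
  0 < T ∧ ∀ S : ℝ, 0 < S → (S : EReal) < T → IsWeakSolutionOn c u₀ u₁ u u' S

/-- `u` is a maximal weak solution, with maximal interval of existence `[0, T)`, `0 < T ≤ ∞`: it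
is a weak solution on `[0, T)` and no weak solution on a longer interval extends it. -/
def IsMaximalWeakSolution (c : Coeffs) (u₀ : H1) (u₁ : L2) (u : ℝ → H1) (u' : ℝ → L2) (T : EReal) :
    Prop :=
  IsWeakSolution c u₀ u₁ u u' T ∧
    ¬ ∃ (S : EReal) (v : ℝ → H1) (v' : ℝ → L2), T < S ∧ IsWeakSolution c u₀ u₁ v v' S ∧
      ∀ t : ℝ, 0 ≤ t → (t : EReal) < T → v t = u t

/-- The energy
`E = ½‖v'‖² + ½‖v‖₁² - (1/p)‖v‖_{L^p}^p - (1/α)|v(0)|^α - (1/β)|v(1)|^β` of a state `(v, v')`. -/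
def energy (c : Coeffs) (v : H1) (v' : L2) : ℝ :=
  1 / 2 * ‖v'‖ ^ 2 + 1 / 2 * ‖v‖ ^ 2 - 1 / c.p * (∫ x in Ioo (0 : ℝ) 1, |v.rep x| ^ c.p)
    - 1 / c.α * |v.rep 0| ^ c.α - 1 / c.β * |v.rep 1| ^ c.β

end TwoPointWave

end

open TwoPointWave

/-! This is a concavity-type argument at negative energy. Let H(t) be `potential` minus ½(‖u‖₁² +
‖u'‖²); its initial value is the positive number H(0) of the hypothesis. The damping is dissipative,
so H(t) ≥ H(0) along a solution (`Coeffs.Admissible.energy_le`). Let γ be the trace and B the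
boundary damping matrix. The virial functional M = ⟨u', u⟩ + λ/2 ‖u‖² + ½⟨Bγu, γu⟩ is built so that
all damping terms disappear from its derivative, which is ‖u'‖² - ‖u‖₁² + (source mass) -
2h̃u(0)u(1). Splitting off (q+2)/2 times H and bounding the coupling by the trace inequality leaves
M' ≥ κW with W = 1 + ‖u'‖² + (source mass) (`virial_deriv_ge`). Since |M| ≤ C W^{1/2+1/q}
(`exists_abs_virial_le`) and s = 2q/(q+2) > 1 is the reciprocal of that exponent, M' dominates both
a positive constant and a multiple of |M|^s, which is impossible on a half-line
(`not_superlinear_growth`). Hence T < ∞ (`not_global`).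

That the norm tends to infinity at T follows from a continuation argument (`tendsto_of_maximal`). If
the norm were below some A at times arbitrarily close to T, a restart from such a time would live
for a duration depending only on A and would extend the solution. This needs local existence with
uniform lifespan (`exists_weakSolution`) and uniqueness (`weakSolution_unique`). An H¹ bound is a
sup bound, so both reduce to truncated, globally Lipschitz sources.

The reduced problem is an abstract equation in V = H¹: the derivative of `mom` is `frc`. The
velocities of the traces exist only as square integrable functions of time; writing their
contribution as the derivative of γ*Bγu turns the distributional equation into a C¹ equation between
continuous curves in V. Since u' takes values in L² only, it is not an admissible test function. The
energy inequality (`IsSol.energy_le`) therefore tests with forward difference quotients of u and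
then lets the step tend to zero.

Existence (`exists_isSol`) comes from adding an inertia term εu'' in V, which makes the equation an
ordinary differential equation. For data satisfying a compatibility condition the regularized
solutions have bounds uniform in ε. Such data are dense, and a choice of ε adapted to the data makes
the approximations Cauchy in the energy norm together with the boundary dissipation. -/

set_option linter.unusedSectionVars false

noncomputable section

namespace TwoPointWave

/-! ### Primitives and forward difference quotients. -/

section Calculus

variable {E : Type*} [NormedAddCommGroup E] [NormedSpace ℝ E]

/-- A continuous function on `[a, b]` has a primitive. -/
lemma exists_primitive [CompleteSpace E] {f : ℝ → E} {a b : ℝ} (hf : ContinuousOn f (Icc a b)) :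
    ∃ F : ℝ → E, F a = 0 ∧ ∀ t ∈ Icc a b, HasDerivWithinAt F (f t) (Icc a b) t := by
  rcases le_or_gt a b with hab | hab
  · have hc : Continuous (IccExtend hab ((Icc a b).domRestrict f)) :=
      (continuousOn_iff_continuous_domRestrict.mp hf).Icc_extend'
    refine ⟨fun t => ∫ s in a..t, IccExtend hab ((Icc a b).domRestrict f) s, by simp, fun t ht => ?_⟩
    have := (intervalIntegral.integral_hasDerivAt_right (a := a) (b := t)
      (hc.intervalIntegrable _ _) hc.stronglyMeasurable.stronglyMeasurableAtFilter
      hc.continuousAt).hasDerivWithinAt (s := Icc a b)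
    rwa [IccExtend_of_mem _ _ ht] at this
  · refine ⟨0, rfl, fun t ht => ?_⟩
    simp [Icc_eq_empty (not_le.mpr hab)] at ht

/-- Curves are differentiated within closed intervals, whereas the mean value and Gronwall
inequalities ask for right derivatives. -/
lemma hasDerivWithinAt_Ici_of_Icc {X : ℝ → E} {x : E} {a b t : ℝ}
    (h : HasDerivWithinAt X x (Icc a b) t) (ha : a ≤ t) (hb : t < b) :
    HasDerivWithinAt X x (Ici t) t :=
  h.mono_of_mem_nhdsWithin (mem_of_superset (Icc_mem_nhdsGE hb) (Icc_subset_Icc_left ha))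

/-- Two functions with the same derivative on `[a, b]` differ by a constant. -/
lemma sub_eq_sub_of_hasDerivWithinAt {X Y x : ℝ → E} {a b : ℝ}
    (hX : ∀ t ∈ Icc a b, HasDerivWithinAt X (x t) (Icc a b) t)
    (hY : ∀ t ∈ Icc a b, HasDerivWithinAt Y (x t) (Icc a b) t) {t : ℝ} (ht : t ∈ Icc a b) :
    X t - Y t = X a - Y a := by
  have hd : ∀ t ∈ Icc a b, HasDerivWithinAt (fun s => X s - Y s) 0 (Icc a b) t := fun t ht => by
    simpa using! (hX t ht).sub (hY t ht)
  have := norm_image_sub_le_of_norm_deriv_right_le_segment (C := 0) (a := a) (b := b)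
    (f := fun s => X s - Y s) (f' := fun _ => 0) (fun t ht => (hd t ht).continuousWithinAt)
    (fun t ht => hasDerivWithinAt_Ici_of_Icc (hd t ⟨ht.1, ht.2.le⟩) ht.1 ht.2)
    (by simp) t ht
  simpa [sub_eq_zero] using this

/-- The forward difference quotient. -/
def dq (h : ℝ) (X : ℝ → E) (t : ℝ) : E := h⁻¹ • (X (t + h) - X t)

lemma dq_hasDerivWithinAt {X x : ℝ → E} {a b t h : ℝ}
    (hX : ∀ t ∈ Icc a b, HasDerivWithinAt X (x t) (Icc a b) t) (ha : a ≤ t) (hh : 0 ≤ h)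
    (hb : t + h < b) : HasDerivWithinAt (dq h X) (dq h x t) (Ici t) t := by
  have h1 := hasDerivWithinAt_Ici_of_Icc (hX t ⟨ha, by linarith⟩) ha (by linarith)
  have h2 := hasDerivWithinAt_Ici_of_Icc (hX (t + h) ⟨by linarith, hb.le⟩) (by linarith) hb
  have h3 : HasDerivWithinAt (fun s => X (s + h)) (x (t + h)) (Ici t) t := by
    have := h2.scomp t (h' := 1) (h := fun s => s + h) (s := Ici t)
      (((hasDerivAt_id t).add_const h).hasDerivWithinAt) (fun s hs => by
        simpa using hs)
    simpa using! this
  exact (h3.sub h1).const_smul h⁻¹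

lemma dq_continuousOn {X : ℝ → E} {a b c h : ℝ} (hX : ContinuousOn X (Icc a b)) (hh : 0 ≤ h)
    (hb : c + h ≤ b) : ContinuousOn (dq h X) (Icc a c) := by
  refine ContinuousOn.const_smul (ContinuousOn.sub ?_ ?_) _
  · exact hX.comp (by fun_prop) fun t ht => ⟨by linarith [ht.1], by linarith [ht.2]⟩
  · exact hX.mono fun t ht => ⟨ht.1, by linarith [ht.2]⟩

/-- Difference quotients of a `C¹` function converge uniformly to its derivative. -/
lemma dq_uniform {X x : ℝ → E} {a b c η : ℝ}
    (hX : ∀ t ∈ Icc a b, HasDerivWithinAt X (x t) (Icc a b) t) (hx : ContinuousOn x (Icc a b))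
    (hc : c < b) (hη : 0 < η) :
    ∀ᶠ h in 𝓝[>] (0 : ℝ), ∀ t ∈ Icc a c, ‖dq h X t - x t‖ ≤ η := by
  obtain ⟨δ, hδ, hu⟩ := Metric.uniformContinuousOn_iff.mp
    (isCompact_Icc.uniformContinuousOn_of_continuous hx) η hη
  have h1 : ∀ᶠ h in 𝓝[>] (0 : ℝ), h ∈ Ioo 0 (min δ (b - c)) :=
    Ioo_mem_nhdsGT (lt_min hδ (by linarith))
  filter_upwards [h1] with h hh t ht
  have hh1 : h < δ := lt_of_lt_of_le hh.2 (min_le_left _ _)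
  have hh2 : h < b - c := lt_of_lt_of_le hh.2 (min_le_right _ _)
  have hsub : Icc t (t + h) ⊆ Icc a b := Icc_subset_Icc ht.1 (by linarith [ht.2])
  -- Subtracting the linearization at `t` leaves a function whose derivative `x s - x t` is at most
  -- `η` by uniform continuity.
  have hd : ∀ s ∈ Icc t (t + h), HasDerivWithinAt (fun s => X s - (s - t) • x t) (x s - x t)
      (Icc t (t + h)) s := fun s hs => by
    have e1 := (hX s (hsub hs)).mono hsub
    have e2 : HasDerivWithinAt (fun s : ℝ => (s - t) • x t) ((1 : ℝ) • x t) (Icc t (t + h)) s :=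
      (((hasDerivAt_id s).sub_const t).smul_const (x t)).hasDerivWithinAt
    simpa using! e1.sub e2
  have := norm_image_sub_le_of_norm_deriv_right_le_segment (C := η)
    (fun s hs => (hd s hs).continuousWithinAt)
    (fun s hs => hasDerivWithinAt_Ici_of_Icc (hd s ⟨hs.1, hs.2.le⟩) hs.1 hs.2)
    (fun s hs => by
      have := hu s (hsub ⟨hs.1, hs.2.le⟩) t (hsub ⟨le_rfl, by linarith [hh.1]⟩) (by
        rw [Real.dist_eq, abs_of_nonneg (by linarith [hs.1])]; linarith [hs.2])
      rw [dist_eq_norm] at this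
      exact this.le) (t + h) ⟨by linarith [hh.1], le_rfl⟩
  simp only [add_sub_cancel_left, sub_self, zero_smul, sub_zero] at this
  have e : dq h X t - x t = h⁻¹ • (X (t + h) - h • x t - X t) := by
    have : h ≠ 0 := hh.1.ne'
    rw [dq, smul_sub, smul_sub, smul_sub, smul_smul, inv_mul_cancel₀ this, one_smul]
    abel
  rw [e, norm_smul, norm_inv, Real.norm_of_nonneg hh.1.le, inv_mul_le_iff₀ hh.1, mul_comm]
  exact this

lemma dq_tendsto {X : ℝ → E} {x : E} {t : ℝ} (h : HasDerivWithinAt X x (Ici t) t) :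
    Tendsto (fun h => dq h X t) (𝓝[>] 0) (𝓝 x) := by
  have h1 := hasDerivWithinAt_iff_tendsto_slope.mp h
  rw [Ici_sdiff_left] at h1
  have h2 : Tendsto (fun h => t + h) (𝓝[>] (0 : ℝ)) (𝓝[>] t) := by
    refine tendsto_nhdsWithin_iff.mpr ⟨?_, ?_⟩
    · have : Tendsto (fun h => t + h) (𝓝 (0 : ℝ)) (𝓝 (t + 0)) :=
        (continuous_const.add continuous_id).tendsto 0
      rw [add_zero] at this
      exact this.mono_left nhdsWithin_le_nhds
    · filter_upwards [self_mem_nhdsWithin] with h hh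
      simpa using hh
  refine (h1.comp h2).congr fun h => ?_
  simp [slope_def_module, dq]

lemma dq_map {F : Type*} [NormedAddCommGroup F] [NormedSpace ℝ F] (A : E →L[ℝ] F) (h : ℝ)
    (X : ℝ → E) (t : ℝ) : dq h (fun s => A (X s)) t = A (dq h X t) := by
  simp [dq]

end Calculus

/-- The data of an abstract damped wave equation: the embedding `ι` of the energy space `V` into
the pivot space `H`, the trace map `γ` into the boundary space `K`, the boundary damping `B`, which
is coercive with constant `b`, and the interior damping coefficient `lam`. -/
structure WaveData (V H K : Type*) [NormedAddCommGroup V] [InnerProductSpace ℝ V]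
    [NormedAddCommGroup H] [InnerProductSpace ℝ H]
    [NormedAddCommGroup K] [InnerProductSpace ℝ K] where
  /-- the embedding -/
  ι : V →L[ℝ] H
  /-- the trace map -/
  γ : V →L[ℝ] K
  /-- the boundary damping -/
  B : K →L[ℝ] K
  /-- the interior damping coefficient -/
  lam : ℝ
  /-- the coercivity constant of the boundary damping -/
  b : ℝ
  lam_nonneg : 0 ≤ lam
  b_pos : 0 < b
  coercive : ∀ k, b * ‖k‖ ^ 2 ≤ inner ℝ (B k) k

variable {V H K : Type*} [NormedAddCommGroup V] [InnerProductSpace ℝ V] [CompleteSpace V]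
  [NormedAddCommGroup H] [InnerProductSpace ℝ H] [CompleteSpace H]
  [NormedAddCommGroup K] [InnerProductSpace ℝ K] [CompleteSpace K]

/-! ### The abstract damped wave equation: energy inequality and continuous dependence. -/

namespace WaveData

variable (D : WaveData V H K)

/-- The functional `w ↦ ⟨v + λ u, w⟩ + ⟨B γ u, γ w⟩`. -/
def mom (u : V) (v : H) : V :=
  D.ι.adjoint (v + D.lam • D.ι u) + D.γ.adjoint (D.B (D.γ u))

/-- The functional `w ↦ -⟨u, w⟩_V + ⟨f, w⟩ + ⟨g, γ w⟩`. -/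
def frc (u : V) (f : H) (g : K) : V := -u + D.ι.adjoint f + D.γ.adjoint g

lemma inner_mom (u : V) (v : H) (w : V) : inner ℝ (D.mom u v) w
    = inner ℝ v (D.ι w) + D.lam * inner ℝ (D.ι u) (D.ι w) + inner ℝ (D.B (D.γ u)) (D.γ w) := by
  simp only [mom, inner_add_left, ContinuousLinearMap.adjoint_inner_left, inner_smul_left]
  simp

lemma inner_frc (u : V) (f : H) (g : K) (w : V) : inner ℝ (D.frc u f g) w
    = -inner ℝ u w + inner ℝ f (D.ι w) + inner ℝ g (D.γ w) := by
  simp only [frc, inner_add_left, ContinuousLinearMap.adjoint_inner_left, inner_neg_left]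

lemma mom_sub (u u' : V) (v v' : H) : D.mom (u - u') (v - v') = D.mom u v - D.mom u' v' := by
  simp only [mom, map_sub, smul_sub, map_add]; abel

lemma frc_sub (u u' : V) (f f' : H) (g g' : K) :
    D.frc (u - u') (f - f') (g - g') = D.frc u f g - D.frc u' f' g' := by
  simp only [frc, map_sub]; abel

/-- `u` is a weak solution on `[a, b]`, with time derivative `v`, of the linear damped wave equation
with interior forcing `f` and boundary forcing `g`. -/
structure IsSol (a b : ℝ) (u : ℝ → V) (v : ℝ → H) (f : ℝ → H) (g : ℝ → K) : Prop where
  cont_u : ContinuousOn u (Icc a b)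
  cont_v : ContinuousOn v (Icc a b)
  cont_f : ContinuousOn f (Icc a b)
  cont_g : ContinuousOn g (Icc a b)
  deriv_u : ∀ t ∈ Icc a b, HasDerivWithinAt (fun s => D.ι (u s)) (v t) (Icc a b) t
  deriv_mom : ∀ t ∈ Icc a b,
    HasDerivWithinAt (fun s => D.mom (u s) (v s)) (D.frc (u t) (f t) (g t)) (Icc a b) t

variable {D}
variable {a b c : ℝ} {u u' : ℝ → V} {v v' f f' : ℝ → H} {g g' : ℝ → K}

lemma IsSol.sub (h : D.IsSol a b u v f g) (h' : D.IsSol a b u' v' f' g') :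
    D.IsSol a b (fun t => u t - u' t) (fun t => v t - v' t) (fun t => f t - f' t)
      (fun t => g t - g' t) where
  cont_u := h.cont_u.sub h'.cont_u
  cont_v := h.cont_v.sub h'.cont_v
  cont_f := h.cont_f.sub h'.cont_f
  cont_g := h.cont_g.sub h'.cont_g
  deriv_u t ht := by simpa only [map_sub] using! (h.deriv_u t ht).sub (h'.deriv_u t ht)
  deriv_mom t ht := by
    simpa only [mom_sub, frc_sub] using! (h.deriv_mom t ht).sub (h'.deriv_mom t ht)

lemma IsSol.mono {a' b' : ℝ} (h : D.IsSol a b u v f g) (hs : Icc a' b' ⊆ Icc a b) :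
    D.IsSol a' b' u v f g where
  cont_u := h.cont_u.mono hs
  cont_v := h.cont_v.mono hs
  cont_f := h.cont_f.mono hs
  cont_g := h.cont_g.mono hs
  deriv_u t ht := (h.deriv_u t (hs ht)).mono hs
  deriv_mom t ht := (h.deriv_mom t (hs ht)).mono hs

/-- The derivative of half the energy of the Steklov averages of a solution. -/
lemma steklov_deriv_le {U v' : V} {q fh : H} {gh : K} (hm : D.mom v' q = D.frc U fh gh) :
    inner ℝ q (D.ι v') + inner ℝ U v'
      ≤ inner ℝ fh (D.ι v') + inner ℝ gh (D.γ v') - D.b * ‖D.γ v'‖ ^ 2 := by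
  have h1 := congrArg (fun z => inner ℝ z v') hm
  simp only [inner_mom, inner_frc] at h1
  have h2 := D.coercive (D.γ v')
  have h3 : 0 ≤ D.lam * inner ℝ (D.ι v') (D.ι v') :=
    mul_nonneg D.lam_nonneg real_inner_self_nonneg
  linarith

/-- Energy inequality. The work of the forcing terms is only required to be controlled, in terms of
difference quotients, by the increment of a potential `P` and a density `ψ`. -/
theorem IsSol.energy_le (h : D.IsSol a b u v f g) {P ψ : ℝ → ℝ}
    (hP : ContinuousOn P (Icc a b)) (hac : a ≤ c) (hcb : c < b)
    (hw : ∀ η : ℝ, 0 < η → ∀ᶠ h in 𝓝[>] (0 : ℝ), ∀ t ∈ Icc a c,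
      inner ℝ (f t) (D.ι (dq h u t)) + inner ℝ (g t) (D.γ (dq h u t))
        ≤ dq h P t + ψ t + D.b / 2 * ‖D.γ (dq h u t)‖ ^ 2 + η * (1 + ‖D.γ (dq h u t)‖)) :
    ∀ Ψ : ℝ → ℝ, (∀ t ∈ Icc a b, HasDerivWithinAt Ψ (ψ t) (Icc a b) t) →
    1 / 2 * (‖u c‖ ^ 2 + ‖v c‖ ^ 2) - P c - Ψ c
      ≤ 1 / 2 * (‖u a‖ ^ 2 + ‖v a‖ ^ 2) - P a - Ψ a := by
  intro Ψ hΨ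
  obtain ⟨U, -, hU⟩ := exists_primitive h.cont_u
  obtain ⟨F, -, hF⟩ := exists_primitive h.cont_f
  obtain ⟨G, -, hG⟩ := exists_primitive h.cont_g
  obtain ⟨Q, -, hQ⟩ := exists_primitive hP
  -- the equation for the difference quotients
  have hmom : ∀ h' : ℝ, 0 ≤ h' → c + h' ≤ b → ∀ t ∈ Icc a c,
      D.mom (dq h' u t) (dq h' v t) = D.frc (dq h' U t) (dq h' F t) (dq h' G t) := by
    intro h' hh' hcb' t ht
    have hd : ∀ t ∈ Icc a b, HasDerivWithinAt (fun s => D.frc (U s) (F s) (G s))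
        (D.frc (u t) (f t) (g t)) (Icc a b) t := fun t ht => by
      unfold frc
      exact ((hU t ht).neg.add
        (D.ι.adjoint.hasFDerivAt.comp_hasDerivWithinAt t (hF t ht))).add
        (D.γ.adjoint.hasFDerivAt.comp_hasDerivWithinAt t (hG t ht))
    have e1 := sub_eq_sub_of_hasDerivWithinAt h.deriv_mom hd (t := t)
      ⟨ht.1, by linarith [ht.2]⟩
    have e2 := sub_eq_sub_of_hasDerivWithinAt h.deriv_mom hd (t := t + h')
      ⟨by linarith [ht.1], by linarith [ht.2]⟩
    have e3 : D.mom (u (t + h')) (v (t + h')) - D.mom (u t) (v t)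
        = D.frc (U (t + h')) (F (t + h')) (G (t + h')) - D.frc (U t) (F t) (G t) := by
      rw [← sub_eq_sub_iff_sub_eq_sub]; exact e2.trans e1.symm
    rw [← mom_sub, ← frc_sub] at e3
    have e4 := congrArg (fun z => h'⁻¹ • z) e3
    simp only [mom, frc, dq] at e4 ⊢
    simp only [map_smul, smul_add, smul_neg, map_add] at e4 ⊢
    rw [smul_comm D.lam h'⁻¹]
    exact e4
  obtain ⟨C, hC⟩ : ∃ C, ∀ t ∈ Icc a b, ‖v t‖ ≤ C :=
    isCompact_Icc.exists_bound_of_continuousOn h.cont_v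
  -- The energy of the averaged solution. The quotient of the primitive `U` is differentiable in
  -- `V`, with derivative the quotient of `u`, which is therefore an admissible test function.
  -- Passing to a primitive `Q` likewise allows a potential `P` that is merely continuous.
  set Y : ℝ → ℝ → ℝ := fun h' t =>
    1 / 2 * (‖dq h' U t‖ ^ 2 + ‖dq h' (fun s => D.ι (u s)) t‖ ^ 2) - dq h' Q t - Ψ t with hY
  have key : ∀ η : ℝ, 0 < η → η ≤ 1 → ∀ᶠ h' in 𝓝[>] (0 : ℝ),
      Y h' c ≤ Y h' a + η * (C + 2 + 2 / D.b) * (c - a) := by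
    intro η hη hη1
    have hlt : ∀ᶠ h' in 𝓝[>] (0 : ℝ), h' ∈ Ioo 0 (b - c) := Ioo_mem_nhdsGT (by linarith)
    filter_upwards [hw η hη, dq_uniform hF h.cont_f hcb hη, dq_uniform hG h.cont_g hcb hη,
      dq_uniform h.deriv_u h.cont_v hcb hη, hlt] with h' w1 w2 w3 w4 hh'
    have hY' : ∀ t ∈ Ico a c, HasDerivWithinAt (Y h')
        (inner ℝ (dq h' U t) (dq h' u t)
          + inner ℝ (dq h' (fun s => D.ι (u s)) t) (dq h' v t) - dq h' P t - ψ t) (Ici t) t := by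
      intro t ht
      have d1 := dq_hasDerivWithinAt hU ht.1 hh'.1.le (by linarith [ht.2, hh'.2])
      have d2 := dq_hasDerivWithinAt h.deriv_u ht.1 hh'.1.le (by linarith [ht.2, hh'.2])
      have d3 := dq_hasDerivWithinAt hQ ht.1 hh'.1.le (by linarith [ht.2, hh'.2])
      have d4 := hasDerivWithinAt_Ici_of_Icc (hΨ t ⟨ht.1, by linarith [ht.2]⟩) ht.1
        (by linarith [ht.2])
      convert! (((d1.norm_sq.add d2.norm_sq).const_mul (1 / 2)).sub d3).sub d4 using 1
      ring
    have hcont : ContinuousOn (Y h') (Icc a c) := by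
      have q1 := dq_continuousOn (fun t ht => (hU t ht).continuousWithinAt) hh'.1.le
        (by linarith [hh'.2] : c + h' ≤ b)
      have q2 := dq_continuousOn (fun t ht => (h.deriv_u t ht).continuousWithinAt) hh'.1.le
        (by linarith [hh'.2] : c + h' ≤ b)
      have q3 := dq_continuousOn (fun t ht => (hQ t ht).continuousWithinAt) hh'.1.le
        (by linarith [hh'.2] : c + h' ≤ b)
      have q4 : ContinuousOn Ψ (Icc a c) := fun t ht =>
        ((hΨ t ⟨ht.1, by linarith [ht.2]⟩).continuousWithinAt).mono
          (Icc_subset_Icc_right hcb.le)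
      exact ((((q1.norm.pow 2).add (q2.norm.pow 2)).const_mul (1/2)).sub q3).sub q4
    have := image_le_of_deriv_right_le_deriv_boundary hcont hY'
      (B := fun t => Y h' a + η * (C + 2 + 2 / D.b) * (t - a))
      (B' := fun _ => η * (C + 2 + 2 / D.b)) (by simp) (by fun_prop)
      (fun t _ => by
        have := (((hasDerivAt_id t).sub_const a).const_mul (η * (C + 2 + 2 / D.b))).const_add
          (Y h' a)
        simpa using this.hasDerivWithinAt)
      (fun t ht => by
        have ht' : t ∈ Icc a c := ⟨ht.1, ht.2.le⟩
        have hb := D.b_pos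
        have s1 := steklov_deriv_le (hmom h' hh'.1.le (by linarith [hh'.2]) t ht')
        have s2 := w1 t ht'
        have s3 := w2 t ht'
        have s4 := w3 t ht'
        have s5 := w4 t ht'
        rw [dq_map] at s5 ⊢
        set p := D.γ (dq h' u t)
        set r := D.ι (dq h' u t)
        have hr : ‖r‖ ≤ C + 1 := by
          have := hC t ⟨ht.1, by linarith [ht.2]⟩
          have := norm_le_norm_add_norm_sub' r (v t)
          linarith
        have i1 : inner ℝ (dq h' F t) r - inner ℝ (f t) r ≤ η * (C + 1) := by
          rw [← inner_sub_left]
          exact (real_inner_le_norm _ _).trans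
            (mul_le_mul s3 hr (norm_nonneg _) hη.le)
        have i2 : inner ℝ (dq h' G t) p - inner ℝ (g t) p ≤ η * ‖p‖ := by
          rw [← inner_sub_left]
          exact (real_inner_le_norm _ _).trans
            (mul_le_mul_of_nonneg_right s4 (norm_nonneg _))
        -- The trace of the quotient is not bounded uniformly in the step, so its error terms are
        -- absorbed by the half of the boundary damping that the hypothesis leaves unused.
        have i3 : 2 * η * ‖p‖ ≤ D.b / 2 * ‖p‖ ^ 2 + η * (2 / D.b) := by
          have e1 : 2 * η * ‖p‖ ≤ D.b / 2 * ‖p‖ ^ 2 + η ^ 2 * (2 / D.b) := by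
            have e : D.b / 2 * ‖p‖ ^ 2 + η ^ 2 * (2 / D.b) - 2 * η * ‖p‖
                = (D.b * ‖p‖ - 2 * η) ^ 2 / (2 * D.b) := by
              field_simp; ring
            have : 0 ≤ (D.b * ‖p‖ - 2 * η) ^ 2 / (2 * D.b) := by positivity
            linarith
          have e2 : η ^ 2 * (2 / D.b) ≤ η * (2 / D.b) := by
            have : η ^ 2 ≤ η := by nlinarith
            exact mul_le_mul_of_nonneg_right this (by positivity)
          linarith
        rw [real_inner_comm] at s1
        rw [show inner ℝ r (dq h' v t) = inner ℝ (dq h' v t) r from real_inner_comm _ _]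
        rw [real_inner_comm (dq h' v t) r] at s1
        linarith) (right_mem_Icc.mpr hac)
    exact this
  have lim : ∀ t, a ≤ t → t < b → Tendsto (fun h' => Y h' t) (𝓝[>] 0)
      (𝓝 (1 / 2 * (‖u t‖ ^ 2 + ‖v t‖ ^ 2) - P t - Ψ t)) := by
    intro t h1 h2
    have ht : t ∈ Icc a b := ⟨h1, h2.le⟩
    exact (((((dq_tendsto (hasDerivWithinAt_Ici_of_Icc (hU t ht) h1 h2)).norm.pow 2).add
      ((dq_tendsto (hasDerivWithinAt_Ici_of_Icc (h.deriv_u t ht) h1 h2)).norm.pow 2)).const_mul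
      (1 / 2)).sub (dq_tendsto (hasDerivWithinAt_Ici_of_Icc (hQ t ht) h1 h2))).sub_const _
  have key2 : ∀ η : ℝ, 0 < η → η ≤ 1 → 1 / 2 * (‖u c‖ ^ 2 + ‖v c‖ ^ 2) - P c - Ψ c
      ≤ 1 / 2 * (‖u a‖ ^ 2 + ‖v a‖ ^ 2) - P a - Ψ a + η * (C + 2 + 2 / D.b) * (c - a) :=
    fun η h1 h2 => le_of_tendsto_of_tendsto (lim c hac hcb)
      ((lim a le_rfl (hac.trans_lt hcb)).add_const _) (key η h1 h2)
  have lim2 : Tendsto (fun η : ℝ => 1 / 2 * (‖u a‖ ^ 2 + ‖v a‖ ^ 2) - P a - Ψ a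
      + η * (C + 2 + 2 / D.b) * (c - a)) (𝓝[>] 0)
      (𝓝 (1 / 2 * (‖u a‖ ^ 2 + ‖v a‖ ^ 2) - P a - Ψ a + 0 * (C + 2 + 2 / D.b) * (c - a))) := by
    refine Tendsto.mono_left (Continuous.tendsto ?_ 0) nhdsWithin_le_nhds
    fun_prop
  simp only [zero_mul, add_zero] at lim2
  refine ge_of_tendsto lim2 ?_
  filter_upwards [Ioc_mem_nhdsGT (zero_lt_one' ℝ)] with η hη
  exact key2 η hη.1 hη.2

/-- Continuous dependence estimate. -/
theorem IsSol.norm_sq_le (h : D.IsSol a b u v f g) {L : ℝ} (hL : 0 ≤ L)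
    (hf : ∀ t ∈ Icc a b, ‖f t‖ ≤ L * ‖u t‖) (hg : ∀ t ∈ Icc a b, ‖g t‖ ≤ L * ‖u t‖)
    (hac : a ≤ c) (hcb : c < b) :
    ‖u c‖ ^ 2 + ‖v c‖ ^ 2
      ≤ (‖u a‖ ^ 2 + ‖v a‖ ^ 2) * Real.exp ((L + L ^ 2 / D.b) * (c - a)) := by
  have hb := D.b_pos
  set C := L + L ^ 2 / D.b with hCdef
  have hC0 : 0 ≤ C := by positivity
  set N : ℝ → ℝ := fun t => ‖u t‖ ^ 2 + ‖v t‖ ^ 2 with hN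
  have cN : ContinuousOn N (Icc a b) := (h.cont_u.norm.pow 2).add (h.cont_v.norm.pow 2)
  obtain ⟨Ψ, hΨ0, hΨ⟩ := exists_primitive (cN.const_mul (C / 2))
  have step : ∀ t ∈ Ico a b, N t ≤ N a + 2 * Ψ t := by
    intro t ht
    have := h.energy_le (P := 0) (c := t) continuousOn_const ht.1 ht.2
      (fun η hη => by
        have : ∀ᶠ h' in 𝓝[>] (0 : ℝ), ∀ s ∈ Icc a t,
            L * ‖u s‖ * ‖D.ι (dq h' u s)‖ ≤ L * ‖u s‖ * ‖v s‖ + η := by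
          obtain ⟨M, hM⟩ := isCompact_Icc.exists_bound_of_continuousOn h.cont_u
          have hMp : 0 ≤ M := (norm_nonneg _).trans (hM a ⟨le_rfl, ht.1.trans ht.2.le⟩)
          have hpos : 0 < η / (L * M + 1) := by positivity
          filter_upwards [dq_uniform h.deriv_u h.cont_v ht.2 hpos] with h' hh s hs
          have e1 := hh s hs
          rw [dq_map] at e1
          have e2 := norm_le_norm_add_norm_sub' (D.ι (dq h' u s)) (v s)
          have e3 : ‖u s‖ ≤ M := hM s ⟨hs.1, hs.2.trans ht.2.le⟩
          have e4 : L * ‖u s‖ * (η / (L * M + 1)) ≤ η := by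
            rw [mul_div_assoc', div_le_iff₀ (by positivity)]
            have : L * ‖u s‖ ≤ L * M := mul_le_mul_of_nonneg_left e3 hL
            nlinarith
          have e5 : 0 ≤ L * ‖u s‖ := by positivity
          nlinarith
        filter_upwards [this] with h' hh s hs
        have hs' : s ∈ Icc a b := ⟨hs.1, hs.2.trans ht.2.le⟩
        have w1 := hh s hs
        have i1 : inner ℝ (f s) (D.ι (dq h' u s)) ≤ L * ‖u s‖ * ‖D.ι (dq h' u s)‖ :=
          (real_inner_le_norm _ _).trans (mul_le_mul_of_nonneg_right (hf s hs') (norm_nonneg _))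
        have i2 : inner ℝ (g s) (D.γ (dq h' u s)) ≤ L * ‖u s‖ * ‖D.γ (dq h' u s)‖ :=
          (real_inner_le_norm _ _).trans (mul_le_mul_of_nonneg_right (hg s hs') (norm_nonneg _))
        set p := ‖D.γ (dq h' u s)‖
        have hp : 0 ≤ p := norm_nonneg _
        -- Young's inequality: the boundary forcing is paid for by half of the damping, which is
        -- where the rate `L ^ 2 / D.b` comes from.
        have i3 : L * ‖u s‖ * p ≤ D.b / 2 * p ^ 2 + L ^ 2 / D.b / 2 * ‖u s‖ ^ 2 := by
          have e : D.b / 2 * p ^ 2 + L ^ 2 / D.b / 2 * ‖u s‖ ^ 2 - L * ‖u s‖ * p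
              = (D.b * p - L * ‖u s‖) ^ 2 / (2 * D.b) := by
            field_simp; ring
          have : 0 ≤ (D.b * p - L * ‖u s‖) ^ 2 / (2 * D.b) := by positivity
          linarith
        have i4 : L * ‖u s‖ * ‖v s‖ ≤ L / 2 * (‖u s‖ ^ 2 + ‖v s‖ ^ 2) := by
          nlinarith [mul_nonneg hL (sq_nonneg (‖u s‖ - ‖v s‖))]
        have i5 : L ^ 2 / D.b / 2 * ‖u s‖ ^ 2 ≤ L ^ 2 / D.b / 2 * (‖u s‖ ^ 2 + ‖v s‖ ^ 2) :=
          mul_le_mul_of_nonneg_left (by nlinarith [sq_nonneg ‖v s‖]) (by positivity)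
        have i6 : dq h' (0 : ℝ → ℝ) s = 0 := by simp [dq]
        have i7 : 0 ≤ η * p := by positivity
        simp only [i6, hN, hCdef]
        linarith) Ψ hΨ
    simp only [hΨ0, Pi.zero_apply, sub_zero] at this
    simp only [hN]; linarith
  -- `N` is only known to be continuous. Gronwall is applied to its majorant, which is
  -- differentiable with derivative `C * N t`.
  have gr := le_gronwallBound_of_liminf_deriv_right_le (f := fun t => N a + 2 * Ψ t)
    (f' := fun t => C * N t) (δ := N a) (K := C) (ε := 0) (a := a) (b := c)
    (continuousOn_const.add (ContinuousOn.const_mul (fun t ht =>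
      (hΨ t ⟨ht.1, ht.2.trans hcb.le⟩).continuousWithinAt.mono (Icc_subset_Icc_right hcb.le)) 2))
    (fun t ht r hr => by
      have d := ((hasDerivWithinAt_Ici_of_Icc (hΨ t ⟨ht.1, (ht.2.trans hcb).le⟩) ht.1
        (ht.2.trans hcb)).const_mul 2).const_add (N a)
      refine HasDerivWithinAt.liminf_right_slope_le d ?_
      simpa only [show 2 * (C / 2 * N t) = C * N t by ring] using hr)
    (by simp [hΨ0]) (fun t ht => by
      have := step t ⟨ht.1, ht.2.trans hcb⟩
      rw [add_zero]
      exact mul_le_mul_of_nonneg_left this hC0) c (right_mem_Icc.mpr hac)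
  rw [gronwallBound_ε0] at gr
  exact (step c ⟨hac, hcb⟩).trans gr

end WaveData

end TwoPointWave

end

/-! ### Gluing, global ordinary differential equations, the virial identity and the regularized
equation. -/

noncomputable section

namespace TwoPointWave

section Calculus

variable {E : Type*} [NormedAddCommGroup E] [NormedSpace ℝ E]

/-- The concatenation of `z` on `(-∞, a]` and of `w`, started at time `a`. -/
def glue {X : Type*} (a : ℝ) (z w : ℝ → X) (t : ℝ) : X := if t ≤ a then z t else w (t - a)

lemma glue_of_le {X : Type*} {a t : ℝ} {z w : ℝ → X} (h : t ≤ a) : glue a z w t = z t := if_pos h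

lemma glue_of_ge {X : Type*} {a t : ℝ} {z w : ℝ → X} (hzw : z a = w 0) (h : a ≤ t) :
    glue a z w t = w (t - a) := by
  rcases h.eq_or_lt with rfl | h
  · rw [glue_of_le le_rfl, hzw, sub_self]
  · exact if_neg (not_le.mpr h)

lemma glue_map {X Y : Type*} (φ : X → Y) (a : ℝ) (z w : ℝ → X) (t : ℝ) :
    φ (glue a z w t) = glue a (fun s => φ (z s)) (fun s => φ (w s)) t :=
  apply_ite φ _ _ _

lemma glue_continuousOn {X : Type*} [TopologicalSpace X] {a b : ℝ} {z w : ℝ → X} (ha : 0 ≤ a)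
    (hb : 0 ≤ b) (hz : ContinuousOn z (Icc 0 a)) (hw : ContinuousOn w (Icc 0 b))
    (hzw : z a = w 0) : ContinuousOn (glue a z w) (Icc 0 (a + b)) := by
  rw [← Icc_union_Icc_eq_Icc ha (le_add_of_nonneg_right hb)]
  refine ContinuousOn.union_of_isClosed ?_ ?_ isClosed_Icc isClosed_Icc
  · exact hz.congr fun t ht => glue_of_le ht.2
  · refine ContinuousOn.congr (f := fun t => w (t - a)) ?_ fun t ht => glue_of_ge hzw ht.1
    exact hw.comp (by fun_prop) fun t ht => ⟨by linarith [ht.1], by linarith [ht.2]⟩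

lemma glue_hasDerivWithinAt {a b : ℝ} {z w dz dw : ℝ → E} (ha : 0 ≤ a) (hb : 0 ≤ b)
    (hz : ∀ t ∈ Icc 0 a, HasDerivWithinAt z (dz t) (Icc 0 a) t)
    (hw : ∀ t ∈ Icc 0 b, HasDerivWithinAt w (dw t) (Icc 0 b) t)
    (hzw : z a = w 0) (hd : dz a = dw 0) :
    ∀ t ∈ Icc 0 (a + b),
      HasDerivWithinAt (glue a z w) (glue a dz dw t) (Icc 0 (a + b)) t := by
  intro t ht
  rw [← Icc_union_Icc_eq_Icc ha (le_add_of_nonneg_right hb)]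
  refine HasDerivWithinAt.union ?_ ?_
  · by_cases h : t ≤ a
    · rw [glue_of_le h]
      exact (hz t ⟨ht.1, h⟩).congr (fun s hs => glue_of_le hs.2) (glue_of_le h)
    · refine HasFDerivWithinAt.of_notMem_closure ?_
      rw [isClosed_Icc.closure_eq]
      exact fun hh => h hh.2
  · by_cases h : a ≤ t
    · rw [glue_of_ge hd h]
      have h1 := (hw (t - a) ⟨by linarith, by linarith [ht.2]⟩).scomp t (h' := 1)
        (h := fun s => s - a) (s := Icc a (a + b))
        (((hasDerivAt_id t).sub_const a).hasDerivWithinAt)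
        (fun s hs => ⟨by linarith [hs.1], by linarith [hs.2]⟩)
      rw [one_smul] at h1
      exact h1.congr (fun s hs => glue_of_ge hzw hs.1) (glue_of_ge hzw h)
    · refine HasFDerivWithinAt.of_notMem_closure ?_
      rw [isClosed_Icc.closure_eq]
      exact fun hh => h hh.1

/-- Global existence for ordinary differential equations with a Lipschitz vector field. -/
theorem exists_integralCurve_of_lipschitz [CompleteSpace E] {f : E → E} {k : NNReal}
    (hf : LipschitzWith k f) (x₀ : E) (S : ℝ) :
    ∃ z : ℝ → E, z 0 = x₀ ∧ ∀ t ∈ Icc 0 S, HasDerivWithinAt z (f (z t)) (Icc 0 S) t := by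
  -- The step length depends on the Lipschitz constant alone, so finitely many local solutions cover
  -- any interval.
  set τ : ℝ := 1 / (2 * (k + 1)) with hτ
  have hk : (0 : ℝ) ≤ k := k.2
  have hτ0 : 0 < τ := by positivity
  have loc : ∀ x₀ : E, ∃ z : ℝ → E, z 0 = x₀ ∧
      ∀ t ∈ Icc 0 τ, HasDerivWithinAt z (f (z t)) (Icc 0 τ) t := by
    intro x₀
    -- On a ball of this radius the field is at most `‖f x₀‖ + k * a`. A radius growing with `‖f
    -- x₀‖` is what lets `τ` be independent of the starting point.
    set a : NNReal := ‖f x₀‖₊ + 1 with ha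
    have hP : IsPicardLindelof (fun _ => f) (tmin := 0) (tmax := τ) ⟨0, le_rfl, hτ0.le⟩ x₀
        a 0 (‖f x₀‖₊ + k * a) k := by
      refine ⟨fun t _ => hf.lipschitzOnWith, fun x _ => continuousOn_const, ?_, ?_⟩
      · intro t _ x hx
        have h1 := hf.dist_le_mul x x₀
        rw [dist_eq_norm, dist_eq_norm] at h1
        have h2 : ‖x - x₀‖ ≤ a := by simpa [dist_eq_norm] using hx
        have h3 := norm_le_norm_add_norm_sub' (f x) (f x₀)
        rw [NNReal.coe_add, NNReal.coe_mul, coe_nnnorm]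
        have : (k : ℝ) * ‖x - x₀‖ ≤ k * a := mul_le_mul_of_nonneg_left h2 hk
        linarith
      · simp only [sub_zero, sub_self, NNReal.coe_zero]
        rw [max_eq_left hτ0.le, hτ, mul_one_div, div_le_iff₀ (by positivity)]
        rw [NNReal.coe_add, NNReal.coe_mul, ha, NNReal.coe_add, coe_nnnorm, NNReal.coe_one]
        nlinarith [norm_nonneg (f x₀), mul_nonneg hk (norm_nonneg (f x₀))]
    exact hP.exists_eq_forall_mem_Icc_hasDerivWithinAt₀
  have steps : ∀ n : ℕ, ∀ x₀ : E, ∃ z : ℝ → E, z 0 = x₀ ∧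
      ∀ t ∈ Icc 0 (n * τ), HasDerivWithinAt z (f (z t)) (Icc 0 (n * τ)) t := by
    intro n
    induction n with
    | zero =>
      intro x₀
      refine ⟨fun _ => x₀, rfl, fun t ht => ?_⟩
      simp only [Nat.cast_zero, zero_mul, Icc_self] at ht ⊢
      rw [mem_singleton_iff] at ht
      subst ht
      exact HasFDerivWithinAt.of_subsingleton subsingleton_singleton
    | succ n ih =>
      intro x₀
      obtain ⟨z, hz0, hz⟩ := ih x₀
      obtain ⟨w, hw0, hw⟩ := loc (z (n * τ))
      have hn : 0 ≤ (n : ℝ) * τ := by positivity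
      refine ⟨glue (n * τ) z w, by rw [glue_of_le hn, hz0], ?_⟩
      have := glue_hasDerivWithinAt hn hτ0.le hz hw hw0.symm (by rw [hw0])
      have e : ((n + 1 : ℕ) : ℝ) * τ = n * τ + τ := by push_cast; ring
      rw [e]
      intro t ht
      rw [glue_map f]
      exact this t ht
  obtain ⟨n, hn⟩ := exists_nat_ge (S / τ)
  obtain ⟨z, hz0, hz⟩ := steps n x₀
  have hle : S ≤ n * τ := by rwa [div_le_iff₀ hτ0] at hn
  exact ⟨z, hz0, fun t ht => (hz t ⟨ht.1, ht.2.trans hle⟩).mono (Icc_subset_Icc_right hle)⟩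

lemma integral_eq_sub_of_hasDerivWithinAt [CompleteSpace E] {X x : ℝ → E} {a b t : ℝ}
    (hX : ∀ t ∈ Icc a b, HasDerivWithinAt X (x t) (Icc a b) t) (hx : ContinuousOn x (Icc a b))
    (ht : t ∈ Icc a b) : ∫ s in a..t, x s = X t - X a := by
  have hsub : Icc a t ⊆ Icc a b := Icc_subset_Icc_right ht.2
  refine intervalIntegral.integral_eq_sub_of_hasDeriv_right_of_le ht.1
    (fun s hs => (hX s (hsub hs)).continuousWithinAt.mono hsub)
    (fun s hs => ((hasDerivWithinAt_Ici_of_Icc (hX s (hsub ⟨hs.1.le, hs.2.le⟩)) hs.1.le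
      (hs.2.trans_le ht.2))).mono Ioi_subset_Ici_self) ?_
  exact ContinuousOn.intervalIntegrable (by rw [uIcc_of_le ht.1]; exact hx.mono hsub)

/-- A pointwise limit of functions whose derivatives converge uniformly is differentiable. -/
lemma hasDerivWithinAt_of_tendstoUniformlyOn [CompleteSpace E] {X x : ℕ → ℝ → E} {Y y : ℝ → E}
    {a b : ℝ} (hX : ∀ n, ∀ t ∈ Icc a b, HasDerivWithinAt (X n) (x n t) (Icc a b) t)
    (hY : ∀ t ∈ Icc a b, Tendsto (fun n => X n t) atTop (𝓝 (Y t)))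
    (hxy : TendstoUniformlyOn x y atTop (Icc a b)) (hy : ContinuousOn y (Icc a b)) :
    ∀ t ∈ Icc a b, HasDerivWithinAt Y (y t) (Icc a b) t := by
  -- By the mean value inequality the increments of `X n - Z` tend to zero, so the limit differs
  -- from the primitive `Z` by a constant.
  obtain ⟨Z, -, hZ⟩ := exists_primitive hy
  have key : ∀ t ∈ Icc a b, Y t = Z t + (Y a - Z a) := by
    intro t ht
    have ha : a ∈ Icc a b := ⟨le_rfl, ht.1.trans ht.2⟩
    have hlim : Tendsto (fun n => ‖(X n t - Z t) - (X n a - Z a)‖) atTop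
        (𝓝 ‖(Y t - Z t) - (Y a - Z a)‖) :=
      (((hY t ht).sub_const _).sub ((hY a ha).sub_const _)).norm
    have hz : Tendsto (fun n => ‖(X n t - Z t) - (X n a - Z a)‖) atTop (𝓝 0) := by
      rw [Metric.tendsto_nhds]
      intro ε hε
      have hba : 0 < b - a + 1 := by linarith [ha.2]
      filter_upwards [Metric.tendstoUniformlyOn_iff.mp hxy (ε / (b - a + 1)) (by positivity)]
        with n hn
      have hd : ∀ s ∈ Icc a b, HasDerivWithinAt (fun s => X n s - Z s) (x n s - y s)
          (Icc a b) s := fun s hs => (hX n s hs).sub (hZ s hs)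
      have := norm_image_sub_le_of_norm_deriv_right_le_segment (C := ε / (b - a + 1))
        (fun s hs => (hd s hs).continuousWithinAt)
        (fun s hs => hasDerivWithinAt_Ici_of_Icc (hd s ⟨hs.1, hs.2.le⟩) hs.1 hs.2)
        (fun s hs => by
          have := hn s ⟨hs.1, hs.2.le⟩
          rw [dist_comm, dist_eq_norm] at this
          exact this.le) t ht
      rw [Real.dist_eq, sub_zero, abs_of_nonneg (norm_nonneg _)]
      refine this.trans_lt ?_
      rw [div_mul_eq_mul_div, div_lt_iff₀ hba]
      nlinarith [ht.1, ht.2]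
    have := tendsto_nhds_unique hlim hz
    rw [norm_eq_zero, sub_eq_zero] at this
    rw [← this]; abel
  intro t ht
  exact ((hZ t ht).add_const _).congr key (key t ht)

end Calculus

variable {V H K : Type*} [NormedAddCommGroup V] [InnerProductSpace ℝ V] [CompleteSpace V]
  [NormedAddCommGroup H] [InnerProductSpace ℝ H] [CompleteSpace H]
  [NormedAddCommGroup K] [InnerProductSpace ℝ K] [CompleteSpace K]

namespace WaveData

variable {D : WaveData V H K}

/-- The derivative of `⟨v, u⟩ + λ/2 ‖u‖² + ½ ⟨B γ u, γ u⟩` along a solution. -/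
theorem IsSol.hasDerivWithinAt_virial {a b t : ℝ} {u : ℝ → V} {v f : ℝ → H} {g : ℝ → K}
    (h : D.IsSol a b u v f g) (hB : ∀ k l, inner ℝ (D.B k) l = inner ℝ (D.B l) k)
    (ht : t ∈ Icc a b) :
    HasDerivWithinAt (fun s => inner ℝ (v s) (D.ι (u s)) + D.lam / 2 * ‖D.ι (u s)‖ ^ 2
        + 1 / 2 * inner ℝ (D.B (D.γ (u s))) (D.γ (u s)))
      (‖v t‖ ^ 2 - ‖u t‖ ^ 2 + inner ℝ (f t) (D.ι (u t)) + inner ℝ (g t) (D.γ (u t)))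
      (Icc a b) t := by
  set ψ : ℝ → ℝ := fun s => inner ℝ (v s) (D.ι (u s)) + D.lam / 2 * ‖D.ι (u s)‖ ^ 2
        + 1 / 2 * inner ℝ (D.B (D.γ (u s))) (D.γ (u s)) with hψ
  -- The product rule is unavailable because `u` need not be differentiable in `V`. By symmetry of
  -- `B`, the increment of `ψ` is exactly a sum of increments of the momentum and of `ι u`, each
  -- paired with a sum of endpoint values; only continuity of the other factors is then needed.
  have id1 : ∀ s, slope ψ t s
      = 1 / 2 * inner ℝ (slope (fun s => D.mom (u s) (v s)) t s) (u s + u t)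
        + 1 / 2 * inner ℝ (v s + v t) (slope (fun s => D.ι (u s)) t s) := by
    intro s
    simp only [slope_def_module, smul_eq_mul, real_inner_smul_left, real_inner_smul_right]
    have : ψ s - ψ t = 1 / 2 * inner ℝ (D.mom (u s) (v s) - D.mom (u t) (v t)) (u s + u t)
        + 1 / 2 * inner ℝ (v s + v t) (D.ι (u s) - D.ι (u t)) := by
      simp only [hψ, inner_sub_left, inner_add_right, inner_mom, inner_add_left, inner_sub_right,
        ← real_inner_self_eq_norm_sq]
      rw [hB (D.γ (u s)) (D.γ (u t)), real_inner_comm (D.ι (u s)) (D.ι (u t))]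
      ring
    rw [this]; ring
  rw [hasDerivWithinAt_iff_tendsto_slope]
  have l1 := hasDerivWithinAt_iff_tendsto_slope.mp (h.deriv_mom t ht)
  have l2 := hasDerivWithinAt_iff_tendsto_slope.mp (h.deriv_u t ht)
  have l3 : Tendsto u (𝓝[Icc a b \ {t}] t) (𝓝 (u t)) :=
    (h.cont_u t ht).mono_left (nhdsWithin_mono _ sdiff_subset)
  have l4 : Tendsto v (𝓝[Icc a b \ {t}] t) (𝓝 (v t)) :=
    (h.cont_v t ht).mono_left (nhdsWithin_mono _ sdiff_subset)
  have l5 := ((l1.inner (l3.add_const (u t)) (𝕜 := ℝ)).const_mul (1 / 2)).add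
    (((l4.add_const (v t)).inner l2 (𝕜 := ℝ)).const_mul (1 / 2))
  refine (l5.congr fun s => (id1 s).symm).trans (le_of_eq ?_)
  congr 1
  simp only [inner_add_right, inner_add_left, inner_frc, ← real_inner_self_eq_norm_sq]
  ring

/-- Lax–Milgram: ε + ι*ι is coercive with constant `ε`. Inverting it solves the regularized equation
for the acceleration. -/
lemma exists_inertia_inverse (D : WaveData V H K) {ε : ℝ} (hε : 0 < ε) :
    ∃ R : V →L[ℝ] V, ∀ x, ε • R x + D.ι.adjoint (D.ι (R x)) = x := by
  let T : V →L[ℝ] V := ε • ContinuousLinearMap.id ℝ V + D.ι.adjoint.comp D.ι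
  let β : V →L[ℝ] V →L[ℝ] ℝ := LinearMap.mkContinuous₂
    (LinearMap.mk₂ ℝ (fun x y => inner ℝ (T x) y) (by intros; simp only [map_add, inner_add_left])
      (by intros; simp only [map_smul, real_inner_smul_left, smul_eq_mul])
      (by intros; simp only [inner_add_right])
      (by intros; simp only [real_inner_smul_right, smul_eq_mul])) ‖T‖
    (fun x y => (norm_inner_le_norm _ _).trans
      (mul_le_mul_of_nonneg_right (T.le_opNorm x) (norm_nonneg y)))
  have hβ : ∀ x y, β x y = inner ℝ (T x) y := fun x y => rfl
  have hco : IsCoercive β := by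
    refine ⟨ε, hε, fun x => ?_⟩
    rw [hβ]
    simp only [T, _root_.add_apply, _root_.smul_apply,
      ContinuousLinearMap.id_apply, ContinuousLinearMap.comp_apply, inner_add_left,
      real_inner_smul_left, ContinuousLinearMap.adjoint_inner_left]
    have := real_inner_self_nonneg (x := D.ι x)
    rw [real_inner_self_eq_norm_sq x]
    nlinarith
  let e := hco.continuousLinearEquivOfBilin
  have he : ∀ x, e x = T x := fun x =>
    ext_inner_right ℝ fun y => (hco.continuousLinearEquivOfBilin_apply x y).trans (hβ x y)
  refine ⟨e.symm, fun x => ?_⟩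
  have := he (e.symm x)
  rw [e.apply_symm_apply] at this
  exact this.symm

/-- Solutions `u`, with derivatives `w` and `A`, of the equation regularized by an inertia term
`ε A` in `V`, with nonlinear forcing `F`, `G`. -/
structure IsRegSol (D : WaveData V H K) (F : H → H) (G : K → K) (ε S : ℝ) (u w A : ℝ → V) :
    Prop where
  deriv_u : ∀ t ∈ Icc 0 S, HasDerivWithinAt u (w t) (Icc 0 S) t
  deriv_w : ∀ t ∈ Icc 0 S, HasDerivWithinAt w (A t) (Icc 0 S) t
  eq : ∀ t ∈ Icc 0 S,
    ε • A t + D.mom (w t) (D.ι (A t)) = D.frc (u t) (F (D.ι (u t))) (G (D.γ (u t)))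

/-- Solved for the acceleration, the equation is a first order system for the pair (u, w) in V × V
with a globally Lipschitz field, because every operator involved is bounded on `V`. -/
theorem exists_isRegSol (D : WaveData V H K) {F : H → H} {G : K → K} {k l : NNReal}
    (hF : LipschitzWith k F) (hG : LipschitzWith l G) {ε : ℝ} (hε : 0 < ε) (S : ℝ) (a b : V) :
    ∃ u w A : ℝ → V, u 0 = a ∧ w 0 = b ∧ D.IsRegSol F G ε S u w A := by
  obtain ⟨R, hR⟩ := D.exists_inertia_inverse hε
  let Q : V → V := fun u => D.frc u (F (D.ι u)) (G (D.γ u))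
  let M : V →L[ℝ] V := D.lam • D.ι.adjoint.comp D.ι + D.γ.adjoint.comp (D.B.comp D.γ)
  have hQ : ∃ q, LipschitzWith q Q :=
    ⟨_, (LipschitzWith.id.neg.add (D.ι.adjoint.lipschitz.comp (hF.comp D.ι.lipschitz))).add
      (D.γ.adjoint.lipschitz.comp (hG.comp D.γ.lipschitz))⟩
  obtain ⟨q, hq⟩ := hQ
  have hΦ : LipschitzWith _ (fun z : V × V => (z.2, R (Q z.1 - M z.2))) :=
    LipschitzWith.prod_snd.prodMk (R.lipschitz.comp
      ((hq.comp LipschitzWith.prod_fst).sub (M.lipschitz.comp LipschitzWith.prod_snd)))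
  obtain ⟨z, hz0, hz⟩ := exists_integralCurve_of_lipschitz hΦ (a, b) S
  refine ⟨fun t => (z t).1, fun t => (z t).2, fun t => R (Q (z t).1 - M (z t).2),
    by simp [hz0], by simp [hz0], fun t ht => ?_, fun t ht => ?_, fun t _ => ?_⟩
  · exact (ContinuousLinearMap.fst ℝ V V).hasFDerivAt.comp_hasDerivWithinAt t (hz t ht)
  · exact (ContinuousLinearMap.snd ℝ V V).hasFDerivAt.comp_hasDerivWithinAt t (hz t ht)
  · have h1 := hR (Q (z t).1 - M (z t).2)
    simp only [mom, map_add, map_smul]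
    rw [← add_assoc, ← add_assoc, h1]
    simp only [M, Q, _root_.add_apply, _root_.smul_apply,
      ContinuousLinearMap.comp_apply]
    abel

/-- The basic estimate for regularized equations. -/
theorem reg_energy_le {S ε L ρ : ℝ} {U W A r : ℝ → V} {f : ℝ → H} {g : ℝ → K}
    (hU : ∀ t ∈ Icc 0 S, HasDerivWithinAt U (W t) (Icc 0 S) t)
    (hW : ∀ t ∈ Icc 0 S, HasDerivWithinAt W (A t) (Icc 0 S) t)
    (heq : ∀ t ∈ Icc 0 S, ε • A t + D.mom (W t) (D.ι (A t)) = D.frc (U t) (f t) (g t) + r t)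
    (hε : 0 ≤ ε) (hL : 0 ≤ L) (hρ : 0 ≤ ρ)
    (hf : ∀ t ∈ Icc 0 S, ‖f t‖ ≤ L * ‖U t‖) (hg : ∀ t ∈ Icc 0 S, ‖g t‖ ≤ L * ‖U t‖)
    (hr : ∀ t ∈ Icc 0 S, inner ℝ (r t) (W t) ≤ ρ) {t : ℝ} (ht : t ∈ Icc 0 S) :
    ‖U t‖ ^ 2 + ‖D.ι (W t)‖ ^ 2 + ε * ‖W t‖ ^ 2 + D.b * ∫ s in (0 : ℝ)..t, ‖D.γ (W s)‖ ^ 2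
      ≤ Real.exp ((L + L ^ 2 / D.b) * S)
        * (‖U 0‖ ^ 2 + ‖D.ι (W 0)‖ ^ 2 + ε * ‖W 0‖ ^ 2 + 2 * ρ * S) := by
  have hb := D.b_pos
  set C := L + L ^ 2 / D.b with hC
  have hC0 : 0 ≤ C := by positivity
  have cW : ContinuousOn (fun s => ‖D.γ (W s)‖ ^ 2) (Icc 0 S) :=
    (D.γ.continuous.comp_continuousOn fun s hs => (hW s hs).continuousWithinAt).norm.pow 2
  obtain ⟨J, hJ0, hJ⟩ := exists_primitive cW
  have hJt := integral_eq_sub_of_hasDerivWithinAt hJ cW ht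
  rw [hJt, hJ0, sub_zero]
  set N : ℝ → ℝ := fun t => ‖U t‖ ^ 2 + ‖D.ι (W t)‖ ^ 2 + ε * ‖W t‖ ^ 2 with hN
  have hN0 : ∀ t, 0 ≤ N t := fun t => by positivity
  have hS : 0 ≤ S := ht.1.trans ht.2
  -- a weighted energy is nonincreasing
  have dN : ∀ s ∈ Icc 0 S, HasDerivWithinAt N
      (2 * inner ℝ (U s) (W s) + 2 * inner ℝ (D.ι (W s)) (D.ι (A s))
        + ε * (2 * inner ℝ (W s) (A s))) (Icc 0 S) s := fun s hs =>
    ((hU s hs).norm_sq.add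
      (D.ι.hasFDerivAt.comp_hasDerivWithinAt s (hW s hs)).norm_sq).add
      ((hW s hs).norm_sq.const_mul ε)
  have dN_le : ∀ s ∈ Icc 0 S, 2 * inner ℝ (U s) (W s) + 2 * inner ℝ (D.ι (W s)) (D.ι (A s))
        + ε * (2 * inner ℝ (W s) (A s)) ≤ C * N s - D.b * ‖D.γ (W s)‖ ^ 2 + 2 * ρ := by
    intro s hs
    have e := congrArg (fun z => inner ℝ z (W s)) (heq s hs)
    simp only [inner_add_left, inner_mom, inner_frc, real_inner_smul_left] at e
    have i0 := hr s hs
    have i1 := D.coercive (D.γ (W s))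
    have i2 : 0 ≤ D.lam * inner ℝ (D.ι (W s)) (D.ι (W s)) :=
      mul_nonneg D.lam_nonneg real_inner_self_nonneg
    have i3 : inner ℝ (f s) (D.ι (W s)) ≤ L * ‖U s‖ * ‖D.ι (W s)‖ :=
      (real_inner_le_norm _ _).trans (mul_le_mul_of_nonneg_right (hf s hs) (norm_nonneg _))
    have i4 : inner ℝ (g s) (D.γ (W s)) ≤ L * ‖U s‖ * ‖D.γ (W s)‖ :=
      (real_inner_le_norm _ _).trans (mul_le_mul_of_nonneg_right (hg s hs) (norm_nonneg _))
    have i5 : 2 * (L * ‖U s‖ * ‖D.ι (W s)‖) ≤ L * (‖U s‖ ^ 2 + ‖D.ι (W s)‖ ^ 2) := by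
      nlinarith [mul_nonneg hL (sq_nonneg (‖U s‖ - ‖D.ι (W s)‖))]
    -- Half of the dissipation absorbs the boundary forcing; the other half survives as the integral
    -- term in the estimate.
    have i6 : 2 * (L * ‖U s‖ * ‖D.γ (W s)‖)
        ≤ L ^ 2 / D.b * ‖U s‖ ^ 2 + D.b * ‖D.γ (W s)‖ ^ 2 := by
      have e : L ^ 2 / D.b * ‖U s‖ ^ 2 + D.b * ‖D.γ (W s)‖ ^ 2 - 2 * (L * ‖U s‖ * ‖D.γ (W s)‖)
          = (D.b * ‖D.γ (W s)‖ - L * ‖U s‖) ^ 2 / D.b := by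
        field_simp; ring
      have : 0 ≤ (D.b * ‖D.γ (W s)‖ - L * ‖U s‖) ^ 2 / D.b := by positivity
      linarith
    have i7 : L ^ 2 / D.b * ‖U s‖ ^ 2 ≤ L ^ 2 / D.b * N s := by
      refine mul_le_mul_of_nonneg_left ?_ (by positivity)
      have : 0 ≤ ‖D.ι (W s)‖ ^ 2 + ε * ‖W s‖ ^ 2 := by positivity
      simp only [hN]; linarith
    have i8 : L * (‖U s‖ ^ 2 + ‖D.ι (W s)‖ ^ 2) ≤ L * N s := by
      refine mul_le_mul_of_nonneg_left ?_ hL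
      have : 0 ≤ ε * ‖W s‖ ^ 2 := by positivity
      simp only [hN]; linarith
    rw [real_inner_comm (D.ι (A s)), real_inner_comm (A s), hC, add_mul]
    linarith
  -- The dissipation carries the constant weight `exp (-C * S)`, the least value of the exponential
  -- weight on the interval, so that its derivative is dominated at every time.
  have dE : ∀ s ∈ Icc 0 S, HasDerivWithinAt (fun s => Real.exp (-C * s) * N s - 2 * ρ * s
      + Real.exp (-C * S) * (D.b * J s)) _ (Icc 0 S) s := fun s hs =>
    (((((hasDerivAt_id s).const_mul (-C)).exp.hasDerivWithinAt).mul (dN s hs)).sub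
      ((hasDerivAt_id s).const_mul (2 * ρ)).hasDerivWithinAt).add
      (((hJ s hs).const_mul D.b).const_mul _)
  have := image_le_of_deriv_right_le_deriv_boundary (a := 0) (b := S)
    (fun s hs => (dE s hs).continuousWithinAt)
    (fun s hs => hasDerivWithinAt_Ici_of_Icc (dE s ⟨hs.1, hs.2.le⟩) hs.1 hs.2)
    (B := fun _ => N 0) (B' := fun _ => 0) (by simp [hJ0]) continuousOn_const
    (fun s _ => hasDerivWithinAt_const _ _ _)
    (fun s hs => by
      have hs' : s ∈ Icc 0 S := ⟨hs.1, hs.2.le⟩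
      have j1 := dN_le s hs'
      have j2 : Real.exp (-C * S) ≤ Real.exp (-C * s) :=
        Real.exp_le_exp.mpr (by nlinarith [hs.2])
      have j3 : Real.exp (-C * s) ≤ 1 := Real.exp_le_one_iff.mpr (by nlinarith [hs.1])
      have j4 := Real.exp_pos (-C * s)
      have j5 := mul_le_mul_of_nonneg_left j1 j4.le
      have j6 : Real.exp (-C * S) * (D.b * ‖D.γ (W s)‖ ^ 2)
          ≤ Real.exp (-C * s) * (D.b * ‖D.γ (W s)‖ ^ 2) :=
        mul_le_mul_of_nonneg_right j2 (by positivity)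
      have j7 : Real.exp (-C * s) * (2 * ρ) ≤ 1 * (2 * ρ) :=
        mul_le_mul_of_nonneg_right j3 (by linarith)
      simp only [id, mul_one]
      nlinarith) ht
  have k1 : Real.exp (-C * S) * (N t + D.b * J t) ≤ N 0 + 2 * ρ * S := by
    have j2 : Real.exp (-C * S) ≤ Real.exp (-C * t) :=
      Real.exp_le_exp.mpr (by nlinarith [ht.2])
    have j3 := mul_le_mul_of_nonneg_right j2 (hN0 t)
    have j4 : ρ * t ≤ ρ * S := mul_le_mul_of_nonneg_left ht.2 hρ
    linarith
  have k2 : Real.exp (C * S) * Real.exp (-C * S) = 1 := by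
    rw [← Real.exp_add]; simp
  have k3 := mul_le_mul_of_nonneg_left k1 (Real.exp_pos (C * S)).le
  rw [← mul_assoc, k2, one_mul] at k3
  exact k3

end WaveData

end TwoPointWave

end

/-! ### Limits of approximations, compatible data and higher-order bounds. -/

noncomputable section

namespace TwoPointWave

section Limits

variable {E : Type*} [NormedAddCommGroup E]

/-- A bound of the form δ n + δ m on squared distances is what the energy estimates deliver; it
gives a uniform Cauchy sequence. -/
lemma exists_tendstoUniformlyOn [CompleteSpace E] {x : ℕ → ℝ → E} {s : Set ℝ} {δ : ℕ → ℝ}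
    (hδ : Tendsto δ atTop (𝓝 0))
    (hx : ∀ n m, ∀ t ∈ s, ‖x n t - x m t‖ ^ 2 ≤ δ n + δ m) :
    ∃ y : ℝ → E, TendstoUniformlyOn x y atTop s := by
  have hu : UniformCauchySeqOn x atTop s := by
    rw [Metric.uniformCauchySeqOn_iff]
    intro ε hε
    have h1 : ∀ᶠ n in atTop, δ n < ε ^ 2 / 2 :=
      hδ.eventually_lt_const (by positivity)
    obtain ⟨N, hN⟩ := eventually_atTop.mp h1
    refine ⟨N, fun m hm n hn t ht => ?_⟩
    rw [dist_eq_norm]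
    refine lt_of_pow_lt_pow_left₀ 2 hε.le ?_
    linarith [hx m n t ht, hN m hm, hN n hn]
  have hl : ∀ t, ∃ y, t ∈ s → Tendsto (fun n => x n t) atTop (𝓝 y) := by
    intro t
    by_cases ht : t ∈ s
    · obtain ⟨y, hy⟩ := cauchySeq_tendsto_of_complete (hu.cauchySeq ht)
      exact ⟨y, fun _ => hy⟩
    · exact ⟨0, fun h => absurd h ht⟩
  choose y hy using hl
  exact ⟨y, hu.tendstoUniformlyOn_of_tendsto fun t ht => hy t ht⟩

variable [InnerProductSpace ℝ E]

/-- Trace velocities of the approximations converge in L² in time only. The convergence of the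
primitives, through L¹ on a bounded interval, identifies the limit as the derivative of the limiting
trace. -/
lemma exists_L2_limit [CompleteSpace E] {S : ℝ} (hS : 0 ≤ S) {x : ℕ → ℝ → E}
    (hx : ∀ n, ContinuousOn (x n) (Icc 0 S)) {δ : ℕ → ℝ} (hδ : Tendsto δ atTop (𝓝 0))
    (hc : ∀ n m, ∫ s in (0 : ℝ)..S, ‖x n s - x m s‖ ^ 2 ≤ δ n + δ m) :
    ∃ d : ℝ → E, MemLp d 2 (volume.restrict (Ioc 0 S)) ∧ ∀ t ∈ Icc 0 S,
      Tendsto (fun n => ∫ s in (0 : ℝ)..t, x n s) atTop (𝓝 (∫ s in (0 : ℝ)..t, d s)) := by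
  set μ := volume.restrict (Ioc (0 : ℝ) S) with hμ
  have hm : ∀ n, MemLp (x n) 2 μ := fun n => by
    obtain ⟨C, hC⟩ := isCompact_Icc.exists_bound_of_continuousOn (hx n)
    refine MemLp.of_bound (((hx n).mono Ioc_subset_Icc_self).aestronglyMeasurable
      measurableSet_Ioc) C ?_
    rw [ae_restrict_iff' measurableSet_Ioc]
    exact Eventually.of_forall fun t ht => hC t (Ioc_subset_Icc_self ht)
  set X : ℕ → Lp E 2 μ := fun n => (hm n).toLp with hX
  have hdist : ∀ n m, ‖X n - X m‖ ^ 2 ≤ δ n + δ m := by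
    intro n m
    rw [← real_inner_self_eq_norm_sq, L2.inner_def]
    refine le_trans (le_of_eq ?_) (hc n m)
    rw [intervalIntegral.integral_of_le hS]
    refine integral_congr_ae ?_
    filter_upwards [Lp.coeFn_sub (X n) (X m), (hm n).coeFn_toLp, (hm m).coeFn_toLp]
      with t h1 h2 h3
    rw [h1, Pi.sub_apply, real_inner_self_eq_norm_sq]
    simp only [hX]
    rw [h2, h3]
  obtain ⟨Y, hY⟩ := exists_tendstoUniformlyOn (x := fun n (_ : ℝ) => X n) (s := univ) hδ
    (fun n m t _ => hdist n m)
  have hlim : Tendsto X atTop (𝓝 (Y 0)) := hY.tendsto_at (mem_univ 0)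
  have hl2 := (Lp.tendsto_Lp_iff_tendsto_eLpNorm' X (Y 0)).mp hlim
  refine ⟨Y 0, Lp.memLp _, fun t ht => ?_⟩
  have hsub : Ioc 0 t ⊆ Ioc 0 S := Ioc_subset_Ioc_right ht.2
  have hl1 : Tendsto (fun n => eLpNorm (fun s => x n s - Y 0 s) 1 μ) atTop (𝓝 0) := by
    have hb : ∀ n, eLpNorm (fun s => x n s - Y 0 s) 1 μ
        ≤ eLpNorm (X n - Y 0 : ℝ → E) 2 μ * μ univ ^ (1 / (1 : ENNReal).toReal
          - 1 / (2 : ENNReal).toReal) := by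
      intro n
      have e : eLpNorm (X n - Y 0 : ℝ → E) 2 μ = eLpNorm (fun s => x n s - Y 0 s) 2 μ := by
        refine eLpNorm_congr_ae ?_
        filter_upwards [(hm n).coeFn_toLp] with s hs
        simp only [hX, Pi.sub_apply, hs]
      rw [e]
      exact eLpNorm_le_eLpNorm_mul_rpow_measure_univ (by norm_num)
        ((hm n).1.sub (Lp.aestronglyMeasurable _))
    have hμf : μ univ ≠ ⊤ := by simp [hμ]
    have hz : Tendsto (fun n => eLpNorm (X n - Y 0 : ℝ → E) 2 μ
        * μ univ ^ (1 / (1 : ENNReal).toReal - 1 / (2 : ENNReal).toReal)) atTop (𝓝 0) := by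
      have := ENNReal.Tendsto.mul_const hl2 (b := μ univ ^ (1 / (1 : ENNReal).toReal
          - 1 / (2 : ENNReal).toReal))
        (Or.inr (ENNReal.rpow_ne_top_of_nonneg (by norm_num) hμf))
      rwa [zero_mul] at this
    exact tendsto_of_tendsto_of_tendsto_of_le_of_le tendsto_const_nhds hz
      (fun _ => zero_le) hb
  have := tendsto_setIntegral_of_L1' (μ := μ) (Y 0 : ℝ → E)
    (Lp.aestronglyMeasurable _)
    (F := x) (l := atTop) (Eventually.of_forall fun n => (hm n).integrable one_le_two) hl1
    (Ioc 0 t)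
  have e : ∀ z : ℝ → E, ∫ s in (0 : ℝ)..t, z s = ∫ s in Ioc 0 t, z s ∂μ := fun z => by
    rw [intervalIntegral.integral_of_le ht.1, hμ, Measure.restrict_restrict measurableSet_Ioc,
      inter_eq_left.mpr hsub]
  simpa only [e] using this

end Limits

variable {V H K : Type*} [NormedAddCommGroup V] [InnerProductSpace ℝ V] [CompleteSpace V]
  [NormedAddCommGroup H] [InnerProductSpace ℝ H] [CompleteSpace H]
  [NormedAddCommGroup K] [InnerProductSpace ℝ K] [CompleteSpace K]

namespace WaveData

variable {D : WaveData V H K}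

/-- Initial data for which the boundary conditions hold are dense in the energy space. -/
lemma exists_compatible (hι : Function.Injective D.ι)
    (hker : ∀ (x : H) (δ : ℝ), 0 < δ → ∃ w : V, D.γ w = 0 ∧ ‖D.ι w - x‖ < δ)
    (hγ : ∀ k : K, ∃ w : V, D.B (D.γ w) = k) (G : K → K) (u₀ : V) (v₀ : H) {δ : ℝ} (hδ : 0 < δ) :
    ∃ (a b : V) (h₀ : H), ‖a - u₀‖ < δ ∧ ‖D.ι b - v₀‖ < δ ∧
      a + D.γ.adjoint (D.B (D.γ b)) - D.γ.adjoint (G (D.γ a)) = D.ι.adjoint h₀ := by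
  -- A vector `x` orthogonal to the range is orthogonal to ι*ιx, so ιx = 0 and injectivity applies.
  have hd : (D.ι.adjoint.range).topologicalClosure = ⊤ := by
    rw [Submodule.topologicalClosure_eq_top_iff, Submodule.eq_bot_iff]
    intro x hx
    rw [Submodule.mem_orthogonal] at hx
    refine hι ?_
    rw [map_zero, ← inner_self_eq_zero (𝕜 := ℝ)]
    have := hx (D.ι.adjoint (D.ι x)) ⟨D.ι x, rfl⟩
    rwa [ContinuousLinearMap.adjoint_inner_left] at this
  have hu : u₀ ∈ closure (D.ι.adjoint.range : Set V) := by
    rw [← Submodule.topologicalClosure_coe, hd]; trivial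
  obtain ⟨a, ⟨h₀, rfl⟩, ha⟩ := Metric.mem_closure_iff.mp hu δ hδ
  -- The trace of the velocity is prescribed by `w₁` so as to balance the boundary force; `w₂`, of
  -- zero trace, then corrects the velocity in `H` without disturbing that balance.
  obtain ⟨w₁, hw₁⟩ := hγ (G (D.γ (D.ι.adjoint h₀)))
  obtain ⟨w₂, hw₂, hw₂'⟩ := hker (v₀ - D.ι w₁) δ hδ
  refine ⟨D.ι.adjoint h₀, w₁ + w₂, h₀, ?_, ?_, ?_⟩
  · rwa [dist_comm, dist_eq_norm] at ha
  · rw [map_add]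
    convert hw₂' using 2
    abel
  · rw [map_add, hw₂, add_zero, hw₁]
    abel

lemma IsRegSol.mono {F : H → H} {G : K → K} {ε S S' : ℝ} {u w A : ℝ → V}
    (h : D.IsRegSol F G ε S u w A) (hS : S' ≤ S) : D.IsRegSol F G ε S' u w A where
  deriv_u t ht := (h.deriv_u t ⟨ht.1, ht.2.trans hS⟩).mono (Icc_subset_Icc_right hS)
  deriv_w t ht := (h.deriv_w t ⟨ht.1, ht.2.trans hS⟩).mono (Icc_subset_Icc_right hS)
  eq t ht := h.eq t ⟨ht.1, ht.2.trans hS⟩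

lemma IsRegSol.shift {F : H → H} {G : K → K} {ε S h : ℝ} {u w A : ℝ → V}
    (hs : D.IsRegSol F G ε S u w A) (hh : 0 ≤ h) :
    D.IsRegSol F G ε (S - h) (fun t => u (t + h)) (fun t => w (t + h)) (fun t => A (t + h)) := by
  have aux : ∀ {X x : ℝ → V}, (∀ t ∈ Icc 0 S, HasDerivWithinAt X (x t) (Icc 0 S) t) →
      ∀ t ∈ Icc 0 (S - h), HasDerivWithinAt (fun t => X (t + h)) (x (t + h)) (Icc 0 (S - h)) t := by
    intro X x hX t ht
    have := (hX (t + h) ⟨by linarith [ht.1], by linarith [ht.2]⟩).scomp t (h' := 1)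
      (h := fun s => s + h) (s := Icc 0 (S - h))
      (((hasDerivAt_id t).add_const h).hasDerivWithinAt)
      (fun s hs => ⟨by linarith [hs.1], by linarith [hs.2]⟩)
    rwa [one_smul] at this
  exact ⟨aux hs.deriv_u, aux hs.deriv_w,
    fun t ht => hs.eq (t + h) ⟨by linarith [ht.1], by linarith [ht.2]⟩⟩

section Lipschitz

variable {F : H → H} {G : K → K} {k l : NNReal}

/-- A common Lipschitz constant of `F ∘ ι` and `G ∘ γ`. -/
def lipConst (D : WaveData V H K) (k l : NNReal) : ℝ := k * ‖D.ι‖ + l * ‖D.γ‖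

lemma lipConst_nonneg : 0 ≤ D.lipConst k l := by unfold lipConst; positivity

lemma norm_comp_ι_sub_le (hF : LipschitzWith k F) (x y : V) :
    ‖F (D.ι x) - F (D.ι y)‖ ≤ D.lipConst k l * ‖x - y‖ := by
  have h1 := hF.dist_le_mul (D.ι x) (D.ι y)
  rw [dist_eq_norm, dist_eq_norm, ← map_sub] at h1
  have h2 : (k : ℝ) * ‖D.ι (x - y)‖ ≤ k * (‖D.ι‖ * ‖x - y‖) :=
    mul_le_mul_of_nonneg_left (D.ι.le_opNorm _) k.2
  have h3 : 0 ≤ (l : ℝ) * ‖D.γ‖ * ‖x - y‖ := by positivity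
  unfold lipConst
  linarith

lemma norm_comp_γ_sub_le (hG : LipschitzWith l G) (x y : V) :
    ‖G (D.γ x) - G (D.γ y)‖ ≤ D.lipConst k l * ‖x - y‖ := by
  have h1 := hG.dist_le_mul (D.γ x) (D.γ y)
  rw [dist_eq_norm, dist_eq_norm, ← map_sub] at h1
  have h2 : (l : ℝ) * ‖D.γ (x - y)‖ ≤ l * (‖D.γ‖ * ‖x - y‖) :=
    mul_le_mul_of_nonneg_left (D.γ.le_opNorm _) l.2
  have h3 : 0 ≤ (k : ℝ) * ‖D.ι‖ * ‖x - y‖ := by positivity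
  unfold lipConst
  linarith

/-- Comparison of two regularized solutions. -/
lemma IsRegSol.compare (hF : LipschitzWith k F) (hG : LipschitzWith l G) {ε ε' S ρ ε₀ : ℝ}
    {u w A u' w' A' : ℝ → V} (h : D.IsRegSol F G ε S u w A) (h' : D.IsRegSol F G ε' S u' w' A')
    (hε : 0 ≤ ε₀) (hρ : 0 ≤ ρ)
    (hr : ∀ t ∈ Icc 0 S, inner ℝ (ε₀ • (A t - A' t) - (ε • A t - ε' • A' t)) (w t - w' t) ≤ ρ)
    {t : ℝ} (ht : t ∈ Icc 0 S) :
    ‖u t - u' t‖ ^ 2 + ‖D.ι (w t - w' t)‖ ^ 2 + ε₀ * ‖w t - w' t‖ ^ 2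
        + D.b * ∫ s in (0 : ℝ)..t, ‖D.γ (w s - w' s)‖ ^ 2
      ≤ Real.exp ((D.lipConst k l + D.lipConst k l ^ 2 / D.b) * S)
        * (‖u 0 - u' 0‖ ^ 2 + ‖D.ι (w 0 - w' 0)‖ ^ 2 + ε₀ * ‖w 0 - w' 0‖ ^ 2 + 2 * ρ * S) := by
  -- The inertia coefficient `ε₀` of the difference is free. With ε = ε' = ε₀ the residual vanishes;
  -- with ε₀ = 0 it consists of the two inertia terms.
  refine reg_energy_le (U := fun t => u t - u' t) (W := fun t => w t - w' t)
    (A := fun t => A t - A' t)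
    (r := fun t => ε₀ • (A t - A' t) - (ε • A t - ε' • A' t))
    (f := fun t => F (D.ι (u t)) - F (D.ι (u' t))) (g := fun t => G (D.γ (u t)) - G (D.γ (u' t)))
    (fun t ht => (h.deriv_u t ht).sub (h'.deriv_u t ht))
    (fun t ht => (h.deriv_w t ht).sub (h'.deriv_w t ht)) (fun t ht => ?_) hε lipConst_nonneg hρ
    (fun t _ => norm_comp_ι_sub_le hF _ _) (fun t _ => norm_comp_γ_sub_le hG _ _) hr ht
  rw [frc_sub, ← h.eq t ht, ← h'.eq t ht, map_sub, mom_sub]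
  abel

/-- Uniform higher-order bounds for regularized solutions with compatible initial data. -/
lemma exists_reg_bound (hF : LipschitzWith k F) (hG : LipschitzWith l G) {a b : V} {h₀ : H}
    (hc : a + D.γ.adjoint (D.B (D.γ b)) - D.γ.adjoint (G (D.γ a)) = D.ι.adjoint h₀)
    {S : ℝ} (hS : 0 ≤ S) :
    ∃ M : ℝ, 0 ≤ M ∧ ∀ (ε : ℝ) (u w A : ℝ → V), 0 < ε → u 0 = a → w 0 = b →
      D.IsRegSol F G ε (S + 1) u w A →
        ∀ t ∈ Icc 0 S, ‖w t‖ ≤ M ∧ Real.sqrt ε * ‖A t‖ ≤ M := by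
  set X := Real.exp ((D.lipConst k l + D.lipConst k l ^ 2 / D.b) * (S + 1)) with hX
  set h₁ := F (D.ι a) - D.lam • D.ι b - h₀ with hh₁
  refine ⟨Real.sqrt (X * (‖b‖ ^ 2 + ‖h₁‖ ^ 2)), Real.sqrt_nonneg _, ?_⟩
  intro ε u w A hε hu hw hs t ht
  have hb := D.b_pos
  have hL : 0 ≤ D.lipConst k l := lipConst_nonneg
  have h0 : (0 : ℝ) ∈ Icc 0 (S + 1) := ⟨le_rfl, by linarith⟩
  -- the initial acceleration
  have hA0 : ε * ‖A 0‖ ^ 2 + ‖D.ι (A 0)‖ ^ 2 ≤ ‖h₁‖ ^ 2 := by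
    -- Compatibility puts the whole initial force in the range of ι*. Pairing with `A 0` then bounds
    -- the initial acceleration independently of `ε`.
    have e1 : ε • A 0 + D.ι.adjoint (D.ι (A 0)) = D.ι.adjoint h₁ := by
      have e := hs.eq 0 h0
      rw [hu, hw] at e
      rw [hh₁, map_sub, map_sub, ← hc]
      simp only [mom, frc, map_add] at e
      have : ε • A 0 + D.ι.adjoint (D.ι (A 0)) = (ε • A 0 + (D.ι.adjoint (D.ι (A 0))
        + D.ι.adjoint (D.lam • D.ι b) + D.γ.adjoint (D.B (D.γ b))))
        - D.ι.adjoint (D.lam • D.ι b) - D.γ.adjoint (D.B (D.γ b)) := by abel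
      rw [this, e]
      abel
    have e2 := congrArg (fun z => inner ℝ z (A 0)) e1
    simp only [inner_add_left, real_inner_smul_left, ContinuousLinearMap.adjoint_inner_left,
      real_inner_self_eq_norm_sq] at e2
    have e3 := real_inner_le_norm h₁ (D.ι (A 0))
    have e4 : 0 ≤ ε * ‖A 0‖ ^ 2 := by positivity
    nlinarith [sq_nonneg (‖h₁‖ - ‖D.ι (A 0)‖), sq_nonneg (‖h₁‖), norm_nonneg (D.ι (A 0))]
  -- The solution is compared with its own time shift, with zero residual, and the estimate is
  -- divided by h². The extra unit of time makes room for the shift.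
  have hq : ∀ᶠ h in 𝓝[>] (0 : ℝ), ‖dq h u t‖ ^ 2 + ‖D.ι (dq h w t)‖ ^ 2 + ε * ‖dq h w t‖ ^ 2
      ≤ X * (‖dq h u 0‖ ^ 2 + ‖D.ι (dq h w 0)‖ ^ 2 + ε * ‖dq h w 0‖ ^ 2) := by
    filter_upwards [Ioo_mem_nhdsGT (zero_lt_one' ℝ)] with h hh
    have hc := (hs.shift hh.1.le).compare hF hG (hs.mono (by linarith [hh.1] : S + 1 - h ≤ S + 1))
      hε.le le_rfl (fun s _ => by simp [smul_sub]) (t := t) ⟨ht.1, by linarith [ht.2, hh.2]⟩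
    have hJ : 0 ≤ D.b * ∫ s in (0 : ℝ)..t, ‖D.γ (w (s + h) - w s)‖ ^ 2 :=
      mul_nonneg hb.le (intervalIntegral.integral_nonneg ht.1 fun s _ => by positivity)
    have hXX : Real.exp ((D.lipConst k l + D.lipConst k l ^ 2 / D.b) * (S + 1 - h)) ≤ X := by
      refine Real.exp_le_exp.mpr (mul_le_mul_of_nonneg_left (by linarith [hh.1]) (by positivity))
    have hi : 0 < h⁻¹ ^ 2 := by have := hh.1; positivity
    have hn : 0 ≤ ‖u (0 + h) - u 0‖ ^ 2 + ‖D.ι (w (0 + h) - w 0)‖ ^ 2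
      + ε * ‖w (0 + h) - w 0‖ ^ 2 := by positivity
    have h2 := mul_le_mul_of_nonneg_right hXX hn
    have h3 : ‖u (t + h) - u t‖ ^ 2 + ‖D.ι (w (t + h) - w t)‖ ^ 2 + ε * ‖w (t + h) - w t‖ ^ 2
      ≤ X * (‖u (0 + h) - u 0‖ ^ 2 + ‖D.ι (w (0 + h) - w 0)‖ ^ 2
        + ε * ‖w (0 + h) - w 0‖ ^ 2) := by
      simp only [mul_zero, zero_mul, add_zero] at hc
      linarith
    have h4 := mul_le_mul_of_nonneg_left h3 hi.le
    simp only [dq, map_smul, norm_smul, norm_inv, Real.norm_of_nonneg hh.1.le, mul_pow]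
    linarith
  have ht1 : t < S + 1 := by linarith [ht.2]
  have h01 : (0 : ℝ) < S + 1 := by linarith
  have ht' : t ∈ Icc 0 (S + 1) := ⟨ht.1, ht1.le⟩
  have lim : ∀ s ∈ Icc 0 (S + 1), s < S + 1 → Tendsto (fun h => ‖dq h u s‖ ^ 2
      + ‖D.ι (dq h w s)‖ ^ 2 + ε * ‖dq h w s‖ ^ 2) (𝓝[>] 0)
      (𝓝 (‖w s‖ ^ 2 + ‖D.ι (A s)‖ ^ 2 + ε * ‖A s‖ ^ 2)) := by
    intro s hs0 hs1
    have l1 := dq_tendsto (hasDerivWithinAt_Ici_of_Icc (hs.deriv_u s hs0) hs0.1 hs1)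
    have l2 := dq_tendsto (hasDerivWithinAt_Ici_of_Icc (hs.deriv_w s hs0) hs0.1 hs1)
    exact ((l1.norm.pow 2).add (((D.ι.continuous.tendsto _).comp l2).norm.pow 2)).add
      ((l2.norm.pow 2).const_mul ε)
  have hle := le_of_tendsto_of_tendsto (lim t ht' ht1) ((lim 0 h0 h01).const_mul X) hq
  rw [hw] at hle
  have hXp : 0 < X := Real.exp_pos _
  have hfin : ‖w t‖ ^ 2 + ‖D.ι (A t)‖ ^ 2 + ε * ‖A t‖ ^ 2 ≤ X * (‖b‖ ^ 2 + ‖h₁‖ ^ 2) := by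
    refine hle.trans (mul_le_mul_of_nonneg_left ?_ hXp.le)
    linarith
  constructor
  · refine Real.le_sqrt_of_sq_le ?_
    have : 0 ≤ ‖D.ι (A t)‖ ^ 2 + ε * ‖A t‖ ^ 2 := by positivity
    linarith
  · refine Real.le_sqrt_of_sq_le ?_
    rw [mul_pow, Real.sq_sqrt hε.le]
    have : 0 ≤ ‖w t‖ ^ 2 + ‖D.ι (A t)‖ ^ 2 := by positivity
    linarith

end Lipschitz

end WaveData

end TwoPointWave

end

/-! ### Convergence of the regularized solutions and existence for Lipschitz nonlinearities. -/

noncomputable section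

namespace TwoPointWave

variable {V H K : Type*} [NormedAddCommGroup V] [InnerProductSpace ℝ V] [CompleteSpace V]
  [NormedAddCommGroup H] [InnerProductSpace ℝ H] [CompleteSpace H]
  [NormedAddCommGroup K] [InnerProductSpace ℝ K] [CompleteSpace K]

namespace WaveData

variable {D : WaveData V H K}

/-- The squared distance, in the energy norm at time `t` together with the boundary dissipation up
to time `t`, between two curves `u`, `u'` with velocities `w`, `w'`. -/
def gap (D : WaveData V H K) (u w u' w' : ℝ → V) (t : ℝ) : ℝ :=
  ‖u t - u' t‖ ^ 2 + ‖D.ι (w t - w' t)‖ ^ 2 + D.b * ∫ s in (0 : ℝ)..t, ‖D.γ (w s - w' s)‖ ^ 2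

lemma norm_add_three_sq_le {E : Type*} [SeminormedAddCommGroup E] (x y z : E) :
    ‖x + y + z‖ ^ 2 ≤ 3 * (‖x‖ ^ 2 + ‖y‖ ^ 2 + ‖z‖ ^ 2) := by
  have h := norm_add₃_le (a := x) (b := y) (c := z)
  have h2 := pow_le_pow_left₀ (norm_nonneg _) h 2
  nlinarith [sq_nonneg (‖x‖ - ‖y‖), sq_nonneg (‖x‖ - ‖z‖), sq_nonneg (‖y‖ - ‖z‖)]

/-- Two approximations differ both in data and in inertia; they are compared through two
intermediate curves, each leg changing one of these. -/
lemma gap_triangle {S t : ℝ} {u₁ w₁ u₂ w₂ u₃ w₃ u₄ w₄ : ℝ → V}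
    (h₁ : ContinuousOn w₁ (Icc 0 S)) (h₂ : ContinuousOn w₂ (Icc 0 S))
    (h₃ : ContinuousOn w₃ (Icc 0 S)) (h₄ : ContinuousOn w₄ (Icc 0 S)) (ht : t ∈ Icc 0 S) :
    D.gap u₁ w₁ u₄ w₄ t
      ≤ 3 * (D.gap u₁ w₁ u₂ w₂ t + D.gap u₂ w₂ u₃ w₃ t + D.gap u₃ w₃ u₄ w₄ t) := by
  have hi : ∀ {w w' : ℝ → V}, ContinuousOn w (Icc 0 S) → ContinuousOn w' (Icc 0 S) →
      IntervalIntegrable (fun s => ‖D.γ (w s - w' s)‖ ^ 2) volume 0 t := fun h h' => by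
    refine ContinuousOn.intervalIntegrable ?_
    rw [uIcc_of_le ht.1]
    exact ((D.γ.continuous.comp_continuousOn (h.sub h')).norm.pow 2).mono
      (Icc_subset_Icc_right ht.2)
  have e1 : ‖u₁ t - u₄ t‖ ^ 2
      ≤ 3 * (‖u₁ t - u₂ t‖ ^ 2 + ‖u₂ t - u₃ t‖ ^ 2 + ‖u₃ t - u₄ t‖ ^ 2) := by
    rw [show u₁ t - u₄ t = (u₁ t - u₂ t) + (u₂ t - u₃ t) + (u₃ t - u₄ t) by abel]
    exact norm_add_three_sq_le _ _ _
  have e2 : ∀ (A : ℝ → V) (B : ℝ → V) (C : ℝ → V) (E : ℝ → V) (s : ℝ),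
      A s - E s = (A s - B s) + (B s - C s) + (C s - E s) := fun A B C E s => by abel
  have e3 : ‖D.ι (w₁ t - w₄ t)‖ ^ 2 ≤ 3 * (‖D.ι (w₁ t - w₂ t)‖ ^ 2 + ‖D.ι (w₂ t - w₃ t)‖ ^ 2
      + ‖D.ι (w₃ t - w₄ t)‖ ^ 2) := by
    rw [e2 w₁ w₂ w₃ w₄, map_add, map_add]
    exact norm_add_three_sq_le _ _ _
  have e4 : ∫ s in (0 : ℝ)..t, ‖D.γ (w₁ s - w₄ s)‖ ^ 2
      ≤ 3 * ((∫ s in (0 : ℝ)..t, ‖D.γ (w₁ s - w₂ s)‖ ^ 2)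
        + (∫ s in (0 : ℝ)..t, ‖D.γ (w₂ s - w₃ s)‖ ^ 2)
        + ∫ s in (0 : ℝ)..t, ‖D.γ (w₃ s - w₄ s)‖ ^ 2) := by
    rw [← intervalIntegral.integral_add (hi h₁ h₂) (hi h₂ h₃),
      ← intervalIntegral.integral_add ((hi h₁ h₂).add (hi h₂ h₃)) (hi h₃ h₄),
      ← intervalIntegral.integral_const_mul]
    refine intervalIntegral.integral_mono_on ht.1 (hi h₁ h₄)
      ((((hi h₁ h₂).add (hi h₂ h₃)).add (hi h₃ h₄)).const_mul 3) fun s _ => ?_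
    rw [e2 w₁ w₂ w₃ w₄, map_add, map_add]
    exact norm_add_three_sq_le _ _ _
  have e5 := mul_le_mul_of_nonneg_left e4 D.b_pos.le
  unfold gap
  linarith

variable {F : H → H} {G : K → K} {k l : NNReal}

lemma IsRegSol.hasDerivWithinAt_mom {ε S t : ℝ} {u w A : ℝ → V} (h : D.IsRegSol F G ε S u w A)
    (ht : t ∈ Icc 0 S) :
    HasDerivWithinAt (fun s => ε • w s + D.mom (u s) (D.ι (w s)))
      (D.frc (u t) (F (D.ι (u t))) (G (D.γ (u t)))) (Icc 0 S) t := by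
  rw [← h.eq t ht]
  have d1 := h.deriv_u t ht
  have d2 := h.deriv_w t ht
  unfold mom
  have d3 := (D.ι.hasFDerivAt.comp_hasDerivWithinAt t d2).add
    ((D.ι.hasFDerivAt.comp_hasDerivWithinAt t d1).const_smul D.lam)
  exact (d2.const_smul ε).add ((D.ι.adjoint.hasFDerivAt.comp_hasDerivWithinAt t d3).add
    (D.γ.adjoint.hasFDerivAt.comp_hasDerivWithinAt t
      (D.B.hasFDerivAt.comp_hasDerivWithinAt t (D.γ.hasFDerivAt.comp_hasDerivWithinAt t d1))))

/-- Approximate solutions that converge in the energy norm. -/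
lemma exists_approx (hι : Function.Injective D.ι)
    (hker : ∀ (x : H) (δ : ℝ), 0 < δ → ∃ w : V, D.γ w = 0 ∧ ‖D.ι w - x‖ < δ)
    (hγ : ∀ k : K, ∃ w : V, D.B (D.γ w) = k) (hF : LipschitzWith k F) (hG : LipschitzWith l G)
    {S : ℝ} (hS : 0 < S) (u₀ : V) (v₀ : H) :
    ∃ (ε : ℕ → ℝ) (u w A : ℕ → ℝ → V) (δ : ℕ → ℝ), Tendsto δ atTop (𝓝 0) ∧
      (∀ n, D.IsRegSol F G (ε n) S (u n) (w n) (A n)) ∧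
      (∀ n m, ∀ t ∈ Icc 0 S, D.gap (u n) (w n) (u m) (w m) t ≤ δ n + δ m) ∧
      Tendsto (fun n => u n 0) atTop (𝓝 u₀) ∧ Tendsto (fun n => D.ι (w n 0)) atTop (𝓝 v₀) ∧
      ∀ t ∈ Icc 0 S, Tendsto (fun n => ε n • w n t) atTop (𝓝 0) := by
  have hb := D.b_pos
  set δ : ℕ → ℝ := fun n => 1 / ((n : ℝ) + 1) with hδ
  have hδ0 : ∀ n, 0 < δ n := fun n => by positivity
  have hδ1 : ∀ n, δ n ≤ 1 := fun n => by
    rw [hδ, div_le_iff₀ (by positivity)]; linarith [(Nat.cast_nonneg n : (0 : ℝ) ≤ n)]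
  have hδl : Tendsto δ atTop (𝓝 0) := tendsto_one_div_add_atTop_nhds_zero_nat
  choose a b h₀ hau hbv hcomp using fun n => exists_compatible hι hker hγ G u₀ v₀ (hδ0 n)
  choose M hM0 hM using fun n => exists_reg_bound hF hG (hcomp n) hS.le
  choose u w A hu0 hw0 hreg using fun (n : ℕ) (ε : ℝ) (hε : 0 < ε) =>
    exists_isRegSol D hF hG hε (S + 1) (a n) (b n)
  set X := Real.exp ((D.lipConst k l + D.lipConst k l ^ 2 / D.b) * S) with hX
  have hX0 : 0 < X := Real.exp_pos _
  -- The square root of the inertia for the `n`-th data. The bounds `M n` may grow with `n`; the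
  -- denominator keeps both the comparison error 8SX s M² and the momentum s M below `δ n`.
  set s : ℕ → ℝ := fun n => δ n / (8 * S * X * M n ^ 2 + M n + 1) with hs
  have hden : ∀ n, 0 < 8 * S * X * M n ^ 2 + M n + 1 := fun n => by
    have := hM0 n; positivity
  have hs0 : ∀ n, 0 < s n := fun n => div_pos (hδ0 n) (hden n)
  have hsM : ∀ n, s n * (8 * S * X * M n ^ 2 + M n + 1) = δ n := fun n =>
    div_mul_cancel₀ _ (hden n).ne'
  have hsX : ∀ n, 0 ≤ s n * (8 * S * X * M n ^ 2) := fun n => by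
    have := hs0 n; positivity
  have hsM' : ∀ n, 0 ≤ s n * M n := fun n => mul_nonneg (hs0 n).le (hM0 n)
  have hs1 : ∀ n, s n ≤ 1 := fun n => by nlinarith [hsM n, hsX n, hsM' n, hδ1 n]
  have hE : ∀ n, 0 < s n ^ 2 := fun n => by have := hs0 n; positivity
  have hS1 : S ≤ S + 1 := by linarith
  have cw : ∀ n ε hε, ContinuousOn (w n ε hε) (Icc 0 S) := fun n ε hε t ht =>
    (((hreg n ε hε).mono hS1).deriv_w t ht).continuousWithinAt
  -- For equal data and different inertia both inertia terms are treated as residual; each is at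
  -- most `s n * M n`, since εA = √ε · √εA.
  have same_data : ∀ n ε ε' hε hε', ε ≤ s n ^ 2 → ε' ≤ s n ^ 2 → ∀ t ∈ Icc 0 S,
      D.gap (u n ε hε) (w n ε hε) (u n ε' hε') (w n ε' hε') t ≤ δ n := by
    intro n ε ε' hε hε' hle hle' t ht
    have bnd : ∀ ε hε, ε ≤ s n ^ 2 → ∀ t ∈ Icc 0 S, ‖ε • A n ε hε t‖ ≤ s n * M n := by
      intro ε hε hle t ht
      have h1 := (hM n ε _ _ _ hε (hu0 n ε hε) (hw0 n ε hε) (hreg n ε hε) t ht).2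
      have h2 : Real.sqrt ε ≤ s n := Real.sqrt_le_iff.mpr ⟨(hs0 n).le, hle⟩
      rw [norm_smul, Real.norm_of_nonneg hε.le]
      calc ε * ‖A n ε hε t‖ = Real.sqrt ε * (Real.sqrt ε * ‖A n ε hε t‖) := by
            rw [← mul_assoc, Real.mul_self_sqrt hε.le]
        _ ≤ s n * M n := mul_le_mul h2 h1 (by positivity) (hs0 n).le
    have := ((hreg n ε hε).mono hS1).compare hF hG ((hreg n ε' hε').mono hS1) (ε₀ := 0)
      (ρ := 4 * s n * M n ^ 2) le_rfl (by have := hs0 n; positivity) (fun t ht => by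
        have b1 := bnd ε hε hle t ht
        have b2 := bnd ε' hε' hle' t ht
        have m1 := (hM n ε _ _ _ hε (hu0 n ε hε) (hw0 n ε hε) (hreg n ε hε) t ht).1
        have m2 := (hM n ε' _ _ _ hε' (hu0 n ε' hε') (hw0 n ε' hε') (hreg n ε' hε') t ht).1
        rw [zero_smul, zero_sub, inner_neg_left, ← inner_neg_right]
        refine (real_inner_le_norm _ _).trans ?_
        rw [norm_neg]
        have n1 := norm_sub_le (ε • A n ε hε t) (ε' • A n ε' hε' t)
        have n2 := norm_sub_le (w n ε hε t) (w n ε' hε' t)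
        calc _ ≤ (2 * (s n * M n)) * (2 * M n) :=
              mul_le_mul (by linarith) (by linarith) (norm_nonneg _)
                (by linarith [hsM' n])
          _ = _ := by ring) ht
    rw [hu0, hu0, hw0, hw0] at this
    simp only [sub_self, map_zero, norm_zero, zero_mul, add_zero, ne_eq, OfNat.ofNat_ne_zero,
      not_false_eq_true, zero_pow, zero_add] at this
    have h3 := hsM n
    have h4 := hsM' n
    have h5 := hs0 n
    unfold gap
    linarith
  -- For equal inertia there is no residual, but the velocities `b n` are controlled only in `H`, so
  -- the term ε‖b n - b m‖² has to be kept.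
  have same_eps : ∀ n m ε hε, ∀ t ∈ Icc 0 S,
      D.gap (u n ε hε) (w n ε hε) (u m ε hε) (w m ε hε) t
        ≤ X * (2 * (δ n + δ m) ^ 2 + ε * ‖b n - b m‖ ^ 2) := by
    intro n m ε hε t ht
    have := ((hreg n ε hε).mono hS1).compare hF hG ((hreg m ε hε).mono hS1) (ε₀ := ε)
      hε.le le_rfl (fun t _ => by simp [smul_sub]) ht
    rw [hu0, hu0, hw0, hw0] at this
    have e1 : ‖a n - a m‖ ≤ δ n + δ m := by
      have := norm_sub_le (a n - u₀) (a m - u₀)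
      rw [sub_sub_sub_cancel_right] at this
      linarith [hau n, hau m]
    have e2 : ‖D.ι (b n - b m)‖ ≤ δ n + δ m := by
      have := norm_sub_le (D.ι (b n) - v₀) (D.ι (b m) - v₀)
      rw [sub_sub_sub_cancel_right, ← map_sub] at this
      linarith [hbv n, hbv m]
    have e3 := pow_le_pow_left₀ (norm_nonneg _) e1 2
    have e4 := pow_le_pow_left₀ (norm_nonneg _) e2 2
    have e5 : 0 ≤ ε * ‖w n ε hε t - w m ε hε t‖ ^ 2 := by positivity
    have e6 : X * (‖a n - a m‖ ^ 2 + ‖D.ι (b n - b m)‖ ^ 2 + ε * ‖b n - b m‖ ^ 2 + 2 * 0 * S)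
        ≤ X * (2 * (δ n + δ m) ^ 2 + ε * ‖b n - b m‖ ^ 2) :=
      mul_le_mul_of_nonneg_left (by linarith) hX0.le
    unfold gap
    linarith
  -- The factor 3 is from the triangle inequality, and 5 from 2(δ n + δ m)² + δ n ≤ 5(δ n + δ m),
  -- valid because each δ is at most 1.
  set κ : ℝ := 3 * (1 + 5 * X) with hκ
  refine ⟨fun n => s n ^ 2, fun n => u n _ (hE n), fun n => w n _ (hE n), fun n => A n _ (hE n),
    fun n => κ * δ n, ?_, fun n => (hreg n _ (hE n)).mono hS1, ?_, ?_, ?_, ?_⟩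
  · simpa using hδl.const_mul κ
  · intro n m t ht
    -- The common inertia of the intermediate curves depends on the pair: below both of its
    -- neighbours, and small enough to defeat the uncontrolled distance of `b n` and `b m` in `V`.
    set ε := min (min (s n ^ 2) (s m ^ 2)) (δ n / (‖b n - b m‖ ^ 2 + 1)) with hεdef
    have hε : 0 < ε := lt_min (lt_min (hE n) (hE m)) (div_pos (hδ0 n) (by positivity))
    have hεn : ε ≤ s n ^ 2 := (min_le_left _ _).trans (min_le_left _ _)
    have hεm : ε ≤ s m ^ 2 := (min_le_left _ _).trans (min_le_right _ _)
    have hεd : ε * ‖b n - b m‖ ^ 2 ≤ δ n := by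
      have h1 : ε ≤ δ n / (‖b n - b m‖ ^ 2 + 1) := min_le_right _ _
      rw [le_div_iff₀ (by positivity)] at h1
      linarith
    have g1 := same_data n _ _ (hE n) hε le_rfl hεn t ht
    have g2 := same_eps n m ε hε t ht
    have g3 := same_data m _ _ hε (hE m) hεm le_rfl t ht
    have g4 := gap_triangle (D := D) (u₁ := u n _ (hE n)) (u₂ := u n ε hε) (u₃ := u m ε hε)
      (u₄ := u m _ (hE m)) (cw n _ (hE n)) (cw n ε hε) (cw m ε hε) (cw m _ (hE m)) ht
    have g5 : X * (2 * (δ n + δ m) ^ 2 + ε * ‖b n - b m‖ ^ 2) ≤ X * (5 * (δ n + δ m)) := by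
      refine mul_le_mul_of_nonneg_left ?_ hX0.le
      nlinarith [hδ0 n, hδ0 m, hδ1 n, hδ1 m]
    rw [hκ]
    linarith
  · simp only [hu0]
    rw [tendsto_iff_norm_sub_tendsto_zero]
    exact squeeze_zero (fun _ => norm_nonneg _) (fun n => (hau n).le) hδl
  · simp only [hw0]
    rw [tendsto_iff_norm_sub_tendsto_zero]
    exact squeeze_zero (fun _ => norm_nonneg _) (fun n => (hbv n).le) hδl
  · intro t ht
    rw [tendsto_zero_iff_norm_tendsto_zero]
    refine squeeze_zero (fun _ => norm_nonneg _) (fun n => ?_) hδl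
    have m1 := (hM n _ _ _ _ (hE n) (hu0 n _ (hE n)) (hw0 n _ (hE n)) (hreg n _ (hE n)) t ht).1
    rw [norm_smul, Real.norm_of_nonneg (hE n).le]
    calc s n ^ 2 * ‖w n _ (hE n) t‖ ≤ s n * M n :=
          mul_le_mul (by nlinarith [hs0 n, hs1 n]) m1 (norm_nonneg _) (hs0 n).le
      _ ≤ δ n := by linarith [hsM n, hsX n, hs0 n]

lemma tendsto_mom {α : Type*} {L : Filter α} {u : α → V} {v : α → H} {u₀ : V} {v₀ : H}
    (hu : Tendsto u L (𝓝 u₀)) (hv : Tendsto v L (𝓝 v₀)) :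
    Tendsto (fun x => D.mom (u x) (v x)) L (𝓝 (D.mom u₀ v₀)) := by
  unfold mom
  exact ((D.ι.adjoint.continuous.tendsto _).comp
    (hv.add (((D.ι.continuous.tendsto _).comp hu).const_smul D.lam))).add
    (((D.γ.adjoint.comp (D.B.comp D.γ)).continuous.tendsto _).comp hu)

lemma exists_lipschitzWith_frc (D : WaveData V H K) (hF : LipschitzWith k F)
    (hG : LipschitzWith l G) :
    ∃ q, LipschitzWith q (fun u => D.frc u (F (D.ι u)) (G (D.γ u))) :=
  ⟨_, (LipschitzWith.id.neg.add (D.ι.adjoint.lipschitz.comp (hF.comp D.ι.lipschitz))).add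
    (D.γ.adjoint.lipschitz.comp (hG.comp D.γ.lipschitz))⟩

/-- Existence of weak solutions, with square integrable traces of the velocity, of the abstract
damped wave equation with globally Lipschitz nonlinearities. -/
theorem exists_isSol (hι : Function.Injective D.ι)
    (hker : ∀ (x : H) (δ : ℝ), 0 < δ → ∃ w : V, D.γ w = 0 ∧ ‖D.ι w - x‖ < δ)
    (hγ : ∀ k : K, ∃ w : V, D.B (D.γ w) = k) (hF : LipschitzWith k F) (hG : LipschitzWith l G)
    {S : ℝ} (hS : 0 < S) (u₀ : V) (v₀ : H) :
    ∃ (u : ℝ → V) (v : ℝ → H) (d : ℝ → K), u 0 = u₀ ∧ v 0 = v₀ ∧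
      D.IsSol 0 S u v (fun t => F (D.ι (u t))) (fun t => G (D.γ (u t))) ∧
      MemLp d 2 (volume.restrict (Ioc 0 S)) ∧
      ∀ t ∈ Icc 0 S, D.γ (u t) = D.γ u₀ + ∫ s in (0 : ℝ)..t, d s := by
  have hb := D.b_pos
  obtain ⟨ε, u, w, A, δ, hδ, hreg, hgap, hu0, hw0, hεw⟩ :=
    exists_approx hι hker hγ hF hG hS u₀ v₀
  have cw : ∀ n, ContinuousOn (w n) (Icc 0 S) := fun n t ht =>
    ((hreg n).deriv_w t ht).continuousWithinAt
  have hint : ∀ n m, ∀ t, 0 ≤ t → 0 ≤ D.b * ∫ s in (0 : ℝ)..t, ‖D.γ (w n s - w m s)‖ ^ 2 :=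
    fun n m t ht => mul_nonneg hb.le (intervalIntegral.integral_nonneg ht fun s _ => by positivity)
  obtain ⟨y, hy⟩ := exists_tendstoUniformlyOn (x := u) (s := Icc 0 S) hδ (fun n m t ht => by
    have h1 := hgap n m t ht
    have h2 := hint n m t ht.1
    unfold gap at h1
    nlinarith [sq_nonneg ‖D.ι (w n t - w m t)‖])
  obtain ⟨v, hv⟩ := exists_tendstoUniformlyOn (x := fun n t => D.ι (w n t)) (s := Icc 0 S) hδ
    (fun n m t ht => by
      have h1 := hgap n m t ht
      have h2 := hint n m t ht.1
      unfold gap at h1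
      rw [← map_sub]
      nlinarith [sq_nonneg ‖u n t - u m t‖])
  obtain ⟨d, hd, hdl⟩ := exists_L2_limit hS.le (x := fun n t => D.γ (w n t))
    (δ := fun n => D.b⁻¹ * δ n) (fun n => D.γ.continuous.comp_continuousOn (cw n))
    (by simpa using hδ.const_mul D.b⁻¹) (fun n m => by
      have h1 := hgap n m S ⟨hS.le, le_rfl⟩
      unfold gap at h1
      simp only [← map_sub]
      rw [← mul_add, le_inv_mul_iff₀ hb]
      nlinarith [sq_nonneg ‖u n S - u m S‖, sq_nonneg ‖D.ι (w n S - w m S)‖])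
  have h0 : (0 : ℝ) ∈ Icc 0 S := ⟨le_rfl, hS.le⟩
  have y0 : y 0 = u₀ := tendsto_nhds_unique (hy.tendsto_at h0) hu0
  have v0 : v 0 = v₀ := tendsto_nhds_unique (hv.tendsto_at h0) hw0
  have cy : ContinuousOn y (Icc 0 S) := hy.continuousOn (Frequently.of_forall fun n t ht =>
    ((hreg n).deriv_u t ht).continuousWithinAt)
  have cv : ContinuousOn v (Icc 0 S) := hv.continuousOn (Frequently.of_forall fun n =>
    D.ι.continuous.comp_continuousOn (cw n))
  have cF : ContinuousOn (fun t => F (D.ι (y t))) (Icc 0 S) :=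
    (hF.continuous.comp D.ι.continuous).comp_continuousOn cy
  have cG : ContinuousOn (fun t => G (D.γ (y t))) (Icc 0 S) :=
    (hG.continuous.comp D.γ.continuous).comp_continuousOn cy
  obtain ⟨q, hq⟩ := D.exists_lipschitzWith_frc hF hG
  have uΦ : TendstoUniformlyOn (fun n t => D.frc (u n t) (F (D.ι (u n t))) (G (D.γ (u n t))))
      (fun t => D.frc (y t) (F (D.ι (y t))) (G (D.γ (y t)))) atTop (Icc 0 S) :=
    hq.uniformContinuous.comp_tendstoUniformlyOn hy
  have cΦ : ContinuousOn (fun t => D.frc (y t) (F (D.ι (y t))) (G (D.γ (y t)))) (Icc 0 S) :=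
    hq.continuous.comp_continuousOn cy
  refine ⟨y, v, d, y0, v0, ⟨cy, cv, cF, cG, ?_, ?_⟩, hd, ?_⟩
  · exact hasDerivWithinAt_of_tendstoUniformlyOn (X := fun n t => D.ι (u n t))
      (fun n t ht => D.ι.hasFDerivAt.comp_hasDerivWithinAt t ((hreg n).deriv_u t ht))
      (fun t ht => (D.ι.continuous.tendsto _).comp (hy.tendsto_at ht)) hv cv
  -- The regularized momentum converges pointwise to the momentum without inertia because ε w → 0,
  -- while its derivative converges uniformly.
  · refine hasDerivWithinAt_of_tendstoUniformlyOn
      (X := fun n t => ε n • w n t + D.mom (u n t) (D.ι (w n t)))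
      (fun n t ht => (hreg n).hasDerivWithinAt_mom ht) (fun t ht => ?_) uΦ cΦ
    have l1 := hy.tendsto_at ht
    have l2 := hv.tendsto_at ht
    have l3 := (hεw t ht).add (tendsto_mom (D := D) l1 l2)
    rwa [zero_add] at l3
  · intro t ht
    have e : ∀ n, ∫ s in (0 : ℝ)..t, D.γ (w n s) = D.γ (u n t) - D.γ (u n 0) := fun n =>
      integral_eq_sub_of_hasDerivWithinAt (X := fun t => D.γ (u n t))
        (fun t ht => D.γ.hasFDerivAt.comp_hasDerivWithinAt t ((hreg n).deriv_u t ht))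
        (D.γ.continuous.comp_continuousOn (cw n)) ht
    have l1 := hdl t ht
    simp only [e] at l1
    have l2 : Tendsto (fun n => D.γ (u n t) - D.γ (u n 0)) atTop (𝓝 (D.γ (y t) - D.γ u₀)) :=
      ((D.γ.continuous.tendsto _).comp (hy.tendsto_at ht)).sub
        ((D.γ.continuous.tendsto _).comp hu0)
    rw [← tendsto_nhds_unique l2 l1]
    abel

end WaveData

end TwoPointWave

end

/-! ### The concrete spaces: completeness of H¹, point evaluation and trace. -/

noncomputable section

namespace TwoPointWave

lemma L2.inner_eq (f g : L2) : inner ℝ f g = ∫ x in Ioo (0 : ℝ) 1, f x * g x := by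
  rw [L2.inner_def]
  refine integral_congr_ae (Eventually.of_forall fun x => ?_)
  simp [mul_comm]

lemma L2.inner_toLp (f : L2) {ψ : ℝ → ℝ} (hψ : MemLp ψ 2 (volume.restrict (Ioo (0 : ℝ) 1))) :
    inner ℝ f hψ.toLp = ∫ x in Ioo (0 : ℝ) 1, f x * ψ x := by
  rw [L2.inner_eq]
  refine integral_congr_ae ?_
  filter_upwards [hψ.coeFn_toLp] with x hx
  rw [hx]

lemma memLp_of_continuousOn {f : ℝ → ℝ} (hf : ContinuousOn f (Icc 0 1)) :
    MemLp f 2 (volume.restrict (Ioo (0 : ℝ) 1)) := by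
  obtain ⟨C, hC⟩ := isCompact_Icc.exists_bound_of_continuousOn hf
  refine MemLp.of_bound ((hf.mono Ioo_subset_Icc_self).aestronglyMeasurable measurableSet_Ioo) C ?_
  rw [ae_restrict_iff' measurableSet_Ioo]
  exact Eventually.of_forall fun t ht => hC t (Ioo_subset_Icc_self ht)

lemma eqOn_Icc_of_ae_eq_Ioo {f g : ℝ → ℝ} {T : ℝ} (hT : 0 < T)
    (h : f =ᵐ[volume.restrict (Ioo 0 T)] g) (hf : ContinuousOn f (Icc 0 T))
    (hg : ContinuousOn g (Icc 0 T)) : EqOn f g (Icc 0 T) :=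
  Measure.eqOn_Icc_of_ae_eq volume hT.ne
    (by rwa [← restrict_Ioo_eq_restrict_Icc]) hf hg

/-- Each test function imposes an equality of two continuous linear functionals of the pair (v,
v_x), so the pairs form a closed subspace. -/
instance : CompleteSpace H1 := by
  suffices h : IsClosed (h1Submodule : Set (WithLp 2 (L2 × L2))) from h.completeSpace_coe
  have : (h1Submodule : Set (WithLp 2 (L2 × L2))) = ⋂ (φ : ℝ → ℝ) (h1 : ContDiff ℝ ∞ φ)
      (h2 : HasCompactSupport φ) (_ : tsupport φ ⊆ Ioo 0 1),
      {z | ∫ x in Ioo (0 : ℝ) 1, z.fst x * deriv φ x = -∫ x in Ioo (0 : ℝ) 1, z.snd x * φ x} := by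
    ext z
    simp only [mem_iInter]
    rfl
  rw [this]
  refine isClosed_iInter fun φ => isClosed_iInter fun h1 => isClosed_iInter fun h2 =>
    isClosed_iInter fun _ => ?_
  have hd : Continuous (deriv φ) := h1.continuous_deriv (by simp)
  have m1 := memLp_of_continuousOn hd.continuousOn
  have m2 := memLp_of_continuousOn h1.continuous.continuousOn
  simp only [← L2.inner_toLp _ m1, ← L2.inner_toLp _ m2]
  have c1 : Continuous fun z : WithLp 2 (L2 × L2) => z.fst := (WithLp.fstL 2 ℝ L2 L2).continuous
  have c2 : Continuous fun z : WithLp 2 (L2 × L2) => z.snd := (WithLp.sndL 2 ℝ L2 L2).continuous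
  exact isClosed_eq (c1.inner continuous_const) (c2.inner continuous_const).neg

namespace H1

lemma inner_eq (v w : H1) : inner ℝ v w = inner ℝ v.toL2 w.toL2 + inner ℝ v.dx w.dx := rfl

/-- The embedding of `H¹` into `L²`. -/
def toL2L : H1 →L[ℝ] L2 := (WithLp.fstL 2 ℝ L2 L2).comp h1Submodule.subtypeL

lemma toL2L_apply (v : H1) : toL2L v = v.toL2 := rfl

lemma rep_eqOn (v : H1) {f : ℝ → ℝ} (hf : ContinuousOn f (Icc 0 1))
    (h : f =ᵐ[volume.restrict (Ioo (0 : ℝ) 1)] v.toL2) : EqOn v.rep f (Icc 0 1) :=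
  eqOn_Icc_of_ae_eq_Ioo one_pos (v.rep_ae_eq.trans h.symm) v.rep_continuousOn hf

lemma primitive_continuousOn (g : L2) : ContinuousOn (fun x => ∫ t in (0 : ℝ)..x, g t) (Icc 0 1) := by
  have := ((L2.intervalIntegrable g).absolutelyContinuousOnInterval_intervalIntegral
    (c := 0) (by simp : (0 : ℝ) ∈ uIcc 0 1)).continuousOn
  rwa [uIcc_of_le zero_le_one] at this

/-- The representative minus the primitive of v_x has zero weak derivative, hence is a.e. constant,
and by continuity constant up to the endpoints. -/
lemma rep_eq (v : H1) {x : ℝ} (hx : x ∈ Icc (0 : ℝ) 1) :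
    v.rep x = v.rep 0 + ∫ t in (0 : ℝ)..x, v.dx t := by
  set P : ℝ → ℝ := fun x => ∫ t in (0 : ℝ)..x, v.dx t
  have hP := primitive_continuousOn v.dx
  obtain ⟨c, hc⟩ := ae_const_of_hasWeakDeriv_zero (d := fun x => v.rep x - P x)
    (((v.rep_continuousOn.sub hP).integrableOn_compact isCompact_Icc).mono_set
      Ioo_subset_Icc_self) (by
    intro φ h1 h2 h3
    have hd : Continuous (deriv φ) := h1.continuous_deriv (by simp)
    have i1 : IntegrableOn (fun x => P x * deriv φ x) (Ioo (0 : ℝ) 1) :=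
      ((hP.mul hd.continuousOn).integrableOn_compact isCompact_Icc).mono_set Ioo_subset_Icc_self
    have i2 : IntegrableOn (fun x => v.rep x * deriv φ x) (Ioo (0 : ℝ) 1) :=
      ((v.rep_continuousOn.mul hd.continuousOn).integrableOn_compact isCompact_Icc).mono_set
        Ioo_subset_Icc_self
    have e1 := v.2 φ h1 h2 h3
    have e2 := hasWeakDeriv_primitive v.dx φ h1 h2 h3
    have e3 : ∫ x in Ioo (0 : ℝ) 1, v.rep x * deriv φ x
        = ∫ x in Ioo (0 : ℝ) 1, v.toL2 x * deriv φ x := by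
      refine integral_congr_ae ?_
      filter_upwards [v.rep_ae_eq] with x hx
      rw [hx]
    simp only [sub_mul, Pi.zero_apply, zero_mul, integral_zero, neg_zero]
    rw [integral_sub i2 i1, e3]
    exact sub_eq_zero.mpr (e1.trans e2.symm))
  have he := eqOn_Icc_of_ae_eq_Ioo one_pos hc (v.rep_continuousOn.sub hP) continuousOn_const
  have h0 := he (x := 0) (by simp)
  have h1 := he hx
  simp only [P, intervalIntegral.integral_same] at h0 h1
  linarith

lemma rep_add (v w : H1) {x : ℝ} (hx : x ∈ Icc (0 : ℝ) 1) : (v + w).rep x = v.rep x + w.rep x := by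
  refine rep_eqOn (v + w) (v.rep_continuousOn.add w.rep_continuousOn) ?_ hx
  filter_upwards [v.rep_ae_eq, w.rep_ae_eq, Lp.coeFn_add v.toL2 w.toL2] with x h1 h2 h3
  have : (v + w).toL2 = v.toL2 + w.toL2 := rfl
  rw [this, h3, Pi.add_apply, Pi.add_apply, h1, h2]

lemma rep_smul (c : ℝ) (v : H1) {x : ℝ} (hx : x ∈ Icc (0 : ℝ) 1) :
    (c • v).rep x = c * v.rep x := by
  refine rep_eqOn (c • v) (continuousOn_const.mul v.rep_continuousOn) ?_ hx
  filter_upwards [v.rep_ae_eq, Lp.coeFn_smul c v.toL2] with x h1 h3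
  have : (c • v).toL2 = c • v.toL2 := rfl
  rw [this, h3, Pi.smul_apply, Pi.mul_apply, h1, smul_eq_mul]

lemma integral_abs_le (f : L2) : ∫ x in Ioo (0 : ℝ) 1, |f x| ≤ ‖f‖ := by
  have m1 : MemLp (fun x => |f x|) 2 (volume.restrict (Ioo (0 : ℝ) 1)) := (Lp.memLp f).norm
  have m2 : MemLp (fun _ : ℝ => (1 : ℝ)) 2 (volume.restrict (Ioo (0 : ℝ) 1)) := memLp_const 1
  have h := real_inner_le_norm m1.toLp m2.toLp
  rw [L2.inner_toLp] at h
  have e1 : ∫ x in Ioo (0 : ℝ) 1, (m1.toLp : L2) x * 1 = ∫ x in Ioo (0 : ℝ) 1, |f x| := by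
    refine integral_congr_ae ?_
    filter_upwards [m1.coeFn_toLp] with x hx
    rw [hx, mul_one]
  have e2 : ‖m1.toLp‖ = ‖f‖ := by
    rw [Lp.norm_toLp, Lp.norm_def]
    congr 1
    exact eLpNorm_norm f
  have e3 : ‖m2.toLp‖ = 1 := by
    rw [Lp.norm_toLp, eLpNorm_const _ (by norm_num) (by simp)]
    simp
  rw [e1, e2, e3, mul_one] at h
  exact h

/-- The trace inequality. -/
lemma rep_sq_le (v : H1) {y : ℝ} (hy : y ∈ Icc (0 : ℝ) 1) : v.rep y ^ 2 ≤ 2 * ‖v‖ ^ 2 := by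
  have hi := L2.intervalIntegrable v.dx
  -- This bound is integrated over `x` in the unit interval, which turns the pointwise value at `x`
  -- into an L¹ norm, bounded by the L² norm.
  have h1 : ∀ x ∈ Ioo (0 : ℝ) 1, |v.rep y| ≤ |v.rep x| + ‖v.dx‖ := by
    intro x hx
    have e : v.rep y - v.rep x = ∫ t in x..y, v.dx t := by
      have hs : ∀ z ∈ Icc (0 : ℝ) 1, IntervalIntegrable v.dx volume 0 z := fun z hz =>
        hi.mono_set (by rw [uIcc_of_le hz.1, uIcc_of_le zero_le_one]; exact Icc_subset_Icc_right hz.2)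
      rw [v.rep_eq hy, v.rep_eq (Ioo_subset_Icc_self hx),
        ← intervalIntegral.integral_interval_sub_left (hs y hy) (hs x (Ioo_subset_Icc_self hx))]
      ring
    have h2 : |∫ t in x..y, v.dx t| ≤ ‖v.dx‖ := by
      refine le_trans ?_ (integral_abs_le v.dx)
      refine (intervalIntegral.norm_integral_le_integral_norm_uIoc (f := v.dx)).trans ?_
      rw [← integral_Ioc_eq_integral_Ioo]
      refine setIntegral_mono_set ?_ (Eventually.of_forall fun t => abs_nonneg _)
        (Eventually.of_forall ?_)
      · exact (((intervalIntegrable_iff_integrableOn_Ioc_of_le zero_le_one).mp hi)).abs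
      · intro t ht
        rcases mem_uIoc.mp ht with h | h
        · exact ⟨hx.1.trans h.1, h.2.trans hy.2⟩
        · exact ⟨hy.1.trans_lt h.1, h.2.trans hx.2.le⟩
    rw [← e] at h2
    have := abs_sub_abs_le_abs_sub (v.rep y) (v.rep x)
    linarith
  have h2 : |v.rep y| ≤ ‖v.toL2‖ + ‖v.dx‖ := by
    have hir : IntegrableOn (fun x => |v.rep x|) (Ioo (0 : ℝ) 1) :=
      ((v.rep_continuousOn.abs).integrableOn_compact isCompact_Icc).mono_set Ioo_subset_Icc_self
    have := setIntegral_mono_on (μ := volume) (s := Ioo (0 : ℝ) 1) (f := fun _ => |v.rep y|)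
      (g := fun x => |v.rep x| + ‖v.dx‖) (integrableOn_const (by simp))
      (hir.add (integrableOn_const (by simp))) measurableSet_Ioo h1
    rw [integral_add hir (integrableOn_const (by simp))] at this
    simp only [setIntegral_const, Real.volume_real_Ioo_of_le zero_le_one, sub_zero, one_smul] at this
    have e : ∫ x in Ioo (0 : ℝ) 1, |v.rep x| = ∫ x in Ioo (0 : ℝ) 1, |v.toL2 x| := by
      refine integral_congr_ae ?_
      filter_upwards [v.rep_ae_eq] with x hx
      rw [hx]
    rw [e] at this
    linarith [integral_abs_le v.toL2]
  have h3 := pow_le_pow_left₀ (abs_nonneg _) h2 2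
  rw [sq_abs] at h3
  rw [H1.norm_sq]
  nlinarith [sq_nonneg (‖v.toL2‖ - ‖v.dx‖)]

lemma abs_rep_le (v : H1) {y : ℝ} (hy : y ∈ Icc (0 : ℝ) 1) : |v.rep y| ≤ 2 * ‖v‖ := by
  refine abs_le_of_sq_le_sq ?_ (by positivity)
  nlinarith [v.rep_sq_le hy, sq_nonneg ‖v‖]

/-- Evaluation at a point of `[0, 1]`. -/
def evalL (y : Icc (0 : ℝ) 1) : H1 →L[ℝ] ℝ :=
  LinearMap.mkContinuous
    { toFun := fun v => v.rep y
      map_add' := fun v w => rep_add v w y.2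
      map_smul' := fun c v => rep_smul c v y.2 } 2 (fun v => v.abs_rep_le y.2)

lemma rep_sub (v w : H1) {x : ℝ} (hx : x ∈ Icc (0 : ℝ) 1) : (v - w).rep x = v.rep x - w.rep x :=
  map_sub (evalL ⟨x, hx⟩) v w

/-- Elements of `H1` carry their derivative as data, so injectivity amounts to uniqueness of weak
derivatives: if v = 0 then v_x annihilates every test function. -/
lemma toL2L_injective : Function.Injective toL2L := by
  rw [injective_iff_map_eq_zero]
  intro v hv
  rw [toL2L_apply] at hv
  have hd : v.dx = 0 := by
    have hz : ∀ᵐ x, x ∈ Ioo (0 : ℝ) 1 → v.dx x = 0 := by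
      refine isOpen_Ioo.ae_eq_zero_of_integral_contDiff_smul_eq_zero ?_ ?_
      · have : IntegrableOn v.dx (Ioo (0 : ℝ) 1) := (Lp.memLp v.dx).integrable one_le_two
        exact this.locallyIntegrableOn
      · intro φ h1 h2 h3
        have e1 := v.2 φ h1 h2 h3
        have e2 : ∫ x in Ioo (0 : ℝ) 1, v.toL2 x * deriv φ x = 0 := by
          refine integral_eq_zero_of_ae ?_
          rw [hv]
          filter_upwards [Lp.coeFn_zero ℝ 2 (volume.restrict (Ioo (0 : ℝ) 1))] with x hx
          rw [hx]; simp
        have e3 : ∫ x, φ x • v.dx x = ∫ x in Ioo (0 : ℝ) 1, v.dx x * φ x := by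
          simp only [smul_eq_mul, mul_comm]
          refine (setIntegral_eq_integral_of_forall_compl_eq_zero fun x hx => ?_).symm
          simp [image_eq_zero_of_notMem_tsupport fun hh => hx (h3 hh)]
        rw [e3]
        have : ∫ x in Ioo (0 : ℝ) 1, v.toL2 x * deriv φ x
          = -∫ x in Ioo (0 : ℝ) 1, v.dx x * φ x := e1
        linarith
    refine Lp.ext ?_
    refine EventuallyEq.trans ?_ (Lp.coeFn_zero ℝ 2 (volume.restrict (Ioo (0 : ℝ) 1))).symm
    rw [EventuallyEq, ae_restrict_iff' measurableSet_Ioo]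
    exact hz
  have := v.norm_sq
  rw [hv, hd] at this
  simpa using this

/-- The element of `H¹` with value `c` at `0` and weak derivative `g`. -/
def ofPrimitive (c : ℝ) (g : L2) : H1 :=
  ⟨WithLp.toLp 2 ((memLp_of_continuousOn
    ((continuousOn_const (c := c)).add (primitive_continuousOn g))).toLp, g), by
    intro φ h1 h2 h3
    have hd : Continuous (deriv φ) := h1.continuous_deriv (by simp)
    have hm := memLp_of_continuousOn
      ((continuousOn_const (c := c)).add (primitive_continuousOn g))
    have e0 : ∫ x in Ioo (0 : ℝ) 1, (hm.toLp : L2) x * deriv φ x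
        = ∫ x in Ioo (0 : ℝ) 1, (c + ∫ t in (0 : ℝ)..x, g t) * deriv φ x := by
      refine integral_congr_ae ?_
      filter_upwards [hm.coeFn_toLp] with x hx
      rw [hx]
      rfl
    have e1 := hasWeakDeriv_primitive g φ h1 h2 h3
    have i1 : IntegrableOn (fun x => c * deriv φ x) (Ioo (0 : ℝ) 1) :=
      ((continuousOn_const.mul hd.continuousOn).integrableOn_compact isCompact_Icc).mono_set
        Ioo_subset_Icc_self
    have i2 : IntegrableOn (fun x => (∫ t in (0 : ℝ)..x, g t) * deriv φ x) (Ioo (0 : ℝ) 1) :=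
      (((primitive_continuousOn g).mul hd.continuousOn).integrableOn_compact
        isCompact_Icc).mono_set Ioo_subset_Icc_self
    have hφ : ∀ y, y ∉ Ioo (0 : ℝ) 1 → φ y = 0 := fun y hy =>
      image_eq_zero_of_notMem_tsupport fun hh => hy (h3 hh)
    have e2 : ∫ x in Ioo (0 : ℝ) 1, c * deriv φ x = 0 := by
      rw [integral_const_mul, ← integral_Ioc_eq_integral_Ioo,
        ← intervalIntegral.integral_of_le zero_le_one,
        intervalIntegral.integral_deriv_eq_sub
          (fun y _ => (h1.differentiable (by simp)).differentiableAt) (hd.intervalIntegrable _ _),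
        hφ 1 (by simp), hφ 0 (by simp)]
      simp
    change ∫ x in Ioo (0 : ℝ) 1, (hm.toLp : L2) x * deriv φ x = -∫ x in Ioo (0 : ℝ) 1, g x * φ x
    rw [e0, ← e1]
    simp only [add_mul]
    rw [integral_add i1 i2, e2, zero_add]⟩

lemma ofPrimitive_toL2 (c : ℝ) (g : L2) :
    (ofPrimitive c g).toL2 =ᵐ[volume.restrict (Ioo (0 : ℝ) 1)]
      fun x => c + ∫ t in (0 : ℝ)..x, g t :=
  (memLp_of_continuousOn ((continuousOn_const (c := c)).add (primitive_continuousOn g))).coeFn_toLp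

lemma rep_ofPrimitive (c : ℝ) (g : L2) {x : ℝ} (hx : x ∈ Icc (0 : ℝ) 1) :
    (ofPrimitive c g).rep x = c + ∫ t in (0 : ℝ)..x, g t :=
  rep_eqOn _ (continuousOn_const.add (primitive_continuousOn g)) (ofPrimitive_toL2 c g).symm hx

/-- The boundary space `ℝ²`. -/
abbrev Bdry : Type := WithLp 2 (ℝ × ℝ)

/-- The trace map `v ↦ (v(0), v(1))`. -/
def traceL : H1 →L[ℝ] Bdry :=
  ((WithLp.prodContinuousLinearEquiv 2 ℝ ℝ ℝ).symm : ℝ × ℝ →L[ℝ] Bdry).comp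
    ((evalL ⟨0, by simp⟩).prod (evalL ⟨1, by simp⟩))

lemma traceL_apply (v : H1) : traceL v = WithLp.toLp 2 (v.rep 0, v.rep 1) := rfl

/-- Affine functions realize all pairs of boundary values. -/
lemma traceL_surjective : Function.Surjective traceL := by
  intro k
  have hm : MemLp (fun _ : ℝ => k.snd - k.fst) 2 (volume.restrict (Ioo (0 : ℝ) 1)) := memLp_const _
  refine ⟨ofPrimitive k.fst hm.toLp, ?_⟩
  have e : ∫ t in (0 : ℝ)..1, (hm.toLp : L2) t = k.snd - k.fst := by
    rw [intervalIntegral.integral_of_le zero_le_one, integral_Ioc_eq_integral_Ioo,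
      integral_congr_ae hm.coeFn_toLp]
    simp
  rw [traceL_apply, rep_ofPrimitive _ _ (by simp), rep_ofPrimitive _ _ (by simp), e]
  simp
  rfl

/-- The kernel of the trace contains all test functions, each realized as the primitive of its
derivative from 0, and nothing nonzero in L² is orthogonal to these. -/
lemma exists_ker_trace_near (x : L2) {δ : ℝ} (hδ : 0 < δ) :
    ∃ w : H1, traceL w = 0 ∧ ‖toL2L w - x‖ < δ := by
  let Z : Submodule ℝ L2 := (traceL.ker).map (toL2L : H1 →ₗ[ℝ] L2)
  have hd : Z.topologicalClosure = ⊤ := by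
    rw [Submodule.topologicalClosure_eq_top_iff, Submodule.eq_bot_iff]
    intro f hf
    rw [Submodule.mem_orthogonal'] at hf
    have hz : ∀ᵐ x, x ∈ Ioo (0 : ℝ) 1 → f x = 0 := by
      refine isOpen_Ioo.ae_eq_zero_of_integral_contDiff_smul_eq_zero ?_ ?_
      · have : IntegrableOn f (Ioo (0 : ℝ) 1) := (Lp.memLp f).integrable one_le_two
        exact this.locallyIntegrableOn
      · intro φ h1 h2 h3
        have hd : Continuous (deriv φ) := h1.continuous_deriv (by simp)
        have hm := memLp_of_continuousOn (hd.continuousOn (s := Icc 0 1))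
        have hφ : ∀ y, y ∉ Ioo (0 : ℝ) 1 → φ y = 0 := fun y hy =>
          image_eq_zero_of_notMem_tsupport fun hh => hy (h3 hh)
        have e : ∀ y ∈ Icc (0 : ℝ) 1, 0 + ∫ t in (0 : ℝ)..y, (hm.toLp : L2) t = φ y := by
          intro y hy
          have e1 : ∫ t in (0 : ℝ)..y, (hm.toLp : L2) t = ∫ t in (0 : ℝ)..y, deriv φ t := by
            rw [intervalIntegral.integral_of_le hy.1, intervalIntegral.integral_of_le hy.1,
              integral_Ioc_eq_integral_Ioo, integral_Ioc_eq_integral_Ioo]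
            refine integral_congr_ae ?_
            exact ae_restrict_of_ae_restrict_of_subset (Ioo_subset_Ioo_right hy.2) hm.coeFn_toLp
          rw [e1, intervalIntegral.integral_deriv_eq_sub
            (fun y _ => (h1.differentiable (by simp)).differentiableAt)
            (hd.intervalIntegrable _ _), hφ 0 (by simp)]
          ring
        have hw : traceL (ofPrimitive 0 hm.toLp) = 0 := by
          rw [traceL_apply, rep_ofPrimitive _ _ (by simp), rep_ofPrimitive _ _ (by simp),
            e 0 (by simp), e 1 (by simp), hφ 0 (by simp), hφ 1 (by simp)]
          rfl
        have := hf (toL2L (ofPrimitive 0 hm.toLp)) ⟨_, hw, rfl⟩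
        rw [L2.inner_eq, toL2L_apply] at this
        have e3 : ∫ x, φ x • f x = ∫ x in Ioo (0 : ℝ) 1, f x * φ x := by
          simp only [smul_eq_mul, mul_comm]
          refine (setIntegral_eq_integral_of_forall_compl_eq_zero fun x hx => ?_).symm
          simp [hφ x hx]
        rw [e3]
        refine Eq.trans ?_ this
        refine integral_congr_ae ?_
        filter_upwards [ofPrimitive_toL2 0 hm.toLp, ae_restrict_mem measurableSet_Ioo]
          with x hx hxI
        rw [hx, e x (Ioo_subset_Icc_self hxI)]
    refine Lp.ext ?_
    refine EventuallyEq.trans ?_ (Lp.coeFn_zero ℝ 2 (volume.restrict (Ioo (0 : ℝ) 1))).symm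
    rw [EventuallyEq, ae_restrict_iff' measurableSet_Ioo]
    exact hz
  have hu : x ∈ closure (Z : Set L2) := by
    rw [← Submodule.topologicalClosure_coe, hd]; trivial
  obtain ⟨_, ⟨w, hw, rfl⟩, ha⟩ := Metric.mem_closure_iff.mp hu δ hδ
  rw [dist_comm, dist_eq_norm] at ha
  exact ⟨w, hw, ha⟩

end H1

end TwoPointWave

end

noncomputable section

namespace TwoPointWave

/-! ### Weak derivatives in time and absolutely continuous functions. -/

section WeakDerivative

variable {T : ℝ} {f g f₁ g₁ f₂ g₂ : ℝ → ℝ}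

/-- `f` is a primitive on `[0, T]` of the integrable function `g`. -/
structure IsPrimitive (T : ℝ) (f g : ℝ → ℝ) : Prop where
  integrableOn : IntegrableOn g (Ioo 0 T)
  eq : ∀ t ∈ Icc 0 T, f t = f 0 + ∫ s in (0 : ℝ)..t, g s

lemma IsPrimitive.intervalIntegrable (h : IsPrimitive T f g) {t : ℝ} (ht : t ∈ Icc 0 T) :
    IntervalIntegrable g volume 0 t := by
  rw [intervalIntegrable_iff_integrableOn_Ioo_of_le ht.1]
  exact h.integrableOn.mono_set (Ioo_subset_Ioo_right ht.2)

lemma IsPrimitive.add (h₁ : IsPrimitive T f₁ g₁) (h₂ : IsPrimitive T f₂ g₂) :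
    IsPrimitive T (fun t => f₁ t + f₂ t) (fun t => g₁ t + g₂ t) where
  integrableOn := h₁.integrableOn.add h₂.integrableOn
  eq t ht := by
    rw [intervalIntegral.integral_add (h₁.intervalIntegrable ht) (h₂.intervalIntegrable ht),
      h₁.eq t ht, h₂.eq t ht]
    ring

lemma IsPrimitive.const_mul (h : IsPrimitive T f g) (c : ℝ) :
    IsPrimitive T (fun t => c * f t) (fun t => c * g t) where
  integrableOn := h.integrableOn.const_mul c
  eq t ht := by
    rw [intervalIntegral.integral_const_mul, h.eq t ht]
    ring

lemma IsPrimitive.congr (h : IsPrimitive T f₁ g₁) (hT : 0 ≤ T) (hf : EqOn f₂ f₁ (Icc 0 T))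
    (hg : EqOn g₂ g₁ (Ioo 0 T)) : IsPrimitive T f₂ g₂ where
  integrableOn := h.integrableOn.congr_fun (fun t ht => (hg ht).symm) measurableSet_Ioo
  eq t ht := by
    rw [hf ht, hf ⟨le_rfl, hT⟩, h.eq t ht, intervalIntegral.integral_of_le ht.1,
      intervalIntegral.integral_of_le ht.1, integral_Ioc_eq_integral_Ioo,
      integral_Ioc_eq_integral_Ioo]
    congr 1
    exact setIntegral_congr_fun measurableSet_Ioo
      fun s hs => (hg ⟨hs.1, hs.2.trans_le ht.2⟩).symm

lemma isPrimitive_of_hasDerivWithinAt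
    (h : ∀ t ∈ Icc 0 T, HasDerivWithinAt f (g t) (Icc 0 T) t) (hg : ContinuousOn g (Icc 0 T)) :
    IsPrimitive T f g where
  integrableOn := (hg.integrableOn_compact isCompact_Icc).mono_set Ioo_subset_Icc_self
  eq t ht := by
    rw [integral_eq_sub_of_hasDerivWithinAt h hg ht]
    ring

lemma HasWeakDeriv.congr {a b : ℝ} (h : HasWeakDeriv a b f₁ g₁) (hf : EqOn f₂ f₁ (Ioo a b))
    (hg : EqOn g₂ g₁ (Ioo a b)) : HasWeakDeriv a b f₂ g₂ := by
  intro φ h1 h2 h3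
  rw [setIntegral_congr_fun (f := fun x => f₂ x * deriv φ x) (g := fun x => f₁ x * deriv φ x)
      measurableSet_Ioo fun x hx => by simp only [hf hx],
    setIntegral_congr_fun (f := fun x => g₂ x * φ x) (g := fun x => g₁ x * φ x)
      measurableSet_Ioo fun x hx => by simp only [hg hx]]
  exact h φ h1 h2 h3

lemma IsPrimitive.continuousOn (h : IsPrimitive T f g) (hT : 0 ≤ T) :
    ContinuousOn f (Icc 0 T) := by
  have := ((h.intervalIntegrable ⟨hT, le_rfl⟩).absolutelyContinuousOnInterval_intervalIntegral
    (c := 0) (by simp : (0 : ℝ) ∈ uIcc 0 T)).continuousOn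
  rw [uIcc_of_le hT] at this
  exact (continuousOn_const.add this).congr fun t ht => h.eq t ht

lemma IsPrimitive.hasWeakDeriv (h : IsPrimitive T f g) (hT : 0 ≤ T) : HasWeakDeriv 0 T f g := by
  intro φ h1 h2 h3
  have hg := h.intervalIntegrable ⟨hT, le_rfl⟩
  have hd : Continuous (deriv φ) := h1.continuous_deriv (by simp)
  have hφ0 : ∀ y, y ∉ Ioo 0 T → φ y = 0 := fun y hy =>
    image_eq_zero_of_notMem_tsupport fun hh => hy (h3 hh)
  have hac := hg.absolutelyContinuousOnInterval_intervalIntegral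
    (c := 0) (by simp : (0 : ℝ) ∈ uIcc 0 T)
  have hprim : ∀ x, ∫ t in (0 : ℝ)..x, deriv φ t = φ x := fun x => by
    rw [intervalIntegral.integral_deriv_eq_sub
      (fun y _ => (h1.differentiable (by simp)).differentiableAt)
      (hd.intervalIntegrable _ _), hφ0 0 (by simp), sub_zero]
  have hφ : AbsolutelyContinuousOnInterval φ 0 T := by
    have := (hd.intervalIntegrable (μ := volume) 0 T).absolutelyContinuousOnInterval_intervalIntegral
      (c := 0) (by simp : (0 : ℝ) ∈ uIcc 0 T)
    rwa [funext hprim] at this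
  have ibp := hac.integral_mul_deriv_eq_deriv_mul hφ
  rw [hφ0 T (by simp)] at ibp
  simp only [intervalIntegral.integral_same, zero_mul, mul_zero, sub_zero, zero_sub] at ibp
  rw [intervalIntegral.integral_of_le hT, intervalIntegral.integral_of_le hT,
    integral_Ioc_eq_integral_Ioo, integral_Ioc_eq_integral_Ioo] at ibp
  have e1 : ∫ x in Ioo 0 T, f x * deriv φ x
      = ∫ x in Ioo 0 T, (∫ t in (0 : ℝ)..x, g t) * deriv φ x := by
    have i1 : IntegrableOn (fun x => f 0 * deriv φ x) (Ioo 0 T) :=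
      ((continuousOn_const.mul hd.continuousOn).integrableOn_compact isCompact_Icc).mono_set
        Ioo_subset_Icc_self
    have i2 : IntegrableOn (fun x => (∫ t in (0 : ℝ)..x, g t) * deriv φ x) (Ioo 0 T) := by
      have := hac.continuousOn
      rw [uIcc_of_le hT] at this
      exact ((this.mul hd.continuousOn).integrableOn_compact isCompact_Icc).mono_set
        Ioo_subset_Icc_self
    have e2 : ∫ x in Ioo 0 T, f 0 * deriv φ x = 0 := by
      rw [integral_const_mul, ← integral_Ioc_eq_integral_Ioo, ← intervalIntegral.integral_of_le hT,
        hprim, hφ0 T (by simp), mul_zero]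
    rw [setIntegral_congr_fun measurableSet_Ioo
      (g := fun x => f 0 * deriv φ x + (∫ t in (0 : ℝ)..x, g t) * deriv φ x) fun x hx => by
        simp only [h.eq x (Ioo_subset_Icc_self hx), add_mul], integral_add i1 i2, e2, zero_add]
  rw [e1, ibp]
  congr 1
  refine integral_congr_ae ?_
  rw [EventuallyEq, ae_restrict_iff' measurableSet_Ioo]
  filter_upwards [hg.ae_hasDerivAt_integral] with x hx hxI
  rw [(hx (by rw [uIcc_of_le hT]; exact Ioo_subset_Icc_self hxI) 0 (by simp)).deriv]

lemma setIntegral_comp_mul_left (hT : 0 < T) (F : ℝ → ℝ) :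
    ∫ x in Ioo (0 : ℝ) 1, F (T * x) = T⁻¹ * ∫ t in Ioo 0 T, F t := by
  rw [← integral_Ioc_eq_integral_Ioo, ← integral_Ioc_eq_integral_Ioo,
    ← intervalIntegral.integral_of_le zero_le_one, ← intervalIntegral.integral_of_le hT.le,
    intervalIntegral.integral_comp_mul_left F hT.ne']
  simp

/-- A continuous function with vanishing weak derivative is constant. -/
lemma eq_of_hasWeakDeriv_zero (hT : 0 < T) (hf : ContinuousOn f (Icc 0 T))
    (h : HasWeakDeriv 0 T f 0) {t : ℝ} (ht : t ∈ Icc 0 T) : f t = f 0 := by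
  have hmaps : ∀ x ∈ Icc (0 : ℝ) 1, T * x ∈ Icc 0 T := fun x hx =>
    ⟨mul_nonneg hT.le hx.1, by nlinarith [hx.2]⟩
  have hc : ContinuousOn (fun x => f (T * x)) (Icc 0 1) := hf.comp (by fun_prop) hmaps
  obtain ⟨c, hc'⟩ := ae_const_of_hasWeakDeriv_zero (d := fun x => f (T * x))
    ((hc.integrableOn_compact isCompact_Icc).mono_set Ioo_subset_Icc_self) (by
    intro φ h1 h2 h3
    -- Rescaling time transfers the question to the unit interval, where it is already settled.
    set χ : ℝ → ℝ := fun t => φ (T⁻¹ * t) with hχ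
    have hχ1 : ContDiff ℝ ∞ χ := h1.comp (by fun_prop)
    have hsupp : tsupport χ ⊆ (fun t => T⁻¹ * t) ⁻¹' tsupport φ := by
      refine closure_minimal (fun t ht => subset_tsupport φ ht) ?_
      exact (isClosed_tsupport φ).preimage (by fun_prop)
    have hχs : tsupport χ ⊆ Ioo 0 T := by
      intro t ht
      have := h3 (hsupp ht)
      rw [mem_Ioo, inv_mul_lt_iff₀ hT, mul_one] at this
      exact ⟨by simpa [hT] using this.1, this.2⟩
    have hχ2 : HasCompactSupport χ :=
      isCompact_Icc.of_isClosed_subset (isClosed_tsupport _) (hχs.trans Ioo_subset_Icc_self)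
    have hd : ∀ t, deriv χ t = T⁻¹ * deriv φ (T⁻¹ * t) := fun t => by
      rw [hχ, deriv_comp_mul_left]; simp
    have e := h χ hχ1 hχ2 hχs
    simp only [Pi.zero_apply, zero_mul, integral_zero, neg_zero] at e ⊢
    have e1 := setIntegral_comp_mul_left hT (fun t => f t * deriv χ t)
    rw [e, mul_zero] at e1
    simp only [hd, inv_mul_cancel_left₀ hT.ne'] at e1
    have e2 : ∫ x in Ioo (0 : ℝ) 1, f (T * x) * (T⁻¹ * deriv φ x)
        = T⁻¹ * ∫ x in Ioo (0 : ℝ) 1, f (T * x) * deriv φ x := by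
      rw [← integral_const_mul]
      congr 1
      funext x
      ring
    rw [e2] at e1
    exact (mul_eq_zero.mp e1).resolve_left (inv_ne_zero hT.ne'))
  have he := eqOn_Icc_of_ae_eq_Ioo one_pos hc' hc continuousOn_const
  have h0 := he (x := 0) (by simp)
  have h1 := he (x := T⁻¹ * t) ⟨mul_nonneg (inv_nonneg.mpr hT.le) ht.1, by
    rw [inv_mul_le_iff₀ hT, mul_one]; exact ht.2⟩
  simp only [mul_zero, mul_inv_cancel_left₀ hT.ne'] at h0 h1
  rw [h0, h1]

/-- Continuity of `f` upgrades the almost everywhere identity to one at every time, which turns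
distributional equations into integrated ones. -/
lemma HasWeakDeriv.isPrimitive (h : HasWeakDeriv 0 T f g) (hT : 0 < T)
    (hf : ContinuousOn f (Icc 0 T)) (hg : IntegrableOn g (Ioo 0 T)) : IsPrimitive T f g where
  integrableOn := hg
  eq t ht := by
    set P : ℝ → ℝ := fun t => ∫ s in (0 : ℝ)..t, g s with hP
    have hPp : IsPrimitive T P g := ⟨hg, fun t _ => by simp [hP]⟩
    have hPc := hPp.continuousOn hT.le
    have hz : HasWeakDeriv 0 T (fun t => f t - P t) 0 := by
      intro φ h1 h2 h3
      have hd : Continuous (deriv φ) := h1.continuous_deriv (by simp)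
      have hi : ∀ {k : ℝ → ℝ}, ContinuousOn k (Icc 0 T) →
          IntegrableOn (fun x => k x * deriv φ x) (Ioo 0 T) := fun hk =>
        ((hk.mul hd.continuousOn).integrableOn_compact isCompact_Icc).mono_set Ioo_subset_Icc_self
      simp only [sub_mul, Pi.zero_apply, zero_mul, integral_zero, neg_zero]
      rw [integral_sub (hi hf) (hi hPc), h φ h1 h2 h3, hPp.hasWeakDeriv hT.le φ h1 h2 h3, sub_self]
    have := eq_of_hasWeakDeriv_zero hT (hf.sub hPc) hz ht
    simp only [hP, Pi.sub_apply, intervalIntegral.integral_same, sub_zero] at this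
    linarith

end WeakDerivative

/-! ### The power nonlinearity and its truncation. -/

section Power

/-- The function `s ↦ |s|^{r-2} s`. -/
def pw (r s : ℝ) : ℝ := |s| ^ (r - 2) * s

variable {r : ℝ}

lemma pw_zero : pw r 0 = 0 := by simp [pw]

/-- Only the origin is delicate: the difference quotient there is |y|^{r-2}, which tends to zero
because r > 2. -/
lemma hasDerivAt_pw (hr : 2 < r) (s : ℝ) :
    HasDerivAt (pw r) ((r - 1) * |s| ^ (r - 2)) s := by
  rcases eq_or_ne s 0 with rfl | hs
  · rw [abs_zero, Real.zero_rpow (by linarith), mul_zero, hasDerivAt_iff_tendsto_slope]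
    have h1 : Tendsto (fun y : ℝ => |y| ^ (r - 2)) (𝓝[≠] 0) (𝓝 0) := by
      have : Continuous fun y : ℝ => |y| ^ (r - 2) :=
        continuous_abs.rpow_const fun _ => Or.inr (by linarith)
      have h := this.tendsto 0
      rw [abs_zero, Real.zero_rpow (by linarith)] at h
      exact h.mono_left nhdsWithin_le_nhds
    refine h1.congr' ?_
    filter_upwards [self_mem_nhdsWithin] with y hy
    rw [slope_def_field, pw_zero, pw, sub_zero, sub_zero, mul_div_assoc, div_self hy, mul_one]
  · have h1 := ((hasDerivAt_abs hs).rpow_const (p := r - 2) (Or.inl (abs_ne_zero.mpr hs))).mul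
      (hasDerivAt_id s)
    refine h1.congr_deriv ?_
    have e : (SignType.sign s : ℝ) * s = |s| := sign_mul_self s
    have e2 : |s| ^ (r - 2) = |s| ^ (r - 2 - 1) * |s| := by
      rw [Real.rpow_sub_one (abs_ne_zero.mpr hs), div_mul_cancel₀ _ (abs_ne_zero.mpr hs)]
    simp only [id, mul_one]
    rw [e2]
    linear_combination (r - 2) * |s| ^ (r - 2 - 1) * e

lemma continuous_pw (hr : 2 < r) : Continuous (pw r) :=
  continuous_iff_continuousAt.mpr fun s => (hasDerivAt_pw hr s).continuousAt

lemma hasDerivAt_abs_rpow_div (hr : 2 < r) (s : ℝ) :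
    HasDerivAt (fun s : ℝ => 1 / r * |s| ^ r) (pw r s) s := by
  refine ((hasDerivAt_abs_rpow s (by linarith : 1 < r)).const_mul (1 / r)).congr_deriv ?_
  have : r ≠ 0 := by linarith
  rw [pw]; field_simp

/-- The truncation of `pw r` at level `R`. -/
def trunc (r R s : ℝ) : ℝ := pw r (max (-R) (min R s))

lemma trunc_eq {R s : ℝ} (h : |s| ≤ R) : trunc r R s = |s| ^ (r - 2) * s := by
  rw [abs_le] at h
  rw [trunc, min_eq_right h.2, max_eq_right h.1, pw]

lemma trunc_zero {R : ℝ} (hR : 0 ≤ R) : trunc r R 0 = 0 := by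
  rw [trunc_eq (by simpa using hR)]; simp

lemma exists_lipschitzWith_trunc (hr : 2 < r) {R : ℝ} (hR : 0 ≤ R) :
    ∃ k : NNReal, LipschitzWith k (trunc r R) := by
  have h1 : LipschitzOnWith (Real.toNNReal ((r - 1) * R ^ (r - 2))) (pw r) (Icc (-R) R) := by
    refine (convex_Icc _ _).lipschitzOnWith_of_nnnorm_hasDerivWithin_le
      (fun s _ => (hasDerivAt_pw hr s).hasDerivWithinAt) fun s hs => ?_
    rw [← NNReal.coe_le_coe, coe_nnnorm]
    have h2 : |s| ^ (r - 2) ≤ R ^ (r - 2) :=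
      Real.rpow_le_rpow (abs_nonneg _) (abs_le.mpr hs) (by linarith)
    have h3 : 0 ≤ |s| ^ (r - 2) := Real.rpow_nonneg (abs_nonneg _) _
    rw [Real.norm_of_nonneg (mul_nonneg (by linarith) h3)]
    exact (mul_le_mul_of_nonneg_left h2 (by linarith)).trans (Real.le_coe_toNNReal _)
  have h2 : LipschitzWith 1 (fun s => max (-R) (min R s)) :=
    (LipschitzWith.id.const_min R).const_max (-R)
  have h3 := h1.comp (h2.lipschitzOnWith (s := univ)) (fun s _ => by
    refine ⟨le_max_left _ _, max_le (by linarith) (min_le_left _ _)⟩)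
  exact ⟨_, lipschitzOnWith_univ.mp h3⟩

end Power

end TwoPointWave

end

/-! ### Translation between the boundary value problem and the abstract equation. -/

noncomputable section

namespace TwoPointWave

open H1 WaveData

/-- The structural hypotheses on the coefficients. -/
structure Coeffs.Admissible (c : Coeffs) (lamT hT : ℝ) : Prop where
  p_gt : 2 < c.p
  α_gt : 2 < c.α
  β_gt : 2 < c.β
  lam_nonneg : 0 ≤ c.lam
  lam0_pos : 0 < c.lam0
  lam1_pos : 0 < c.lam1
  lamT0_eq : c.lamT0 = lamT
  lamT1_eq : c.lamT1 = lamT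
  det_pos : lamT ^ 2 < c.lam0 * c.lam1
  hT0_eq : ∀ t, 0 ≤ t → c.hT0 t = hT
  hT1_eq : ∀ t, 0 ≤ t → c.hT1 t = hT

lemma inner_bdry (k l : Bdry) : inner ℝ k l = k.fst * l.fst + k.snd * l.snd := by
  rw [WithLp.prod_inner_apply]
  simp [mul_comm]

/-- The boundary damping `(x, y) ↦ (l₀ x + l y, l x + l₁ y)`. -/
def dampL (l₀ l₁ l : ℝ) : Bdry →L[ℝ] Bdry :=
  ((WithLp.prodContinuousLinearEquiv 2 ℝ ℝ ℝ).symm : ℝ × ℝ →L[ℝ] Bdry).comp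
    ((l₀ • WithLp.fstL 2 ℝ ℝ ℝ + l • WithLp.sndL 2 ℝ ℝ ℝ).prod
      (l • WithLp.fstL 2 ℝ ℝ ℝ + l₁ • WithLp.sndL 2 ℝ ℝ ℝ))

lemma dampL_apply (l₀ l₁ l : ℝ) (k : Bdry) :
    dampL l₀ l₁ l k = WithLp.toLp 2 (l₀ * k.fst + l * k.snd, l * k.fst + l₁ * k.snd) := rfl

lemma inner_dampL (l₀ l₁ l : ℝ) (k m : Bdry) : inner ℝ (dampL l₀ l₁ l k) m
    = (l₀ * k.fst + l * k.snd) * m.fst + (l * k.fst + l₁ * k.snd) * m.snd := by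
  rw [inner_bdry, dampL_apply]
  rfl

lemma dampL_symm (l₀ l₁ l : ℝ) (k m : Bdry) :
    inner ℝ (dampL l₀ l₁ l k) m = inner ℝ (dampL l₀ l₁ l m) k := by
  rw [inner_dampL, inner_dampL]; ring

lemma dampL_surjective {l₀ l₁ l : ℝ} (h : l ^ 2 < l₀ * l₁) :
    Function.Surjective (dampL l₀ l₁ l) := by
  intro k
  have hd : l₀ * l₁ - l ^ 2 ≠ 0 := by linarith
  refine ⟨WithLp.toLp 2 ((l₁ * k.fst - l * k.snd) / (l₀ * l₁ - l ^ 2),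
    (l₀ * k.snd - l * k.fst) / (l₀ * l₁ - l ^ 2)), ?_⟩
  rw [dampL_apply]
  have e1 : l₀ * ((l₁ * k.fst - l * k.snd) / (l₀ * l₁ - l ^ 2))
      + l * ((l₀ * k.snd - l * k.fst) / (l₀ * l₁ - l ^ 2)) = k.fst := by
    rw [mul_div_assoc', mul_div_assoc', ← add_div, div_eq_iff hd]; ring
  have e2 : l * ((l₁ * k.fst - l * k.snd) / (l₀ * l₁ - l ^ 2))
      + l₁ * ((l₀ * k.snd - l * k.fst) / (l₀ * l₁ - l ^ 2)) = k.snd := by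
    rw [mul_div_assoc', mul_div_assoc', ← add_div, div_eq_iff hd]; ring
  simp only [WithLp.toLp_fst, WithLp.toLp_snd]
  rw [e1, e2]
  rfl

/-- Determinant over trace is a lower bound for the smaller eigenvalue of a positive definite 2×2
matrix. -/
lemma dampL_coercive {l₀ l₁ l : ℝ} (h₀ : 0 < l₀) (h₁ : 0 < l₁) (h : l ^ 2 < l₀ * l₁) (k : Bdry) :
    (l₀ * l₁ - l ^ 2) / (l₀ + l₁) * ‖k‖ ^ 2 ≤ inner ℝ (dampL l₀ l₁ l k) k := by
  rw [inner_dampL, ← real_inner_self_eq_norm_sq, inner_bdry]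
  generalize k.fst = x
  generalize k.snd = y
  have hs : 0 < l₀ + l₁ := by linarith
  set b := (l₀ * l₁ - l ^ 2) / (l₀ + l₁) with hb
  have e : b * (l₀ + l₁) = l₀ * l₁ - l ^ 2 := div_mul_cancel₀ _ hs.ne'
  have hb0 : 0 < b := div_pos (by linarith) hs
  have hlt : b < l₀ := by
    rw [hb, div_lt_iff₀ hs]; nlinarith [sq_nonneg l]
  -- Completing the square; the coefficient (l₀ - b)(l₁ - b) - l² left on y² equals b² by the choice
  -- of `b`.
  have key : (l₀ - b) * ((l₀ * x + l * y) * x + (l * x + l₁ * y) * y - b * (x * x + y * y))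
      = ((l₀ - b) * x + l * y) ^ 2 + b ^ 2 * y ^ 2 := by
    linear_combination (-y ^ 2) * e
  have : 0 ≤ (l₀ - b) * ((l₀ * x + l * y) * x + (l * x + l₁ * y) * y - b * (x * x + y * y)) := by
    rw [key]; positivity
  have := nonneg_of_mul_nonneg_right this (by linarith)
  linarith

variable {c : Coeffs} {lamT hT : ℝ}

/-- The abstract damped wave equation underlying the problem. -/
def Coeffs.Admissible.data (h : c.Admissible lamT hT) : WaveData H1 L2 Bdry where
  ι := toL2L
  γ := traceL
  B := dampL c.lam0 c.lam1 lamT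
  lam := c.lam
  b := (c.lam0 * c.lam1 - lamT ^ 2) / (c.lam0 + c.lam1)
  lam_nonneg := h.lam_nonneg
  b_pos := div_pos (by linarith [h.det_pos]) (by linarith [h.lam0_pos, h.lam1_pos])
  coercive := dampL_coercive h.lam0_pos h.lam1_pos h.det_pos

/-- Composition with a globally Lipschitz function vanishing at 0 is a Lipschitz map of L²; this is
why the power is truncated. -/
lemma exists_source {r R : ℝ} (hr : 2 < r) (hR : 0 ≤ R) :
    ∃ F : L2 → L2, F 0 = 0 ∧ (∃ k, LipschitzWith k F) ∧
      ∀ f : L2, F f =ᵐ[volume.restrict (Ioo (0 : ℝ) 1)] fun x => trunc r R (f x) := by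
  obtain ⟨k, hk⟩ := exists_lipschitzWith_trunc hr hR
  exact ⟨hk.compLp (trunc_zero hR), hk.compLp_zero _, ⟨k, hk.lipschitzWith_compLp _⟩,
    fun f => hk.coeFn_compLp _ f⟩

/-- The truncated interior source term. -/
def source {r R : ℝ} (hr : 2 < r) (hR : 0 ≤ R) : L2 → L2 := Classical.choose (exists_source hr hR)

section source

variable {r R : ℝ} (hr : 2 < r) (hR : 0 ≤ R)

lemma source_zero : source hr hR 0 = 0 := (Classical.choose_spec (exists_source hr hR)).1

lemma source_lipschitz : ∃ k, LipschitzWith k (source hr hR) :=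
  (Classical.choose_spec (exists_source hr hR)).2.1

lemma source_coeFn (f : L2) :
    source hr hR f =ᵐ[volume.restrict (Ioo (0 : ℝ) 1)] fun x => trunc r R (f x) :=
  (Classical.choose_spec (exists_source hr hR)).2.2 f

lemma inner_source {v : H1} (hv : ∀ x ∈ Icc (0 : ℝ) 1, |v.rep x| ≤ R) (w : H1) :
    inner ℝ (source hr hR v.toL2) w.toL2
      = ∫ x in Ioo (0 : ℝ) 1, |v.rep x| ^ (r - 2) * v.rep x * w.rep x := by
  rw [L2.inner_eq]
  refine integral_congr_ae ?_
  filter_upwards [source_coeFn hr hR v.toL2, v.rep_ae_eq, w.rep_ae_eq,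
    ae_restrict_mem measurableSet_Ioo] with x h1 h2 h3 h4
  rw [h1, ← h2, ← h3, trunc_eq (hv x (Ioo_subset_Icc_self h4))]

end source

/-- The truncated boundary source term. -/
def bdrySource (c : Coeffs) (hT R : ℝ) (k : Bdry) : Bdry :=
  WithLp.toLp 2 (trunc c.α R k.fst - hT * k.snd, trunc c.β R k.snd - hT * k.fst)

lemma bdrySource_zero {R : ℝ} (hR : 0 ≤ R) : bdrySource c hT R 0 = 0 := by
  simp [bdrySource, trunc_zero hR]

lemma bdrySource_lipschitz (h : c.Admissible lamT hT) {R : ℝ} (hR : 0 ≤ R) :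
    ∃ k, LipschitzWith k (bdrySource c hT R) := by
  obtain ⟨k, hk⟩ := exists_lipschitzWith_trunc h.α_gt hR
  obtain ⟨l, hl⟩ := exists_lipschitzWith_trunc h.β_gt hR
  have h1 := (hk.comp (WithLp.fstL 2 ℝ ℝ ℝ).lipschitz).sub (hT • WithLp.sndL 2 ℝ ℝ ℝ).lipschitz
  have h2 := (hl.comp (WithLp.sndL 2 ℝ ℝ ℝ).lipschitz).sub (hT • WithLp.fstL 2 ℝ ℝ ℝ).lipschitz
  exact ⟨_, ((WithLp.prodContinuousLinearEquiv 2 ℝ ℝ ℝ).symm : ℝ × ℝ →L[ℝ] Bdry).lipschitz.comp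
    (h1.prodMk h2)⟩

/-- The weak form of the equation in terms of the abstract data. -/
lemma Coeffs.Admissible.weakRHS_eq (h : c.Admissible lamT hT) {R : ℝ} (hR : 0 ≤ R) {t : ℝ}
    (ht : 0 ≤ t) {v : H1} (hv : ∀ x ∈ Icc (0 : ℝ) 1, |v.rep x| ≤ R) (v' : L2) (d₀ d₁ : ℝ) (w : H1) :
    weakRHS c t v v' d₀ d₁ w
      = inner ℝ (h.data.frc v (source h.p_gt hR v.toL2) (bdrySource c hT R (traceL v))) w
        - c.lam * inner ℝ v' w.toL2 - (c.lam0 * w.rep 0 + lamT * w.rep 1) * d₀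
        - (lamT * w.rep 0 + c.lam1 * w.rep 1) * d₁ := by
  rw [inner_frc]
  change _ = -inner ℝ v w + inner ℝ (source h.p_gt hR v.toL2) w.toL2
    + inner ℝ (bdrySource c hT R (traceL v)) (traceL w) - _ - _ - _
  rw [inner_source h.p_gt hR hv, inner_bdry, bdrySource, traceL_apply, traceL_apply, H1.inner_eq]
  simp only [WithLp.toLp_fst, WithLp.toLp_snd]
  rw [trunc_eq (hv 0 (by simp)), trunc_eq (hv 1 (by simp)), weakRHS, h.hT0_eq t ht, h.hT1_eq t ht,
    h.lamT0_eq, h.lamT1_eq]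
  ring

/-- The traces of `u` have square integrable derivatives on `(0, T)`. -/
def HasTraces (u : ℝ → H1) (T : ℝ) : Prop :=
  ∃ d₀ d₁ : ℝ → ℝ, MemLp d₀ 2 (volume.restrict (Ioo 0 T)) ∧
    MemLp d₁ 2 (volume.restrict (Ioo 0 T)) ∧ IsPrimitive T (fun t => (u t).rep 0) d₀ ∧
    IsPrimitive T (fun t => (u t).rep 1) d₁

variable {T R : ℝ} {u₀ : H1} {u₁ : L2} {u : ℝ → H1} {u' : ℝ → L2}

/-- Solutions of the problem truncated at level `R`. -/
def Coeffs.Admissible.IsTruncSol (h : c.Admissible lamT hT) (hR : 0 ≤ R) (T : ℝ) (u : ℝ → H1)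
    (u' : ℝ → L2) : Prop :=
  h.data.IsSol 0 T u u' (fun t => source h.p_gt hR (u t).toL2)
    (fun t => bdrySource c hT R (traceL (u t)))

lemma Coeffs.Admissible.inner_mom_eq (h : c.Admissible lamT hT) (v : H1) (v' : L2) (w : H1) :
    inner ℝ (h.data.mom v v') w = inner ℝ v' w.toL2 + c.lam * inner ℝ v.toL2 w.toL2
      + (c.lam0 * w.rep 0 + lamT * w.rep 1) * v.rep 0
      + (lamT * w.rep 0 + c.lam1 * w.rep 1) * v.rep 1 := by
  rw [inner_mom]
  change inner ℝ v' w.toL2 + c.lam * inner ℝ v.toL2 w.toL2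
    + inner ℝ (dampL c.lam0 c.lam1 lamT (traceL v)) (traceL w) = _
  rw [inner_dampL, traceL_apply, traceL_apply]
  simp only [WithLp.toLp_fst, WithLp.toLp_snd]
  ring

lemma isPrimitive_inner_toL2 (hd : ∀ t ∈ Icc 0 T,
      HasDerivWithinAt (fun s => (u s).toL2) (u' t) (Icc 0 T) t)
    (hc : ContinuousOn u' (Icc 0 T)) (w : H1) :
    IsPrimitive T (fun t => inner ℝ (u t).toL2 w.toL2) (fun t => inner ℝ (u' t) w.toL2) := by
  refine isPrimitive_of_hasDerivWithinAt (fun t ht => ?_) (hc.inner continuousOn_const)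
  have := (hd t ht).inner ℝ (hasDerivWithinAt_const t (Icc 0 T) w.toL2)
  simpa using this

/-- Below the level `R` the truncation is inactive, and the distributional equation, integrated in
time against each test function, becomes the C¹ equation for the momentum in H¹. -/
lemma Coeffs.Admissible.isTruncSol_of_isWeakSolutionOn (h : c.Admissible lamT hT) (hR : 0 ≤ R)
    (hT0 : 0 < T) (hu : IsWeakSolutionOn c u₀ u₁ u u' T)
    (hb : ∀ t ∈ Icc 0 T, ∀ x ∈ Icc (0 : ℝ) 1, |(u t).rep x| ≤ R) :
    h.IsTruncSol hR T u u' ∧ HasTraces u T := by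
  obtain ⟨d₀, d₁, m₀, m₁, w₀, w₁, hw⟩ := hu.weak_eq
  have ceval : ∀ y : Icc (0 : ℝ) 1, ContinuousOn (fun t => (u t).rep y) (Icc 0 T) := fun y =>
    (evalL y).continuous.comp_continuousOn hu.continuousOn
  have c₀ := ceval ⟨0, by simp⟩
  have c₁ := ceval ⟨1, by simp⟩
  have p₀ : IsPrimitive T (fun t => (u t).rep 0) d₀ :=
    w₀.isPrimitive hT0 c₀ (m₀.integrable one_le_two)
  have p₁ : IsPrimitive T (fun t => (u t).rep 1) d₁ :=
    w₁.isPrimitive hT0 c₁ (m₁.integrable one_le_two)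
  obtain ⟨k, hk⟩ := source_lipschitz h.p_gt hR
  obtain ⟨l, hl⟩ := bdrySource_lipschitz h hR
  have cF : ContinuousOn (fun t => source h.p_gt hR (u t).toL2) (Icc 0 T) :=
    (hk.continuous.comp toL2L.continuous).comp_continuousOn hu.continuousOn
  have cG : ContinuousOn (fun t => bdrySource c hT R (traceL (u t))) (Icc 0 T) :=
    (hl.continuous.comp traceL.continuous).comp_continuousOn hu.continuousOn
  set Φ : ℝ → H1 := fun t => h.data.frc (u t) (source h.p_gt hR (u t).toL2)
    (bdrySource c hT R (traceL (u t))) with hΦ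
  have cΦ : ContinuousOn Φ (Icc 0 T) := by
    simp only [hΦ, frc]
    exact (hu.continuousOn.neg.add (h.data.ι.adjoint.continuous.comp_continuousOn cF)).add
      (h.data.γ.adjoint.continuous.comp_continuousOn cG)
  obtain ⟨Z, hZ0, hZ⟩ := exists_primitive cΦ
  have key : ∀ w : H1, IsPrimitive T (fun t => inner ℝ (h.data.mom (u t) (u' t)) w)
      (fun t => inner ℝ (Φ t) w) := by
    intro w
    have q := isPrimitive_inner_toL2 hu.hasDeriv hu.continuousOn_deriv w
    have iΦ : IntegrableOn (fun t => inner ℝ (Φ t) w) (Ioo 0 T) :=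
      ((cΦ.inner continuousOn_const).integrableOn_compact isCompact_Icc).mono_set
        Ioo_subset_Icc_self
    have hwd : HasWeakDeriv 0 T (fun t => inner ℝ (u' t) w.toL2) (fun t => inner ℝ (Φ t) w
        - c.lam * inner ℝ (u' t) w.toL2 - (c.lam0 * w.rep 0 + lamT * w.rep 1) * d₀ t
        - (lamT * w.rep 0 + c.lam1 * w.rep 1) * d₁ t) :=
      (hw w).congr (fun _ _ => rfl) fun t ht =>
        (h.weakRHS_eq hR ht.1.le (hb t (Ioo_subset_Icc_self ht)) (u' t) (d₀ t) (d₁ t) w).symm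
    have q' := hwd.isPrimitive hT0 (hu.continuousOn_deriv.inner continuousOn_const)
      (((iΦ.sub (q.integrableOn.const_mul _)).sub (p₀.integrableOn.const_mul _)).sub
        (p₁.integrableOn.const_mul _))
    -- Adding λ⟨u, w⟩ and the weighted traces to ⟨u', w⟩ cancels the damping and the velocities
    -- `d₀`, `d₁`, leaving a continuous right-hand side.
    refine (((q'.add (q.const_mul c.lam)).add (p₀.const_mul (c.lam0 * w.rep 0 + lamT * w.rep 1))).add
      (p₁.const_mul (lamT * w.rep 0 + c.lam1 * w.rep 1))).congr hT0.le (fun t _ => ?_)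
      (fun t _ => ?_)
    · exact h.inner_mom_eq _ _ w
    · ring
  have hmom : ∀ t ∈ Icc 0 T, h.data.mom (u t) (u' t) = Z t + h.data.mom (u 0) (u' 0) := by
    intro t ht
    refine ext_inner_right ℝ fun w => ?_
    have e1 := (key w).eq t ht
    have e2 := integral_eq_sub_of_hasDerivWithinAt (X := fun t => inner ℝ (Z t) w)
      (x := fun t => inner ℝ (Φ t) w) (fun t ht => by
        simpa using (hZ t ht).inner ℝ (hasDerivWithinAt_const t (Icc 0 T) w))
      (cΦ.inner continuousOn_const) ht
    rw [hZ0, inner_zero_left, sub_zero] at e2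
    rw [e1, e2, inner_add_left, add_comm]
  exact ⟨⟨hu.continuousOn, hu.continuousOn_deriv, cF, cG, hu.hasDeriv,
    fun t ht => ((hZ t ht).add_const _).congr hmom (hmom t ht)⟩, d₀, d₁, m₀, m₁, p₀, p₁⟩

/-- Square integrability of the trace velocities is not part of the momentum equation and must be
supplied; the damping terms are then split off the momentum again. -/
lemma Coeffs.Admissible.isWeakSolutionOn_of_isTruncSol (h : c.Admissible lamT hT) (hR : 0 ≤ R)
    (hT0 : 0 < T) (hu : h.IsTruncSol hR T u u') (htr : HasTraces u T)
    (hb : ∀ t ∈ Icc 0 T, ∀ x ∈ Icc (0 : ℝ) 1, |(u t).rep x| ≤ R) :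
    IsWeakSolutionOn c (u 0) (u' 0) u u' T := by
  obtain ⟨d₀, d₁, m₀, m₁, p₀, p₁⟩ := htr
  refine ⟨hu.cont_u, hu.deriv_u, hu.cont_v, rfl, rfl, d₀, d₁, m₀, m₁, p₀.hasWeakDeriv hT0.le,
    p₁.hasWeakDeriv hT0.le, fun w => ?_⟩
  have q := isPrimitive_inner_toL2 hu.deriv_u hu.cont_v w
  have cΦ : ContinuousOn (fun t => h.data.frc (u t) (source h.p_gt hR (u t).toL2)
      (bdrySource c hT R (traceL (u t)))) (Icc 0 T) := by
    simp only [frc]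
    exact (hu.cont_u.neg.add (h.data.ι.adjoint.continuous.comp_continuousOn hu.cont_f)).add
      (h.data.γ.adjoint.continuous.comp_continuousOn hu.cont_g)
  have q' : IsPrimitive T (fun t => inner ℝ (h.data.mom (u t) (u' t)) w) _ :=
    isPrimitive_of_hasDerivWithinAt (fun t ht => by
      simpa using (hu.deriv_mom t ht).inner ℝ (hasDerivWithinAt_const t (Icc 0 T) w))
      (cΦ.inner continuousOn_const)
  refine ((((q'.add (q.const_mul (-c.lam))).add
    (p₀.const_mul (-(c.lam0 * w.rep 0 + lamT * w.rep 1)))).add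
    (p₁.const_mul (-(lamT * w.rep 0 + c.lam1 * w.rep 1)))).congr hT0.le (fun t _ => ?_)
    (fun t ht => ?_)).hasWeakDeriv hT0.le
  · simp only [h.inner_mom_eq]
    ring
  · rw [h.weakRHS_eq hR ht.1.le (hb t (Ioo_subset_Icc_self ht))]
    ring

end TwoPointWave

end

/-! ### Concatenation, uniqueness, local existence and continuation. -/

noncomputable section

namespace TwoPointWave

open H1 WaveData

section Glue

variable {a b : ℝ} {f d g e : ℝ → ℝ}

lemma glue_memLp (hd : MemLp d 2 (volume.restrict (Ioo 0 a)))
    (he : MemLp e 2 (volume.restrict (Ioo 0 b))) :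
    MemLp (glue a d e) 2 (volume.restrict (Ioo 0 (a + b))) := by
  classical
  have h1 : glue a d e = (Iic a).piecewise d (fun t => e (t - a)) := by
    funext t
    simp only [glue, piecewise, mem_Iic]
  rw [h1]
  refine MemLp.piecewise measurableSet_Iic ?_ ?_
  · rw [Measure.restrict_restrict measurableSet_Iic]
    rw [Measure.restrict_congr_set Ioo_ae_eq_Ioc] at hd
    have hsub : Iic a ∩ Ioo 0 (a + b) ⊆ Ioc 0 a := fun t ht => ⟨ht.2.1, ht.1⟩
    exact hd.mono_measure (Measure.restrict_mono hsub le_rfl)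
  · rw [Measure.restrict_restrict measurableSet_Iic.compl, compl_Iic]
    have hp := (measurePreserving_sub_right volume a).restrict_preimage (s := Ioo 0 b)
      measurableSet_Ioo
    have := he.comp_measurePreserving hp
    refine MemLp.mono_measure (Measure.restrict_mono ?_ le_rfl) this
    intro t ht
    exact ⟨by simpa using ht.1, by have := ht.2.2; simp; linarith⟩

lemma glue_isPrimitive (ha : 0 ≤ a) (hb : 0 ≤ b) (hf : IsPrimitive a f d) (hg : IsPrimitive b g e)
    (hfg : f a = g 0) (hi : IntegrableOn (glue a d e) (Ioo 0 (a + b))) :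
    IsPrimitive (a + b) (glue a f g) (glue a d e) where
  integrableOn := hi
  eq t ht := by
    have h1 : ∀ s ∈ Icc 0 a, ∫ x in (0 : ℝ)..s, glue a d e x = ∫ x in (0 : ℝ)..s, d x := by
      intro s hs
      refine intervalIntegral.integral_congr_ae (Eventually.of_forall fun x hx => ?_)
      rw [uIoc_of_le hs.1] at hx
      exact glue_of_le (hx.2.trans hs.2)
    rw [glue_of_le ha]
    rcases le_or_gt t a with h | h
    · rw [glue_of_le h, h1 t ⟨ht.1, h⟩, hf.eq t ⟨ht.1, h⟩]
    · have h2 : ∫ x in a..t, glue a d e x = ∫ x in (0 : ℝ)..(t - a), e x := by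
        have h3 : ∫ x in a..t, glue a d e x = ∫ x in a..t, e (x - a) := by
          refine intervalIntegral.integral_congr_ae (Eventually.of_forall fun x hx => ?_)
          rw [uIoc_of_le h.le] at hx
          exact if_neg (not_le.mpr hx.1)
        rw [h3, intervalIntegral.integral_comp_sub_right, sub_self]
      have hII : ∀ s ∈ Icc 0 (a + b), IntervalIntegrable (glue a d e) volume 0 s := fun s hs => by
        rw [intervalIntegrable_iff_integrableOn_Ioo_of_le hs.1]
        exact hi.mono_set (Ioo_subset_Ioo_right hs.2)
      have ha' : a ∈ Icc 0 (a + b) := ⟨ha, by linarith⟩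
      rw [glue_of_ge hfg h.le, hg.eq (t - a) ⟨by linarith, by linarith [ht.2]⟩, ← hfg,
        hf.eq a ⟨ha, le_rfl⟩, ← h2, ← h1 a ⟨ha, le_rfl⟩,
        ← intervalIntegral.integral_add_adjacent_intervals (hII a ha')
          ((hII a ha').symm.trans (hII t ht))]
      ring

end Glue

variable {c : Coeffs} {lamT hT : ℝ} {T R a b : ℝ} {u₀ : H1} {u₁ : L2} {u w : ℝ → H1}
  {u' w' : ℝ → L2}

lemma HasTraces.mono (h : HasTraces u T) {S : ℝ} (hS : S ≤ T) : HasTraces u S := by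
  obtain ⟨d₀, d₁, m₀, m₁, p₀, p₁⟩ := h
  have hsub : Ioo 0 S ⊆ Ioo 0 T := Ioo_subset_Ioo_right hS
  exact ⟨d₀, d₁, m₀.mono_measure (Measure.restrict_mono hsub le_rfl),
    m₁.mono_measure (Measure.restrict_mono hsub le_rfl),
    ⟨p₀.integrableOn.mono_set hsub, fun t ht => p₀.eq t ⟨ht.1, ht.2.trans hS⟩⟩,
    ⟨p₁.integrableOn.mono_set hsub, fun t ht => p₁.eq t ⟨ht.1, ht.2.trans hS⟩⟩⟩

lemma HasTraces.glue (hu : HasTraces u a) (hw : HasTraces w b) (ha : 0 ≤ a) (hb : 0 ≤ b)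
    (huw : u a = w 0) : HasTraces (glue a u w) (a + b) := by
  obtain ⟨d₀, d₁, m₀, m₁, p₀, p₁⟩ := hu
  obtain ⟨e₀, e₁, n₀, n₁, q₀, q₁⟩ := hw
  have k₀ := glue_memLp m₀ n₀
  have k₁ := glue_memLp m₁ n₁
  refine ⟨_, _, k₀, k₁, ?_, ?_⟩
  · simp only [glue_map (fun v : H1 => v.rep 0)]
    exact glue_isPrimitive ha hb p₀ q₀ (by rw [huw]) (k₀.integrable one_le_two)
  · simp only [glue_map (fun v : H1 => v.rep 1)]
    exact glue_isPrimitive ha hb p₁ q₁ (by rw [huw]) (k₁.integrable one_le_two)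

lemma exists_rep_bound (hu : ContinuousOn u (Icc 0 T)) :
    ∃ R, 0 ≤ R ∧ ∀ t ∈ Icc 0 T, ∀ x ∈ Icc (0 : ℝ) 1, |(u t).rep x| ≤ R := by
  obtain ⟨C, hC⟩ := isCompact_Icc.exists_bound_of_continuousOn hu
  exact ⟨2 * max C 0, by positivity, fun t ht x hx => ((u t).abs_rep_le hx).trans
    (mul_le_mul_of_nonneg_left ((hC t ht).trans (le_max_left _ _)) zero_le_two)⟩

namespace Coeffs.Admissible

lemma isWeakSolutionOn_mono (h : c.Admissible lamT hT) (hT0 : 0 < T) {S : ℝ} (hS0 : 0 < S)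
    (hS : S ≤ T)
    (hu : IsWeakSolutionOn c u₀ u₁ u u' T) : IsWeakSolutionOn c u₀ u₁ u u' S := by
  obtain ⟨R, hR, hb⟩ := exists_rep_bound hu.continuousOn
  obtain ⟨h1, h2⟩ := h.isTruncSol_of_isWeakSolutionOn hR hT0 hu hb
  have h3 : h.IsTruncSol hR S u u' := IsSol.mono h1 (Icc_subset_Icc_right hS)
  have := h.isWeakSolutionOn_of_isTruncSol hR hS0 h3 (h2.mono hS)
    (fun t ht => hb t ⟨ht.1, ht.2.trans hS⟩)
  rwa [hu.init, hu.init_deriv] at this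

/-- In momentum form, agreement of position and velocity at the junction suffices, since both the
momentum and its derivative are functions of these two. -/
lemma isWeakSolutionOn_glue (h : c.Admissible lamT hT) (ha : 0 < a) (hb : 0 < b)
    (hu : IsWeakSolutionOn c u₀ u₁ u u' a)
    (hw : IsWeakSolutionOn c (u a) (u' a) w w' b) :
    IsWeakSolutionOn c u₀ u₁ (glue a u w) (glue a u' w') (a + b) := by
  obtain ⟨R₁, hR₁, hb₁⟩ := exists_rep_bound hu.continuousOn
  obtain ⟨R₂, hR₂, hb₂⟩ := exists_rep_bound hw.continuousOn
  set R := max R₁ R₂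
  have hR : 0 ≤ R := hR₁.trans (le_max_left _ _)
  obtain ⟨s1, t1⟩ := h.isTruncSol_of_isWeakSolutionOn hR ha hu
    (fun t ht x hx => (hb₁ t ht x hx).trans (le_max_left _ _))
  obtain ⟨s2, t2⟩ := h.isTruncSol_of_isWeakSolutionOn hR hb hw
    (fun t ht x hx => (hb₂ t ht x hx).trans (le_max_right _ _))
  have e0 : u a = w 0 := hw.init.symm
  have e1 : u' a = w' 0 := hw.init_deriv.symm
  have sol : h.IsTruncSol hR (a + b) (glue a u w) (glue a u' w') := by
    refine ⟨glue_continuousOn ha.le hb.le s1.cont_u s2.cont_u e0,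
      glue_continuousOn ha.le hb.le s1.cont_v s2.cont_v e1, ?_, ?_, ?_, ?_⟩
    · simp only [glue_map (fun v : H1 => source h.p_gt hR v.toL2)]
      exact glue_continuousOn ha.le hb.le s1.cont_f s2.cont_f (by rw [e0])
    · simp only [glue_map (fun v : H1 => bdrySource c hT R (traceL v))]
      exact glue_continuousOn ha.le hb.le s1.cont_g s2.cont_g (by rw [e0])
    · simp only [glue_map h.data.ι]
      exact glue_hasDerivWithinAt ha.le hb.le s1.deriv_u s2.deriv_u (by rw [e0]) e1
    · have := glue_hasDerivWithinAt ha.le hb.le s1.deriv_mom s2.deriv_mom (by rw [e0, e1])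
        (by rw [e0])
      intro t ht
      convert! this t ht using 1
      · funext s
        unfold glue
        split_ifs <;> rfl
      · unfold glue
        split_ifs <;> rfl
  have := h.isWeakSolutionOn_of_isTruncSol hR (add_pos ha hb) sol
    (t1.glue t2 ha.le hb.le e0) (fun t ht x hx => by
      rcases le_or_gt t a with hta | hta
      · rw [glue_of_le hta]
        exact (hb₁ t ⟨ht.1, hta⟩ x hx).trans (le_max_left _ _)
      · rw [glue_of_ge e0 hta.le]
        exact (hb₂ _ ⟨by linarith, by linarith [ht.2]⟩ x hx).trans (le_max_right _ _))
  rwa [glue_of_le ha.le, glue_of_le ha.le, hu.init, hu.init_deriv] at this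

/-- The rate comes from the Lipschitz constants of the sources truncated at `R`, so it is the same
for all solutions and all times. -/
lemma exists_stability (h : c.Admissible lamT hT) (hR : 0 ≤ R) : ∃ C : ℝ, 0 ≤ C ∧
    ∀ (T : ℝ) (u w : ℝ → H1) (u' w' : ℝ → L2),
    h.IsTruncSol hR T u u' → h.IsTruncSol hR T w w' → ∀ t ∈ Ico 0 T,
      ‖u t - w t‖ ^ 2 + ‖u' t - w' t‖ ^ 2
        ≤ (‖u 0 - w 0‖ ^ 2 + ‖u' 0 - w' 0‖ ^ 2) * Real.exp (C * t) := by
  obtain ⟨k, hk⟩ := source_lipschitz h.p_gt hR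
  obtain ⟨l, hl⟩ := bdrySource_lipschitz h hR
  set L := h.data.lipConst k l
  have hL : 0 ≤ L := lipConst_nonneg
  have hb := h.data.b_pos
  refine ⟨L + L ^ 2 / h.data.b, by positivity, fun T u w u' w' hu hw t ht => ?_⟩
  have hs := IsSol.sub hu hw
  have := hs.norm_sq_le hL (fun t _ => norm_comp_ι_sub_le (D := h.data) hk (u t) (w t))
    (fun t _ => norm_comp_γ_sub_le (D := h.data) hl (u t) (w t)) ht.1 ht.2
  rwa [sub_zero] at this

/-- Weak solutions are determined by their initial data. -/
theorem weakSolution_unique (h : c.Admissible lamT hT) (hT0 : 0 < T)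
    (hu : IsWeakSolutionOn c u₀ u₁ u u' T) (hw : IsWeakSolutionOn c u₀ u₁ w w' T) {t : ℝ}
    (ht : t ∈ Ico 0 T) : u t = w t := by
  obtain ⟨R₁, hR₁, hb₁⟩ := exists_rep_bound hu.continuousOn
  obtain ⟨R₂, hR₂, hb₂⟩ := exists_rep_bound hw.continuousOn
  set R := max R₁ R₂
  have hR : 0 ≤ R := hR₁.trans (le_max_left _ _)
  obtain ⟨s1, -⟩ := h.isTruncSol_of_isWeakSolutionOn hR hT0 hu
    (fun t ht x hx => (hb₁ t ht x hx).trans (le_max_left _ _))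
  obtain ⟨s2, -⟩ := h.isTruncSol_of_isWeakSolutionOn hR hT0 hw
    (fun t ht x hx => (hb₂ t ht x hx).trans (le_max_right _ _))
  obtain ⟨C, -, hC⟩ := h.exists_stability hR
  have := hC T u w u' w' s1 s2 t ht
  rw [hu.init, hw.init, hu.init_deriv, hw.init_deriv] at this
  simp only [sub_self, norm_zero, ne_eq, OfNat.ofNat_ne_zero, not_false_eq_true, zero_pow,
    add_zero, zero_mul] at this
  have h0 : ‖u t - w t‖ ^ 2 = 0 := by nlinarith [sq_nonneg ‖u t - w t‖, sq_nonneg ‖u' t - w' t‖]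
  rwa [sq_eq_zero_iff, norm_eq_zero, sub_eq_zero] at h0

/-- Comparison with the zero solution turns stability into an a priori bound. -/
lemma isTruncSol_zero (h : c.Admissible lamT hT) (hR : 0 ≤ R) (T : ℝ) :
    h.IsTruncSol hR T (fun _ => 0) (fun _ => 0) where
  cont_u := continuousOn_const
  cont_v := continuousOn_const
  cont_f := continuousOn_const
  cont_g := continuousOn_const
  deriv_u t _ := hasDerivWithinAt_const _ _ _
  deriv_mom t _ := by
    have e1 : source h.p_gt hR (0 : H1).toL2 = 0 := source_zero h.p_gt hR
    have e2 : bdrySource c hT R (traceL 0) = 0 := by rw [map_zero]; exact bdrySource_zero hR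
    rw [e1, e2]
    simp only [frc, map_zero, neg_zero, add_zero]
    exact hasDerivWithinAt_const _ _ _

/-- Local existence, with a time of existence that is uniform for bounded data. -/
theorem exists_weakSolution (h : c.Admissible lamT hT) (A : ℝ) : ∃ δ : ℝ, 0 < δ ∧
    ∀ (v₀ : H1) (v₁ : L2),
    ‖v₁‖ ^ 2 + ‖v₀‖ ^ 2 ≤ A → ∃ (w : ℝ → H1) (w' : ℝ → L2), IsWeakSolutionOn c v₀ v₁ w w' δ := by
  rcases lt_or_ge A 0 with hA | hA
  · refine ⟨1, one_pos, fun v₀ v₁ hv => ?_⟩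
    nlinarith [sq_nonneg ‖v₁‖, sq_nonneg ‖v₀‖]
  -- The factor 2 is that of the sup bound by the H¹ norm: as long as the squared norm stays below A
  -- + 1, the truncation is invisible.
  set R := 2 * Real.sqrt (A + 1) with hRdef
  have hR : 0 ≤ R := by positivity
  obtain ⟨C, hC0, hC⟩ := h.exists_stability hR
  have hlog : 0 < Real.log (1 + 1 / (A + 1)) := Real.log_pos (by
    have : 0 < 1 / (A + 1) := by positivity
    linarith)
  -- Chosen so that A e^{Cδ} ≤ A(1 + 1/(A+1)) ≤ A + 1; the denominator C + 1 allows C = 0.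
  set δ := Real.log (1 + 1 / (A + 1)) / (C + 1) with hδdef
  have hδ : 0 < δ := div_pos hlog (by linarith)
  refine ⟨δ, hδ, fun v₀ v₁ hv => ?_⟩
  obtain ⟨k, hk⟩ := source_lipschitz h.p_gt hR
  obtain ⟨l, hl⟩ := bdrySource_lipschitz h hR
  obtain ⟨w, w', d, hw0, hw0', hsol, hd, htr⟩ := exists_isSol (D := h.data) (S := δ + 1)
    toL2L_injective (fun x δ hδ => exists_ker_trace_near x hδ) (fun k => by
      obtain ⟨m, hm⟩ := dampL_surjective h.det_pos k
      obtain ⟨v, hv⟩ := traceL_surjective m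
      exact ⟨v, by change dampL _ _ _ (traceL v) = k; rw [hv, hm]⟩) hk hl (by linarith) v₀ v₁
  have hsol' : h.IsTruncSol hR (δ + 1) w w' := hsol
  have hle : δ ≤ δ + 1 := by linarith
  have hnorm : ∀ t ∈ Icc 0 δ, ‖w t‖ ^ 2 ≤ A + 1 := by
    intro t ht
    have h1 := hC _ _ _ _ _ hsol' (h.isTruncSol_zero hR _) t ⟨ht.1, by linarith [ht.2]⟩
    simp only [sub_zero, hw0, hw0'] at h1
    have h2 : Real.exp (C * t) ≤ 1 + 1 / (A + 1) := by
      rw [← Real.le_log_iff_exp_le (by positivity)]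
      have e : (C + 1) * δ = Real.log (1 + 1 / (A + 1)) := by rw [hδdef]; field_simp
      nlinarith [ht.1, ht.2]
    have h3 : (‖v₀‖ ^ 2 + ‖v₁‖ ^ 2) * Real.exp (C * t) ≤ A * (1 + 1 / (A + 1)) :=
      mul_le_mul (by linarith) h2 (Real.exp_pos _).le hA
    have h4 : A * (1 + 1 / (A + 1)) ≤ A + 1 := by
      have : A * (1 / (A + 1)) ≤ 1 := by
        rw [mul_one_div, div_le_one (by linarith)]; linarith
      linarith
    nlinarith [sq_nonneg ‖w' t‖]
  have hbd : ∀ t ∈ Icc 0 δ, ∀ x ∈ Icc (0 : ℝ) 1, |(w t).rep x| ≤ R := fun t ht x hx =>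
    ((w t).abs_rep_le hx).trans
      (mul_le_mul_of_nonneg_left (Real.le_sqrt_of_sq_le (hnorm t ht)) zero_le_two)
  have htraces : HasTraces w (δ + 1) := by
    have hd' : MemLp d 2 (volume.restrict (Ioo 0 (δ + 1))) :=
      hd.mono_measure (Measure.restrict_mono Ioo_subset_Ioc_self le_rfl)
    have hdi : ∀ t ∈ Icc 0 (δ + 1), IntervalIntegrable d volume 0 t := fun t ht => by
      rw [intervalIntegrable_iff_integrableOn_Ioc_of_le ht.1]
      exact IntegrableOn.mono_set (hd.integrable one_le_two) (Ioc_subset_Ioc_right ht.2)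
    have m₀ : MemLp (fun t => (d t).fst) 2 (volume.restrict (Ioo 0 (δ + 1))) :=
      (WithLp.fstL 2 ℝ ℝ ℝ).comp_memLp' hd'
    have m₁ : MemLp (fun t => (d t).snd) 2 (volume.restrict (Ioo 0 (δ + 1))) :=
      (WithLp.sndL 2 ℝ ℝ ℝ).comp_memLp' hd'
    refine ⟨_, _, m₀, m₁, ⟨m₀.integrable one_le_two, fun t ht => ?_⟩,
      ⟨m₁.integrable one_le_two, fun t ht => ?_⟩⟩
    · have e := congrArg (WithLp.fstL 2 ℝ ℝ ℝ) (htr t ht)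
      rw [map_add, ← ContinuousLinearMap.intervalIntegral_comp_comm _ (hdi t ht), ← hw0] at e
      exact e
    · have e := congrArg (WithLp.sndL 2 ℝ ℝ ℝ) (htr t ht)
      rw [map_add, ← ContinuousLinearMap.intervalIntegral_comp_comm _ (hdi t ht), ← hw0] at e
      exact e
  have := h.isWeakSolutionOn_of_isTruncSol hR hδ (IsSol.mono hsol' (Icc_subset_Icc_right hle))
    (htraces.mono hle) hbd
  rw [hw0, hw0'] at this
  exact ⟨w, w', this⟩

/-- A maximal weak solution with finite maximal time of existence blows up. -/
theorem tendsto_of_maximal (h : c.Admissible lamT hT) {Tmax : ℝ}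
    (hu : IsMaximalWeakSolution c u₀ u₁ u u' Tmax) :
    Tendsto (fun t : ℝ => ‖u' t‖ ^ 2 + ‖u t‖ ^ 2) (𝓝[<] Tmax) atTop := by
  obtain ⟨⟨hT0, hsol⟩, hmax⟩ := hu
  have hTpos : 0 < Tmax := by exact_mod_cast hT0
  by_contra hnot
  rw [tendsto_atTop] at hnot
  push Not at hnot
  obtain ⟨A, hA⟩ := hnot
  obtain ⟨δ, hδ, hloc⟩ := h.exists_weakSolution A
  have hev : ∀ᶠ t in 𝓝[<] Tmax, t ∈ Ioo (max 0 (Tmax - δ)) Tmax :=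
    Ioo_mem_nhdsLT (max_lt hTpos (by linarith))
  -- A time less than `δ` before the end at which the norm is below `A`; a restart there outlives
  -- `Tmax`.
  obtain ⟨a, haA, ha⟩ := (hA.and_eventually hev).exists
  have ha0 : 0 < a := (le_max_left _ _).trans_lt ha.1
  have haδ : Tmax - δ < a := (le_max_right _ _).trans_lt ha.1
  obtain ⟨w, w', hw⟩ := hloc (u a) (u' a) haA.le
  have hua := hsol a ha0 (by exact_mod_cast ha.2)
  have hg := h.isWeakSolutionOn_glue ha0 hδ hua hw
  have hpos : 0 < a + δ := by linarith
  refine hmax ⟨((a + δ : ℝ) : EReal), glue a u w, glue a u' w', ?_, ⟨?_, ?_⟩, ?_⟩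
  · exact_mod_cast (by linarith : Tmax < a + δ)
  · exact_mod_cast hpos
  · intro S hS hS'
    have : S < a + δ := by exact_mod_cast hS'
    exact h.isWeakSolutionOn_mono hpos hS this.le hg
  · intro t ht ht'
    have htT : t < Tmax := by exact_mod_cast ht'
    -- Uniqueness holds strictly before the end of an interval, hence an interval reaching past `t`
    -- but short of `Tmax`.
    have hS0 : 0 < (t + Tmax) / 2 := by linarith
    have s1 := hsol ((t + Tmax) / 2) hS0 (by exact_mod_cast (by linarith : (t + Tmax) / 2 < Tmax))
    have s2 := h.isWeakSolutionOn_mono hpos hS0 (by linarith) hg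
    exact h.weakSolution_unique hS0 s2 s1 ⟨ht, by linarith⟩

end Coeffs.Admissible

end TwoPointWave

end

/-! ### The energy inequality for the nonlinear problem. -/

noncomputable section

namespace TwoPointWave

open H1 WaveData

/-- On [-R, R] the derivative `pw r` is uniformly continuous, so the mean value inequality gives a
first order expansion with uniform remainder. -/
lemma abs_rpow_div_taylor {r R η : ℝ} (hr : 2 < r) (hη : 0 < η) :
    ∃ ρ : ℝ, 0 < ρ ∧ ∀ x y : ℝ, |x| ≤ R → |y| ≤ R → |x - y| ≤ ρ →
      |1 / r * |x| ^ r - 1 / r * |y| ^ r - pw r y * (x - y)| ≤ η * |x - y| := by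
  obtain ⟨δ, hδ, hu⟩ := Metric.uniformContinuousOn_iff.mp
    ((isCompact_Icc (a := -R) (b := R)).uniformContinuousOn_of_continuous
      (continuous_pw hr).continuousOn) η hη
  refine ⟨δ / 2, by positivity, fun x y hx hy hxy => ?_⟩
  have hconv : Convex ℝ (Icc (-R) R ∩ Metric.closedBall y (δ / 2)) :=
    (convex_Icc _ _).inter (convex_closedBall _ _)
  have := hconv.norm_image_sub_le_of_norm_hasDerivWithin_le
    (f := fun s => 1 / r * |s| ^ r - pw r y * s) (f' := fun s => pw r s - pw r y * 1) (C := η)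
    (x := y) (y := x)
    (fun s _ => ((hasDerivAt_abs_rpow_div hr s).sub
      ((hasDerivAt_id s).const_mul (pw r y))).hasDerivWithinAt)
    (fun s hs => by
      have h1 := hu s hs.1 y (abs_le.mp hy) (by
        have := Metric.mem_closedBall.mp hs.2
        linarith)
      rw [Real.dist_eq] at h1
      rw [mul_one, Real.norm_eq_abs]
      exact h1.le)
    ⟨abs_le.mp hy, Metric.mem_closedBall_self (by positivity)⟩
    ⟨abs_le.mp hx, by rwa [Metric.mem_closedBall, Real.dist_eq]⟩
  simp only [Real.norm_eq_abs] at this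
  convert! this using 2
  ring

/-- The potential energy of a state, with the indirect boundary coupling included. -/
def potential (c : Coeffs) (hT : ℝ) (v : H1) : ℝ :=
  1 / c.p * (∫ x in Ioo (0 : ℝ) 1, |v.rep x| ^ c.p) + 1 / c.α * |v.rep 0| ^ c.α
    + 1 / c.β * |v.rep 1| ^ c.β - hT * (v.rep 0 * v.rep 1)

lemma integrableOn_of_rep (v : H1) {φ : ℝ → ℝ} (hφ : Continuous φ) :
    IntegrableOn (fun x => φ (v.rep x)) (Ioo (0 : ℝ) 1) :=
  ((hφ.comp_continuousOn v.rep_continuousOn).integrableOn_compact isCompact_Icc).mono_set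
    Ioo_subset_Icc_self

lemma abs_fst_le_norm (k : Bdry) : |k.fst| ≤ ‖k‖ := by
  refine abs_le_of_sq_le_sq ?_ (norm_nonneg _)
  rw [← real_inner_self_eq_norm_sq, inner_bdry]
  nlinarith [sq_nonneg k.snd]

lemma abs_snd_le_norm (k : Bdry) : |k.snd| ≤ ‖k‖ := by
  refine abs_le_of_sq_le_sq ?_ (norm_nonneg _)
  rw [← real_inner_self_eq_norm_sq, inner_bdry]
  nlinarith [sq_nonneg k.fst]

variable {c : Coeffs} {lamT hT : ℝ} {T R a b : ℝ} {u₀ : H1} {u₁ : L2} {u w : ℝ → H1}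
  {u' w' : ℝ → L2}

namespace Coeffs.Admissible

/-- First order expansion of the potential energy. -/
lemma potential_taylor (h : c.Admissible lamT hT) (hR : 0 ≤ R) {η : ℝ} (hη : 0 < η) :
    ∃ ρ : ℝ, 0 < ρ ∧ ∀ v w : H1, (∀ x ∈ Icc (0 : ℝ) 1, |v.rep x| ≤ R) →
      (∀ x ∈ Icc (0 : ℝ) 1, |w.rep x| ≤ R) → ‖w - v‖ ≤ ρ →
      |potential c hT w - potential c hT v - inner ℝ (source h.p_gt hR v.toL2) (w - v).toL2
        - inner ℝ (bdrySource c hT R (traceL v)) (traceL (w - v))|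
        ≤ η * (‖(w - v).toL2‖ + ‖traceL (w - v)‖) := by
  have hη3 : 0 < η / 3 := by positivity
  obtain ⟨ρ₁, h₁, H₁⟩ := abs_rpow_div_taylor (R := R) h.p_gt hη3
  obtain ⟨ρ₂, h₂, H₂⟩ := abs_rpow_div_taylor (R := R) h.α_gt hη3
  obtain ⟨ρ₃, h₃, H₃⟩ := abs_rpow_div_taylor (R := R) h.β_gt hη3
  have h₄ : 0 < η / 3 / (|hT| + 1) := by positivity
  set ρ := min (min ρ₁ ρ₂) (min ρ₃ (η / 3 / (|hT| + 1)))
  have hρ : 0 < ρ := lt_min (lt_min h₁ h₂) (lt_min h₃ h₄)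
  have o₁ : ρ ≤ ρ₁ := (min_le_left _ _).trans (min_le_left _ _)
  have o₂ : ρ ≤ ρ₂ := (min_le_left _ _).trans (min_le_right _ _)
  have o₃ : ρ ≤ ρ₃ := (min_le_right _ _).trans (min_le_left _ _)
  have o₄ : ρ ≤ η / 3 / (|hT| + 1) := (min_le_right _ _).trans (min_le_right _ _)
  -- Halved because the sup norm is at most twice the H¹ norm. The remainder is measured by the L²
  -- norm and the trace only, since difference quotients in time are not controlled in H¹.
  refine ⟨ρ / 2, by positivity, fun v w hv hw hvw => ?_⟩
  have hsub : ∀ x ∈ Icc (0 : ℝ) 1, (w - v).rep x = w.rep x - v.rep x := fun x hx => rep_sub w v hx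
  have hd : ∀ x ∈ Icc (0 : ℝ) 1, |w.rep x - v.rep x| ≤ ρ := fun x hx => by
    rw [← hsub x hx]
    linarith [(w - v).abs_rep_le hx]
  have i0 : (0 : ℝ) ∈ Icc (0 : ℝ) 1 := by simp
  have i1 : (1 : ℝ) ∈ Icc (0 : ℝ) 1 := by simp
  -- the interior term
  have cp : Continuous fun s : ℝ => |s| ^ c.p :=
    continuous_abs.rpow_const fun _ => Or.inr (by linarith [h.p_gt])
  have I : |1 / c.p * (∫ x in Ioo (0 : ℝ) 1, |w.rep x| ^ c.p)
      - 1 / c.p * (∫ x in Ioo (0 : ℝ) 1, |v.rep x| ^ c.p)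
      - inner ℝ (source h.p_gt hR v.toL2) (w - v).toL2| ≤ η / 3 * ‖(w - v).toL2‖ := by
    have j1 := (integrableOn_of_rep w cp).const_mul (1 / c.p)
    have j2 := (integrableOn_of_rep v cp).const_mul (1 / c.p)
    have j3 : IntegrableOn (fun x => |v.rep x| ^ (c.p - 2) * v.rep x * (w - v).rep x)
        (Ioo (0 : ℝ) 1) :=
      ((((continuous_pw h.p_gt).comp_continuousOn v.rep_continuousOn).mul
        (w - v).rep_continuousOn).integrableOn_compact isCompact_Icc).mono_set Ioo_subset_Icc_self
    have j4 : IntegrableOn (fun x => 1 / c.p * |w.rep x| ^ c.p - 1 / c.p * |v.rep x| ^ c.p)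
        (Ioo (0 : ℝ) 1) := j1.sub j2
    rw [inner_source h.p_gt hR hv, ← integral_const_mul, ← integral_const_mul,
      ← integral_sub j1 j2, ← integral_sub j4 j3]
    refine (abs_integral_le_integral_abs).trans (le_trans ?_
      (mul_le_mul_of_nonneg_left (integral_abs_le (w - v).toL2) hη3.le))
    rw [← integral_const_mul]
    refine integral_mono_ae (j4.sub j3).abs
      (((Lp.memLp (w - v).toL2).integrable one_le_two).abs.const_mul _) ?_
    filter_upwards [(w - v).rep_ae_eq, ae_restrict_mem measurableSet_Ioo] with x hx hxI
    have hxI := Ioo_subset_Icc_self hxI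
    rw [← hx, hsub x hxI]
    exact H₁ _ _ (hw x hxI) (hv x hxI) ((hd x hxI).trans o₁)
  -- the boundary terms
  have B0 := H₂ _ _ (hw 0 i0) (hv 0 i0) ((hd 0 i0).trans o₂)
  have B1 := H₃ _ _ (hw 1 i1) (hv 1 i1) ((hd 1 i1).trans o₃)
  have n0 : |w.rep 0 - v.rep 0| ≤ ‖traceL (w - v)‖ := by
    rw [← hsub 0 i0]; exact abs_fst_le_norm (traceL (w - v))
  have n1 : |w.rep 1 - v.rep 1| ≤ ‖traceL (w - v)‖ := by
    rw [← hsub 1 i1]; exact abs_snd_le_norm (traceL (w - v))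
  -- The coupling is bilinear, and its second order remainder is the product of the two boundary
  -- increments.
  have B2 : |hT * ((w.rep 0 - v.rep 0) * (w.rep 1 - v.rep 1))|
      ≤ η / 3 * ‖traceL (w - v)‖ := by
    rw [abs_mul, abs_mul, ← mul_assoc]
    refine mul_le_mul ?_ n1 (abs_nonneg _) hη3.le
    have e : η / 3 / (|hT| + 1) * (|hT| + 1) = η / 3 := div_mul_cancel₀ _ (by positivity)
    have := mul_le_mul_of_nonneg_left ((hd 0 i0).trans o₄) (abs_nonneg hT)
    nlinarith
  have eB : inner ℝ (bdrySource c hT R (traceL v)) (traceL (w - v))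
      = (pw c.α (v.rep 0) - hT * v.rep 1) * (w.rep 0 - v.rep 0)
        + (pw c.β (v.rep 1) - hT * v.rep 0) * (w.rep 1 - v.rep 1) := by
    rw [inner_bdry, bdrySource, traceL_apply, traceL_apply]
    simp only [WithLp.toLp_fst, WithLp.toLp_snd]
    rw [trunc_eq (hv 0 i0), trunc_eq (hv 1 i1), hsub 0 i0, hsub 1 i1]
    rfl
  rw [eB]
  have B0' := B0.trans (mul_le_mul_of_nonneg_left n0 hη3.le)
  have B1' := B1.trans (mul_le_mul_of_nonneg_left n1 hη3.le)
  rw [abs_le] at I B0' B1' B2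
  have hn : 0 ≤ η * ‖(w - v).toL2‖ := by positivity
  unfold potential
  rw [abs_le]
  constructor <;> linarith [I.1, I.2, B0'.1, B0'.2, B1'.1, B1'.2, B2.1, B2.2]

/-- Evaluations are continuous on H¹, and the sup bound dominates the interior integrand. -/
lemma continuousOn_potential (h : c.Admissible lamT hT) (hu : ContinuousOn u (Icc 0 T)) :
    ContinuousOn (fun t => potential c hT (u t)) (Icc 0 T) := by
  have h0 : ContinuousOn (fun t => (u t).rep 0) (Icc 0 T) :=
    (evalL ⟨0, by simp⟩).continuous.comp_continuousOn hu
  have h1 : ContinuousOn (fun t => (u t).rep 1) (Icc 0 T) :=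
    (evalL ⟨1, by simp⟩).continuous.comp_continuousOn hu
  have hα : 0 < c.α := by linarith [h.α_gt]
  have hβ : 0 < c.β := by linarith [h.β_gt]
  have hI : ContinuousOn (fun t => 1 / c.p * ∫ x in Ioo (0 : ℝ) 1, |(u t).rep x| ^ c.p)
      (Icc 0 T) := by
    obtain ⟨R, hR, hb⟩ := exists_rep_bound hu
    have cp : Continuous fun s : ℝ => |s| ^ c.p :=
      continuous_abs.rpow_const fun _ => Or.inr (by linarith [h.p_gt])
    refine ContinuousOn.mul continuousOn_const ?_
    intro t ht
    refine tendsto_integral_filter_of_dominated_convergence (fun _ => R ^ c.p)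
      (Eventually.of_forall fun s => (integrableOn_of_rep (u s) cp).aestronglyMeasurable) ?_
      (integrable_const _) ?_
    · filter_upwards [self_mem_nhdsWithin] with s hs
      filter_upwards [ae_restrict_mem measurableSet_Ioo] with x hx
      rw [Real.norm_of_nonneg (by positivity)]
      exact Real.rpow_le_rpow (abs_nonneg _) (hb s hs x (Ioo_subset_Icc_self hx))
        (by linarith [h.p_gt])
    · filter_upwards [ae_restrict_mem measurableSet_Ioo] with x hx
      exact (cp.tendsto _).comp (((evalL ⟨x, Ioo_subset_Icc_self hx⟩).continuous.comp_continuousOn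
        hu) t ht)
  unfold potential
  refine ((hI.add (ContinuousOn.mul continuousOn_const ?_)).add
    (ContinuousOn.mul continuousOn_const ?_)).sub (ContinuousOn.mul continuousOn_const (h0.mul h1))
  · exact h0.abs.rpow_const fun _ _ => Or.inr hα.le
  · exact h1.abs.rpow_const fun _ _ => Or.inr hβ.le

/-- The energy inequality. -/
theorem energy_le (h : c.Admissible lamT hT) (hR : 0 ≤ R) (hu : h.IsTruncSol hR T u u')
    (hb : ∀ t ∈ Icc 0 T, ∀ x ∈ Icc (0 : ℝ) 1, |(u t).rep x| ≤ R) {t : ℝ} (ht : t ∈ Ico 0 T) :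
    1 / 2 * (‖u t‖ ^ 2 + ‖u' t‖ ^ 2) - potential c hT (u t)
      ≤ 1 / 2 * (‖u 0‖ ^ 2 + ‖u' 0‖ ^ 2) - potential c hT (u 0) := by
  have key := IsSol.energy_le (P := fun t => potential c hT (u t)) (ψ := fun _ => 0) hu
    (h.continuousOn_potential hu.cont_u) ht.1 ht.2 ?_ (fun _ => 0)
    (fun s _ => hasDerivWithinAt_const _ _ _)
  · simpa using key
  intro η hη
  obtain ⟨M, hM⟩ := isCompact_Icc.exists_bound_of_continuousOn hu.cont_v
  have hM0 : 0 ≤ M := (norm_nonneg _).trans (hM 0 ⟨le_rfl, ht.1.trans ht.2.le⟩)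
  -- Interior quotients are bounded by M + 1 once the step is small, so this makes the interior
  -- error at most `η`, and also η' ≤ η for the trace error.
  set η' := η / (M + 2) with hη'
  have hη'0 : 0 < η' := by positivity
  have eη : η' * (M + 2) = η := div_mul_cancel₀ _ (by positivity)
  obtain ⟨ρ, hρ, H⟩ := h.potential_taylor hR hη'0
  obtain ⟨δ, hδ, huc⟩ := Metric.uniformContinuousOn_iff.mp
    (isCompact_Icc.uniformContinuousOn_of_continuous hu.cont_u) ρ hρ
  have h1 : ∀ᶠ s in 𝓝[>] (0 : ℝ), s ∈ Ioo 0 (min δ (T - t)) :=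
    Ioo_mem_nhdsGT (lt_min hδ (by linarith [ht.2]))
  filter_upwards [h1, dq_uniform hu.deriv_u hu.cont_v ht.2 one_pos] with s hs hdq τ hτ
  have hs1 : s < δ := hs.2.trans_le (min_le_left _ _)
  have hs2 : s < T - t := hs.2.trans_le (min_le_right _ _)
  have m1 : τ ∈ Icc 0 T := ⟨hτ.1, by linarith [hτ.2, ht.2]⟩
  have m2 : τ + s ∈ Icc 0 T := ⟨by linarith [hτ.1, hs.1], by linarith [hτ.2]⟩
  have hclose := huc (τ + s) m2 τ m1 (by
    rw [Real.dist_eq, add_sub_cancel_left, abs_of_pos hs.1]; exact hs1)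
  rw [dist_eq_norm] at hclose
  have E := H (u τ) (u (τ + s)) (hb τ m1) (hb _ m2) hclose.le
  have n1 := hdq τ hτ
  rw [dq_map] at n1
  have n2 : ‖h.data.ι (dq s u τ)‖ ≤ M + 1 := by
    have := norm_le_norm_add_norm_sub' (h.data.ι (dq s u τ)) (u' τ)
    linarith [hM τ m1]
  have hsi : 0 < s⁻¹ := inv_pos.mpr hs.1
  have e1 : h.data.ι (dq s u τ) = s⁻¹ • (u (τ + s) - u τ).toL2 := by
    rw [dq, map_smul]; rfl
  have e2 : h.data.γ (dq s u τ) = s⁻¹ • traceL (u (τ + s) - u τ) := by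
    rw [dq, map_smul]; rfl
  have n3 : ‖h.data.ι (dq s u τ)‖ = s⁻¹ * ‖(u (τ + s) - u τ).toL2‖ := by
    rw [e1, norm_smul, Real.norm_of_nonneg hsi.le]
  have n4 : ‖h.data.γ (dq s u τ)‖ = s⁻¹ * ‖traceL (u (τ + s) - u τ)‖ := by
    rw [e2, norm_smul, Real.norm_of_nonneg hsi.le]
  have E' := mul_le_mul_of_nonneg_left (abs_le.mp E).1 hsi.le
  have e3 : dq s (fun t => potential c hT (u t)) τ
      = s⁻¹ * (potential c hT (u (τ + s)) - potential c hT (u τ)) := rfl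
  have hb0 : 0 ≤ h.data.b / 2 * ‖h.data.γ (dq s u τ)‖ ^ 2 := by
    have := h.data.b_pos
    positivity
  have i1 : inner ℝ (source h.p_gt hR (u τ).toL2) (h.data.ι (dq s u τ))
      = s⁻¹ * inner ℝ (source h.p_gt hR (u τ).toL2) (u (τ + s) - u τ).toL2 := by
    rw [e1, real_inner_smul_right]
  have i2 : inner ℝ (bdrySource c hT R (traceL (u τ))) (h.data.γ (dq s u τ))
      = s⁻¹ * inner ℝ (bdrySource c hT R (traceL (u τ))) (traceL (u (τ + s) - u τ)) := by
    rw [e2, real_inner_smul_right]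
  rw [i1, i2, e3]
  have n5 : η' * ‖h.data.ι (dq s u τ)‖ ≤ η' * (M + 1) := mul_le_mul_of_nonneg_left n2 hη'0.le
  have n6 : η' * ‖h.data.γ (dq s u τ)‖ ≤ η * ‖h.data.γ (dq s u τ)‖ :=
    mul_le_mul_of_nonneg_right (by nlinarith) (norm_nonneg _)
  nlinarith

end Coeffs.Admissible

end TwoPointWave

end

/-! ### The virial functional and finite-time blow-up. -/

noncomputable section

namespace TwoPointWave

open H1 WaveData

/-- A function on the half-line cannot satisfy a superlinear differential inequality while being
driven at a positive rate. -/
lemma not_superlinear_growth {M m : ℝ → ℝ} {κ s : ℝ} (hκ : 0 < κ) (hs : 1 < s)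
    (hM : ∀ t, 0 < t → HasDerivAt M (m t) t) (h₁ : ∀ t, 0 < t → κ ≤ m t)
    (h₂ : ∀ t, 0 < t → κ * |M t| ^ s ≤ m t) : False := by
  have lin : ∀ t, 1 ≤ t → κ * (t - 1) ≤ M t - M 1 := fun t ht =>
    (convex_Ici (1 : ℝ)).mul_sub_le_image_sub_of_le_deriv
      (fun x hx => (hM x (lt_of_lt_of_le one_pos hx)).continuousAt.continuousWithinAt)
      (fun x hx => (hM x (lt_of_lt_of_le one_pos
        (interior_subset hx))).differentiableAt.differentiableWithinAt)
      (fun x hx => by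
        have hx0 : 0 < x := lt_of_lt_of_le one_pos (interior_subset hx)
        rw [(hM x hx0).deriv]
        exact h₁ x hx0) 1 self_mem_Ici t ht ht
  -- Linear growth at rate κ makes M at least 1 + M 1 + |M 1| from here on, hence positive.
  set t₀ := 1 + (|M 1| + 1) / κ with ht₀
  have h0 : 1 ≤ t₀ := by
    have : 0 ≤ (|M 1| + 1) / κ := by positivity
    linarith
  have pos : ∀ t, t₀ ≤ t → 0 < M t := fun t ht => by
    have e : κ * (t₀ - 1) = |M 1| + 1 := by rw [ht₀]; field_simp; ring
    have := lin t (h0.trans ht)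
    have := mul_le_mul_of_nonneg_left (sub_le_sub_right ht 1) hκ.le
    linarith [neg_abs_le (M 1)]
  set κ' := (s - 1) * κ with hκ'
  have hκ'0 : 0 < κ' := mul_pos (by linarith) hκ
  have der : ∀ t, t₀ ≤ t → HasDerivAt (fun t => M t ^ (1 - s))
      (m t * (1 - s) * M t ^ (1 - s - 1)) t := fun t ht =>
    (hM t (by linarith)).rpow_const (Or.inl (pos t ht).ne')
  -- The superlinear inequality says that the positive quantity M^{1-s} decreases at least at rate
  -- (s - 1)κ; at `t₁` below nothing of it would be left.
  have dec : ∀ t, t₀ ≤ t → M t ^ (1 - s) - M t₀ ^ (1 - s) ≤ -κ' * (t - t₀) := fun t ht =>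
    (convex_Ici t₀).image_sub_le_mul_sub_of_deriv_le
      (f := fun t => M t ^ (1 - s))
      (fun x hx => (der x hx).continuousAt.continuousWithinAt)
      (fun x hx => (der x (interior_subset hx)).differentiableAt.differentiableWithinAt)
      (fun x hx => by
        have hx : t₀ ≤ x := interior_subset hx
        rw [(der x hx).deriv]
        have hp := pos x hx
        have e : M x ^ s * M x ^ (1 - s - 1) = 1 := by
          rw [← Real.rpow_add hp]; simp
        have h3 := h₂ x (by linarith)
        rw [abs_of_pos hp] at h3
        have h4 : 0 < M x ^ (1 - s - 1) := Real.rpow_pos_of_pos hp _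
        have h5 := mul_le_mul_of_nonneg_right h3 h4.le
        rw [mul_assoc, e, mul_one] at h5
        have h6 := mul_le_mul_of_nonneg_left h5 (by linarith : 0 ≤ s - 1)
        rw [hκ']
        nlinarith) t₀ self_mem_Ici t ht ht
  have hN : 0 < M t₀ ^ (1 - s) := Real.rpow_pos_of_pos (pos t₀ le_rfl) _
  set t₁ := t₀ + M t₀ ^ (1 - s) / κ' with ht₁
  have h1 : t₀ ≤ t₁ := by
    have : 0 ≤ M t₀ ^ (1 - s) / κ' := by positivity
    linarith
  have e1 : κ' * (t₁ - t₀) = M t₀ ^ (1 - s) := by rw [ht₁]; field_simp; ring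
  have := dec t₁ h1
  have := Real.rpow_pos_of_pos (pos t₁ h1) (1 - s)
  linarith

/-- The total mass of the source terms. -/
def sourceMass (c : Coeffs) (v : H1) : ℝ :=
  (∫ x in Ioo (0 : ℝ) 1, |v.rep x| ^ c.p) + |v.rep 0| ^ c.α + |v.rep 1| ^ c.β

lemma integral_abs_rpow_nonneg (r : ℝ) (v : H1) : 0 ≤ ∫ x in Ioo (0 : ℝ) 1, |v.rep x| ^ r :=
  integral_nonneg fun x => by positivity

lemma sourceMass_nonneg (c : Coeffs) (v : H1) : 0 ≤ sourceMass c v := by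
  have := integral_abs_rpow_nonneg c.p v
  unfold sourceMass
  positivity

/-- The virial functional. -/
def virial (c : Coeffs) (lamT : ℝ) (v : H1) (v' : L2) : ℝ :=
  inner ℝ v' v.toL2 + c.lam / 2 * ‖v.toL2‖ ^ 2
    + 1 / 2 * inner ℝ (dampL c.lam0 c.lam1 lamT (traceL v)) (traceL v)

lemma abs_rpow_sub_two_mul_sq {r : ℝ} (hr : 2 < r) (s : ℝ) : |s| ^ (r - 2) * s * s = |s| ^ r := by
  rw [mul_assoc, ← sq, ← sq_abs, ← Real.rpow_natCast |s| 2, ← Real.rpow_add_of_nonneg (abs_nonneg s)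
    (by linarith) (by norm_num)]
  norm_num

lemma le_of_rpow_le {k y q r : ℝ} (hk : 1 ≤ k) (hy : 0 ≤ y) (hq : 0 < q) (hqr : q ≤ r)
    (h : y ^ r ≤ k ^ q) : y ≤ k := by
  have h1 : k ^ q ≤ k ^ r := Real.rpow_le_rpow_of_exponent_le hk hqr
  exact (Real.rpow_le_rpow_iff hy (by linarith) (by linarith)).mp (h.trans h1)

/-- Where |s| ≤ k the first term suffices; where |s| > k the superquadratic power wins. The level
`k` stays free so that it can be tuned to the size of the source mass. -/
lemma sq_le_add_rpow {k r : ℝ} (hk : 0 < k) (hr : 2 < r) (s : ℝ) :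
    s ^ 2 ≤ k ^ 2 + k ^ (2 - r) * |s| ^ r := by
  have hp : 0 < k ^ (2 - r) := Real.rpow_pos_of_pos hk _
  rcases le_or_gt |s| k with h | h
  · have : s ^ 2 ≤ k ^ 2 := by rw [← sq_abs]; exact pow_le_pow_left₀ (abs_nonneg s) h 2
    have : 0 ≤ k ^ (2 - r) * |s| ^ r := by positivity
    linarith
  · have h1 : k ^ (r - 2) ≤ |s| ^ (r - 2) := Real.rpow_le_rpow hk.le h.le (by linarith)
    have h2 : k ^ (2 - r) * k ^ (r - 2) = 1 := by
      rw [← Real.rpow_add hk]; simp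
    have h3 : |s| ^ r = |s| ^ (r - 2) * s ^ 2 := by
      rw [← abs_rpow_sub_two_mul_sq hr]; ring
    have h4 := mul_le_mul_of_nonneg_left h1 hp.le
    rw [h2] at h4
    rw [h3, ← mul_assoc]
    nlinarith [sq_nonneg s, sq_nonneg k]

lemma norm_toL2_sq_le {k r W : ℝ} (hk : 0 < k) (hr : 2 < r) (v : H1)
    (hW : ∫ x in Ioo (0 : ℝ) 1, |v.rep x| ^ r ≤ W) :
    ‖v.toL2‖ ^ 2 ≤ k ^ 2 + k ^ (2 - r) * W := by
  have cp : Continuous fun s : ℝ => |s| ^ r :=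
    continuous_abs.rpow_const fun _ => Or.inr (by linarith)
  have e : ‖v.toL2‖ ^ 2 = ∫ x in Ioo (0 : ℝ) 1, v.rep x ^ 2 := by
    rw [← real_inner_self_eq_norm_sq, L2.inner_eq]
    refine integral_congr_ae ?_
    filter_upwards [v.rep_ae_eq] with x hx
    rw [hx, sq]
  have j := (integrableOn_of_rep v cp).const_mul (k ^ (2 - r))
  have hc : IntegrableOn (fun _ : ℝ => k ^ 2) (Ioo (0 : ℝ) 1) := integrableOn_const (by simp)
  have hadd : IntegrableOn (fun x => k ^ 2 + k ^ (2 - r) * |v.rep x| ^ r) (Ioo (0 : ℝ) 1) :=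
    hc.add j
  rw [e]
  calc ∫ x in Ioo (0 : ℝ) 1, v.rep x ^ 2
      ≤ ∫ x in Ioo (0 : ℝ) 1, (k ^ 2 + k ^ (2 - r) * |v.rep x| ^ r) :=
        integral_mono (integrableOn_of_rep v (continuous_pow 2)) hadd
          fun x => sq_le_add_rpow hk hr _
    _ = k ^ 2 + k ^ (2 - r) * ∫ x in Ioo (0 : ℝ) 1, |v.rep x| ^ r := by
        rw [integral_add hc j, integral_const_mul]; simp
    _ ≤ _ := by
        have := mul_le_mul_of_nonneg_left hW (Real.rpow_pos_of_pos hk (2 - r)).le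
        linarith

variable {c : Coeffs} {lamT hT q : ℝ} {T R : ℝ} {u₀ : H1} {u₁ : L2} {u : ℝ → H1} {u' : ℝ → L2}

namespace Coeffs.Admissible

/-- The virial functional has subcritical growth. -/
lemma exists_abs_virial_le (h : c.Admissible lamT hT) (hq : 2 < q) (hqp : q ≤ c.p) (hqα : q ≤ c.α)
    (hqβ : q ≤ c.β) : ∃ C : ℝ, 0 < C ∧ ∀ (v : H1) (v' : L2),
      |virial c lamT v v'| ≤ C * (1 + ‖v'‖ ^ 2 + sourceMass c v) ^ (1 / 2 + 1 / q) := by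
  set b := ‖dampL c.lam0 c.lam1 lamT‖ with hb
  have hb0 : 0 ≤ b := norm_nonneg _
  have hl := h.lam_nonneg
  refine ⟨2 + c.lam + b, by linarith, fun v v' => ?_⟩
  set W := 1 + ‖v'‖ ^ 2 + sourceMass c v with hW
  have hI := integral_abs_rpow_nonneg c.p v
  have h0 : 0 ≤ |v.rep 0| ^ c.α := by positivity
  have h1 : 0 ≤ |v.rep 1| ^ c.β := by positivity
  have hv' := sq_nonneg ‖v'‖
  have hS : sourceMass c v = (∫ x in Ioo (0 : ℝ) 1, |v.rep x| ^ c.p) + |v.rep 0| ^ c.α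
    + |v.rep 1| ^ c.β := rfl
  have hW1 : 1 ≤ W := by rw [hW, hS]; linarith
  have hW0 : 0 < W := by linarith
  -- The natural amplitude: since W ≥ 1 and q is at most each exponent, a power integral or boundary
  -- power bounded by W = k^q forces amplitudes of order `k`.
  set k := W ^ (1 / q) with hk
  have hk1 : 1 ≤ k := Real.one_le_rpow hW1 (by positivity)
  have hk0 : 0 < k := by linarith
  have hkW : k ^ q = W := by
    rw [hk, ← Real.rpow_mul hW0.le, one_div_mul_cancel (by linarith), Real.rpow_one]
  have hx : ‖v'‖ ≤ W ^ (1 / 2 : ℝ) := by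
    rw [← Real.sqrt_eq_rpow]
    exact Real.le_sqrt_of_sq_le (by linarith [sourceMass_nonneg c v])
  have hkx : k ≤ W ^ (1 / 2 : ℝ) :=
    Real.rpow_le_rpow_of_exponent_le hW1 (one_div_le_one_div_of_le two_pos hq.le)
  have hy : ‖v.toL2‖ ^ 2 ≤ 2 * k ^ 2 := by
    have e1 := norm_toL2_sq_le (W := W) hk0 h.p_gt v (by rw [hW, hS]; linarith)
    have e2 : k ^ (2 - c.p) * W ≤ k ^ 2 := by
      calc k ^ (2 - c.p) * W ≤ k ^ (2 - c.p) * k ^ c.p := by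
            rw [← hkW]
            exact mul_le_mul_of_nonneg_left (Real.rpow_le_rpow_of_exponent_le hk1 hqp)
              (Real.rpow_pos_of_pos hk0 _).le
        _ = k ^ 2 := by
            rw [← Real.rpow_add hk0]; norm_num
    linarith
  have hy' : ‖v.toL2‖ ≤ 2 * k := by
    refine abs_le_of_sq_le_sq' ?_ (by positivity) |>.2
    nlinarith
  have r0 : |v.rep 0| ≤ k := le_of_rpow_le hk1 (abs_nonneg _) (by linarith) hqα
    (by rw [hkW, hW, hS]; linarith)
  have r1 : |v.rep 1| ≤ k := le_of_rpow_le hk1 (abs_nonneg _) (by linarith) hqβ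
    (by rw [hkW, hW, hS]; linarith)
  have ht : ‖traceL v‖ ^ 2 ≤ 2 * k ^ 2 := by
    rw [← real_inner_self_eq_norm_sq, inner_bdry, traceL_apply]
    simp only [WithLp.toLp_fst, WithLp.toLp_snd]
    have e0 := pow_le_pow_left₀ (abs_nonneg _) r0 2
    have e1 := pow_le_pow_left₀ (abs_nonneg _) r1 2
    rw [sq_abs] at e0 e1
    linarith
  have t1 : |inner ℝ v' v.toL2| ≤ W ^ (1 / 2 : ℝ) * (2 * k) :=
    (abs_real_inner_le_norm _ _).trans (mul_le_mul hx hy' (norm_nonneg _) (by positivity))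
  have t2 : |inner ℝ (dampL c.lam0 c.lam1 lamT (traceL v)) (traceL v)| ≤ b * (2 * k ^ 2) := by
    refine (abs_real_inner_le_norm _ _).trans ?_
    have := mul_le_mul_of_nonneg_right ((dampL c.lam0 c.lam1 lamT).le_opNorm (traceL v))
      (norm_nonneg (traceL v))
    have := mul_le_mul_of_nonneg_left ht hb0
    rw [← hb] at *
    linarith
  -- As q > 2, the quadratic damping terms of size k² are dominated by the kinetic cross term of
  -- size W^{1/2} k.
  have hkk : k ^ 2 ≤ W ^ (1 / 2 : ℝ) * k := by
    rw [sq]; exact mul_le_mul_of_nonneg_right hkx hk0.le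
  rw [Real.rpow_add hW0, ← hk]
  set X := W ^ (1 / 2 : ℝ) * k
  have t3 : c.lam / 2 * ‖v.toL2‖ ^ 2 ≤ c.lam / 2 * (2 * X) :=
    mul_le_mul_of_nonneg_left (by linarith) (by linarith)
  have t4 : b * (2 * k ^ 2) ≤ b * (2 * X) := mul_le_mul_of_nonneg_left (by linarith) hb0
  have t5 : 0 ≤ c.lam / 2 * ‖v.toL2‖ ^ 2 := by positivity
  have t1' : |inner ℝ v' v.toL2| ≤ 2 * X := by simp only [X]; linarith
  rw [abs_le] at t1' t2
  unfold virial
  rw [abs_le]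
  constructor <;> linarith [t1'.1, t1'.2, t2.1, t2.2]

/-- The derivative of the virial functional along solutions. -/
lemma hasDerivWithinAt_virial (h : c.Admissible lamT hT) (hR : 0 ≤ R)
    (hu : h.IsTruncSol hR T u u') {t : ℝ} (ht : t ∈ Icc 0 T)
    (hb : ∀ x ∈ Icc (0 : ℝ) 1, |(u t).rep x| ≤ R) :
    HasDerivWithinAt (fun s => virial c lamT (u s) (u' s))
      (‖u' t‖ ^ 2 - ‖u t‖ ^ 2 + sourceMass c (u t) - 2 * hT * ((u t).rep 0 * (u t).rep 1))
      (Icc 0 T) t := by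
  have key := IsSol.hasDerivWithinAt_virial hu (dampL_symm c.lam0 c.lam1 lamT) ht
  refine HasDerivWithinAt.congr_deriv (f := fun s => virial c lamT (u s) (u' s)) key ?_
  have e1 : inner ℝ (source h.p_gt hR (u t).toL2) (h.data.ι (u t))
      = ∫ x in Ioo (0 : ℝ) 1, |(u t).rep x| ^ c.p :=
    (inner_source h.p_gt hR hb (u t)).trans
      (integral_congr_ae (Eventually.of_forall fun x => abs_rpow_sub_two_mul_sq h.p_gt _))
  have e2 : inner ℝ (bdrySource c hT R (traceL (u t))) (h.data.γ (u t))
      = |(u t).rep 0| ^ c.α + |(u t).rep 1| ^ c.β - 2 * hT * ((u t).rep 0 * (u t).rep 1) := by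
    change inner ℝ (bdrySource c hT R (traceL (u t))) (traceL (u t)) = _
    rw [inner_bdry, bdrySource, traceL_apply]
    simp only [WithLp.toLp_fst, WithLp.toLp_snd]
    rw [trunc_eq (hb 0 (by simp)), trunc_eq (hb 1 (by simp)),
      ← abs_rpow_sub_two_mul_sq h.α_gt, ← abs_rpow_sub_two_mul_sq h.β_gt]
    ring
  rw [e1, e2]
  unfold sourceMass
  ring

/-- Lower bound for the derivative of the virial functional in terms of the energy. -/
lemma virial_deriv_ge (hq : 2 < q) (hqp : q ≤ c.p) (hqα : q ≤ c.α)
    (hqβ : q ≤ c.β) (hh : |hT| < (q - 2) / (4 * (q + 2))) (v : H1) (v' : L2) :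
    (q + 2) / 2 * (potential c hT v - 1 / 2 * (‖v‖ ^ 2 + ‖v'‖ ^ 2)) + ‖v'‖ ^ 2
        + (q - 2) / (2 * q) * sourceMass c v
      ≤ ‖v'‖ ^ 2 - ‖v‖ ^ 2 + sourceMass c v - 2 * hT * (v.rep 0 * v.rep 1) := by
  have hq0 : 0 < q := by linarith
  have hP : potential c hT v ≤ 1 / q * sourceMass c v - hT * (v.rep 0 * v.rep 1) := by
    have i0 := mul_le_mul_of_nonneg_right (one_div_le_one_div_of_le hq0 hqp)
      (integral_abs_rpow_nonneg c.p v)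
    have i1 := mul_le_mul_of_nonneg_right (one_div_le_one_div_of_le hq0 hqα)
      (by positivity : 0 ≤ |v.rep 0| ^ c.α)
    have i2 := mul_le_mul_of_nonneg_right (one_div_le_one_div_of_le hq0 hqβ)
      (by positivity : 0 ≤ |v.rep 1| ^ c.β)
    unfold potential sourceMass
    linarith
  have h4 : |hT| ≤ 1 / 4 := by
    refine hh.le.trans ?_
    rw [div_le_div_iff₀ (by linarith) (by norm_num)]
    linarith
  have hprod : |v.rep 0 * v.rep 1| ≤ 2 * ‖v‖ ^ 2 := by
    have e0 := v.rep_sq_le (y := 0) (by simp)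
    have e1 := v.rep_sq_le (y := 1) (by simp)
    rw [abs_le]
    constructor <;> nlinarith [sq_nonneg (v.rep 0 + v.rep 1), sq_nonneg (v.rep 0 - v.rep 1)]
  have hm : |hT * (v.rep 0 * v.rep 1)| ≤ 1 / 4 * (2 * ‖v‖ ^ 2) := by
    rw [abs_mul]
    exact mul_le_mul h4 hprod (abs_nonneg _) (by norm_num)
  -- The coupling left over has coefficient (q - 2)/2, and with |h̃| ≤ 1/4 and the trace inequality
  -- it costs at most (q - 2)/4 ‖v‖². This is exactly the surplus (q + 2)/4 - 1 of the H¹ term.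
  have hm' := mul_le_mul_of_nonneg_left (abs_le.mp hm).1 (by linarith : 0 ≤ (q - 2) / 2)
  have hP' := mul_le_mul_of_nonneg_left hP (by linarith : 0 ≤ (q + 2) / 2)
  -- The multiplier (q + 2)/2, midway between 2 and q, leaves positive multiples of both the source
  -- mass and the energy.
  have e : (q + 2) / 2 * (1 / q * sourceMass c v) + (q - 2) / (2 * q) * sourceMass c v
      = sourceMass c v := by
    field_simp; ring
  have n1 : 0 ≤ (q + 2) / 4 * ‖v'‖ ^ 2 := by positivity
  nlinarith

/-- Solutions with negative initial energy are not global. -/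
theorem not_global (h : c.Admissible lamT hT) (hq : 2 < q) (hqp : q ≤ c.p) (hqα : q ≤ c.α)
    (hqβ : q ≤ c.β) (hh : |hT| < (q - 2) / (4 * (q + 2)))
    (hH : 0 < potential c hT u₀ - 1 / 2 * (‖u₀‖ ^ 2 + ‖u₁‖ ^ 2))
    (hu : ∀ S : ℝ, 0 < S → IsWeakSolutionOn c u₀ u₁ u u' S) : False := by
  set H₀ := potential c hT u₀ - 1 / 2 * (‖u₀‖ ^ 2 + ‖u₁‖ ^ 2) with hH₀
  have hq0 : 0 < q := by linarith
  obtain ⟨C, hC, hvir⟩ := h.exists_abs_virial_le hq hqp hqα hqβ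
  set m : ℝ → ℝ := fun t =>
    ‖u' t‖ ^ 2 - ‖u t‖ ^ 2 + sourceMass c (u t) - 2 * hT * ((u t).rep 0 * (u t).rep 1) with hm
  set W : ℝ → ℝ := fun t => 1 + ‖u' t‖ ^ 2 + sourceMass c (u t) with hW
  have hW1 : ∀ t, 1 ≤ W t := fun t => by
    have := sourceMass_nonneg c (u t)
    have := sq_nonneg ‖u' t‖
    simp only [hW]; linarith
  -- The reciprocal of the growth exponent 1/2 + 1/q, so that |M|^s is bounded by a multiple of `W`;
  -- it exceeds 1 precisely because q > 2.
  set s := 2 * q / (q + 2) with hs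
  have hs1 : 1 < s := by rw [hs, lt_div_iff₀ (by linarith)]; linarith
  set κ₀ := min ((q + 2) / 2 * H₀) ((q - 2) / (2 * q)) with hκ₀
  have hκ₀0 : 0 < κ₀ := lt_min (by positivity) (div_pos (by linarith) (by linarith))
  have both : ∀ t, 0 < t → HasDerivAt (fun s => virial c lamT (u s) (u' s)) (m t) t
      ∧ κ₀ * W t ≤ m t := by
    intro t ht
    have hS : 0 < t + 1 := by linarith
    have hsol := hu (t + 1) hS
    obtain ⟨R, hR, hb⟩ := exists_rep_bound hsol.continuousOn
    obtain ⟨h1, -⟩ := h.isTruncSol_of_isWeakSolutionOn hR hS hsol hb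
    have ht' : t ∈ Icc 0 (t + 1) := ⟨ht.le, by linarith⟩
    refine ⟨(h.hasDerivWithinAt_virial hR h1 ht' (hb t ht')).hasDerivAt
      (Icc_mem_nhds ht (by linarith)), ?_⟩
    have hE := h.energy_le hR h1 hb (t := t) ⟨ht.le, by linarith⟩
    rw [hsol.init, hsol.init_deriv] at hE
    have hV := virial_deriv_ge hq hqp hqα hqβ hh (u t) (u' t)
    have e0 : (q + 2) / 2 * H₀
        ≤ (q + 2) / 2 * (potential c hT (u t) - 1 / 2 * (‖u t‖ ^ 2 + ‖u' t‖ ^ 2)) :=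
      mul_le_mul_of_nonneg_left (by rw [hH₀]; linarith) (by linarith)
    have k1 : κ₀ ≤ (q + 2) / 2 * H₀ := min_le_left _ _
    have k2 : κ₀ ≤ (q - 2) / (2 * q) := min_le_right _ _
    have k3 : κ₀ ≤ 1 := k2.trans (by rw [div_le_one (by linarith)]; linarith)
    have k4 := mul_le_mul_of_nonneg_right k2 (sourceMass_nonneg c (u t))
    have k5 := mul_le_mul_of_nonneg_right k3 (sq_nonneg ‖u' t‖)
    simp only [hW, hm]
    linarith
  have hCs : 0 < C ^ s := Real.rpow_pos_of_pos hC s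
  refine not_superlinear_growth (κ := min κ₀ (κ₀ / C ^ s))
    (lt_min hκ₀0 (by positivity)) hs1 (fun t ht => (both t ht).1) (fun t ht => ?_) (fun t ht => ?_)
  · have := (both t ht).2
    have := hW1 t
    have : κ₀ ≤ κ₀ * W t := le_mul_of_one_le_right hκ₀0.le (hW1 t)
    linarith [min_le_left κ₀ (κ₀ / C ^ s)]
  · have hWt : 0 < W t := by linarith [hW1 t]
    have e1 : |virial c lamT (u t) (u' t)| ^ s ≤ C ^ s * W t := by
      refine (Real.rpow_le_rpow (abs_nonneg _) (hvir (u t) (u' t)) (by linarith)).trans ?_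
      rw [Real.mul_rpow hC.le (by positivity), ← Real.rpow_mul hWt.le]
      have : (1 / 2 + 1 / q) * s = 1 := by rw [hs]; field_simp
      rw [this, Real.rpow_one]
    calc min κ₀ (κ₀ / C ^ s) * |virial c lamT (u t) (u' t)| ^ s
        ≤ κ₀ / C ^ s * (C ^ s * W t) :=
          mul_le_mul (min_le_right _ _) e1 (by positivity) (by positivity)
      _ = κ₀ * W t := by field_simp
      _ ≤ m t := (both t ht).2

end Coeffs.Admissible

end TwoPointWave

end

/-! ### Conclusion: an infinite lifespan contradicts the virial argument, and a finite one forces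
blow-up of the norm. -/

theorem theorem3p1 (c : Coeffs) (lamT hT q : ℝ)
    (hp : 2 < c.p) (hα : 2 < c.α) (hβ : 2 < c.β) (hlam : 0 < c.lam)
    (hlam0 : 0 < c.lam0) (hlam1 : 0 < c.lam1)
    (hlamT0 : c.lamT0 = lamT) (hlamT1 : c.lamT1 = lamT)
    (hlamT : |lamT| < Real.sqrt (c.lam0 * c.lam1))
    (hhT0 : ∀ t : ℝ, 0 ≤ t → c.hT0 t = hT) (hhT1 : ∀ t : ℝ, 0 ≤ t → c.hT1 t = hT)
    (hq : q = min c.p (min c.α c.β))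
    (hhT : |hT| < (q - 2) / (4 * (q + 2)))
    (u₀ : H1) (u₁ : L2)
    (hH : 0 < -energy c u₀ u₁ - hT * u₀.rep 0 * u₀.rep 1)
    (u : ℝ → H1) (u' : ℝ → L2) (T : EReal)
    (hu : IsMaximalWeakSolution c u₀ u₁ u u' T) :
    ∃ Tmax : ℝ, T = (Tmax : EReal) ∧
      Tendsto (fun t : ℝ => ‖u' t‖ ^ 2 + ‖u t‖ ^ 2) (𝓝[<] Tmax) atTop := by
  have hq2 : 2 < q := by
    rw [hq]
    exact lt_min hp (lt_min hα hβ)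
  have hqp : q ≤ c.p := hq ▸ min_le_left _ _
  have hqα : q ≤ c.α := hq ▸ (min_le_right _ _).trans (min_le_left _ _)
  have hqβ : q ≤ c.β := hq ▸ (min_le_right _ _).trans (min_le_right _ _)
  have hdet : lamT ^ 2 < c.lam0 * c.lam1 := by
    rw [← sq_abs]
    exact (Real.lt_sqrt (abs_nonneg _)).mp hlamT
  have adm : c.Admissible lamT hT :=
    ⟨hp, hα, hβ, hlam.le, hlam0, hlam1, hlamT0, hlamT1, hdet, hhT0, hhT1⟩
  induction T with
  | bot => exact absurd hu.1.1 (by simp)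
  | top =>
    refine (adm.not_global hq2 hqp hqα hqβ hhT ?_
      fun S hS => hu.1.2 S hS (EReal.coe_lt_top S)).elim
    · have e : -energy c u₀ u₁ - hT * u₀.rep 0 * u₀.rep 1
          = potential c hT u₀ - 1 / 2 * (‖u₀‖ ^ 2 + ‖u₁‖ ^ 2) := by
        unfold energy potential
        ring
      rwa [← e]
  | coe Tmax => exact ⟨Tmax, rfl, adm.tendsto_of_maximal hu⟩
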